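/- **Theorem 2 (Quenched central limit theorem).** *Setting.* Let $\mathbb R_+=[0,\infty)$ and $\mathbb N=\{1,2,\dots\}$. Let $f:\mathbb R_+^2\to[0,1]$ be measurable with $f(x,y)+f(y,x)=1$ for all $x,y$. Let $\mu,\nu$ be Borel probability measures on $\mathbb R_+$, and let $\xi=(\xi_\ell)_{\ell\in\mathbb N}$ be an $\mathbb R_+$-valued process such that $\xi_\ell\sim\nu$ for all $\ell$ and $(\xi_\ell,\xi_k)\overset{d}{=}(\xi_{\ell+\tau},\xi_{k+\tau})$ for all $\ell,k,\tau\in\mathbb N$. Assume: * (weak mixing) for every $A\in\sigma(\xi_1)$ and all $B_\ell\in\sigma(\xi_\ell)$, $\ell\in\mathbb N$, one has $\frac1n\sum_{\ell=1}^n|\mathbb P(A\cap B_\ell)-\mathbb P(A)\mathbb P(B_\ell)|\to0$ as $n\to\infty$; * (strong mixing) with $$\alpha_n=\sup\bigl\{|\mathbb P(A\cap B)-\mathbb P(A)\mathbb P(B)| : k\in\mathbb N,\ A\in\sigma(\xi_1,\dots,\xi_k),\ B\in\sigma(\xi_{k+n},\xi_{k+n+1},\dots)\bigr\},$$ one has $\sum_{n\ge1}\alpha_n<\infty$,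 and there are integer sequences $p=p(n)\to\infty$, $q=q(n)\to\infty$ with $q=o(p)$, $p=o(n)$, $np^{-1}\alpha_q\to0$ and $\frac pn\sum_{j=1}^p j\alpha_j\to0$. *The league.* For each $n$ consider a league of $2n$ teams $T_0,\dots,T_{2n-1}$ with a fixed calendar of $2n-1$ days, in which each team plays exactly one match per day and exactly one match against each other team. Given $s\in\mathbb R_+$ and a deterministic sequence $\vec s=(s_i)_{i\in\mathbb N}\in\mathbb R_+^{\mathbb N}$, let $T_0$ have initial strength $s_0=s$ and $T_i$ initial strength $s_i$ for $1\le i\le 2n-1$. Let $\xi^0,\dots,\xi^{2n-1}$ be independent copies of $\xi$; the strength of $T_i$ on day $d$ is $s_i\,\xi^i_d$. Conditionally on $(\xi^i)_i$, the results of the matches are independent, and if $T_i$ plays $T_j$ on day $d$, then $T_i$ wins with probability $f(s_i\xi^i_d,s_j\xi^j_d)$ (otherwise $T_j$ wins). Let $\mathbb P_{\vec s}$, $\mathbb E_{\vec s}$ denote the resulting probability and expectation, and $W_n(s)$ the number of wins of $T_0$. *Constants.* Let $V,V'\sim\nu$ and $U,U'\sim\mu$ be independent of each other and of $\xi$, and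 put $\ell(s)=\mathbb E[f(sV,UV')]$, $F_s(x,y)=\mathbb E[f(sx,yV')]$, $\tilde F_s(x,y)=F_s(x,y)-\mathbb E[F_s(V,y)]$, $$\sigma(s)^2=\mathbb E\bigl[F_s(V,U)-F_s(V,U)^2\bigr],\qquad \rho(s)^2=\mathbb E\bigl[\tilde F_s(V,U)^2\bigr]+2\sum_{k=1}^\infty\mathbb E\bigl[\tilde F_s(\xi_1,U)\,\tilde F_s(\xi_{1+k},U')\bigr].$$ *Claim.* Fix the calendars and any $s\in\mathbb R_+$. Then $\sigma(s)^2=\ell(s)-\mathbb E[F_s(V,U)^2]$, the series defining $\rho(s)^2$ converges (absolutely), $\sigma(s)^2$ and $\rho(s)^2$ are nonnegative, and for $\mu^{\mathbb N}$-almost every $\vec s$, under $\mathbb P_{\vec s}$, $$\frac{W_n(s)-\mathbb E_{\vec s}[W_n(s)]}{\sqrt{2n}}\xrightarrow[n\to\infty]{d}\mathcal N\bigl(0,\sigma(s)^2+\rho(s)^2\bigr).$$ -/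

import Mathlib

open MeasureTheory ProbabilityTheory Filter Topology Asymptotics
open scoped NNReal unitInterval

noncomputable section

namespace League

/-! Times (days) and opponents are numbered from `0` instead of `1`: `ξ ℓ` is the value of the
process on day number `ℓ + 1`, and `S j` is the initial strength of the team `T_{j+1}`. -/

/-- The function `f : ℝ₊² → [0,1]`: a team of strength `x` beats a team of strength `y` with
probability `f x y`. Draws are impossible. -/
structure WinFunction where
  toFun : ℝ≥0 → ℝ≥0 → I
  measurable : Measurable (Function.uncurry toFun)
  no_draw : ∀ x y, (toFun x y : ℝ) + (toFun y x : ℝ) = 1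

instance : CoeFun WinFunction (fun _ => ℝ≥0 → ℝ≥0 → I) := ⟨WinFunction.toFun⟩

/-- A calendar for a league of `N + 1` teams `T_0, …, T_N` and `N` days: `day i j` is the day of
the match between `T_i` and `T_j` (the value for `i = j` is irrelevant). Every team plays exactly
one match on each of the `N` days, one against each other team. -/
structure Calendar (N : ℕ) where
  day : Fin (N + 1) → Fin (N + 1) → ℕ
  symm : ∀ i j, day i j = day j i
  bijOn : ∀ i, Set.BijOn (day i) {i}ᶜ (Set.Iio N)

/-- The matches of a league of `N + 1` teams: the pairs of teams, listed as `(i, j)`, `i < j`. -/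
abbrev Match (N : ℕ) : Type := {m : Fin (N + 1) × Fin (N + 1) // m.1 < m.2}

/-- The probability that the first team of the match `m` wins, when the initial strengths are `x`
and `e i` is the path of the process of the team `T_i`. -/
def winProb (f : WinFunction) {N : ℕ} (C : Calendar N) (x : Fin (N + 1) → ℝ≥0)
    (e : Fin (N + 1) → ℕ → ℝ≥0) (m : Match N) : I :=
  f (x m.1.1 * e m.1.1 (C.day m.1.1 m.1.2)) (x m.1.2 * e m.1.2 (C.day m.1.1 m.1.2))

/-- The conditional law of the results of all matches given the paths of the processes: the
results are independent, and the first team of `m` wins (`true`) with probability `winProb`. -/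
def condResults (f : WinFunction) {N : ℕ} (C : Calendar N) (x : Fin (N + 1) → ℝ≥0)
    (e : Fin (N + 1) → ℕ → ℝ≥0) : Measure (Match N → Bool) :=
  Measure.pi fun m => bernoulliMeasure true false (winProb f C x e m)

lemma measurable_condResults (f : WinFunction) {N : ℕ} (C : Calendar N)
    (x : Fin (N + 1) → ℝ≥0) : Measurable (condResults f C x) := by
  have hw : ∀ m : Match N, Measurable fun e => winProb f C x e m := by
    intro m
    have h : Measurable fun e : Fin (N + 1) → ℕ → ℝ≥0 =>
        (x m.1.1 * e m.1.1 (C.day m.1.1 m.1.2), x m.1.2 * e m.1.2 (C.day m.1.1 m.1.2)) := by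
      fun_prop
    exact f.measurable.comp h
  refine Measure.measurable_of_measurable_coe _ fun A _ => ?_
  have hA : ∀ e, condResults f C x e A = ∑ r ∈ A.toFinite.toFinset, condResults f C x e {r} := by
    intro e
    rw [sum_measure_singleton]
    simp
  simp_rw [hA, condResults, Measure.pi_singleton]
  refine Finset.measurable_sum _ fun r _ => Finset.measurable_prod _ fun m _ => ?_
  have hm := hw m
  have hs : Measurable fun e => unitInterval.toNNReal (winProb f C x e m) :=
    unitInterval.toNNReal_continuous.measurable.comp hm
  have hs' : Measurable fun e => unitInterval.toNNReal (σ (winProb f C x e m)) :=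
    unitInterval.toNNReal_continuous.measurable.comp
      (unitInterval.continuous_symm.measurable.comp hm)
  simp only [bernoulliMeasure_def, Measure.coe_add, Pi.add_apply, Measure.smul_apply]
  exact (hs.smul_const _).add (hs'.smul_const _)

/-- The law of the results of all matches of a league with deterministic initial strengths `x`,
when the processes of the teams are independent, each with path law `Q`. -/
def resultsLaw (f : WinFunction) (Q : ProbabilityMeasure (ℕ → ℝ≥0)) {N : ℕ} (C : Calendar N)
    (x : Fin (N + 1) → ℝ≥0) : ProbabilityMeasure (Match N → Bool) :=
  ⟨(Measure.pi fun _ : Fin (N + 1) => (Q : Measure (ℕ → ℝ≥0))).bind (condResults f C x),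
    isProbabilityMeasure_bind (measurable_condResults f C x).aemeasurable
      (Eventually.of_forall fun e => by unfold condResults; infer_instance)⟩

/-- The initial strengths of all teams: `s` for `T_0`, and `S 0, S 1, …` for `T_1, T_2, …`. -/
def strengths (s : ℝ≥0) (S : ℕ → ℝ≥0) (N : ℕ) : Fin (N + 1) → ℝ≥0 :=
  Fin.cons s fun j : Fin N => S j

/-- The quenched law `P_{S}` of the results of all matches: the initial strengths are `s` for `T_0`
and the deterministic sequence `S` for its opponents. -/
def quenchedLaw (f : WinFunction) (Q : ProbabilityMeasure (ℕ → ℝ≥0)) {N : ℕ} (C : Calendar N)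
    (s : ℝ≥0) (S : ℕ → ℝ≥0) : Measure (Match N → Bool) :=
  resultsLaw f Q C (strengths s S N)

instance (f : WinFunction) (Q : ProbabilityMeasure (ℕ → ℝ≥0)) {N : ℕ} (C : Calendar N)
    (s : ℝ≥0) (S : ℕ → ℝ≥0) : IsProbabilityMeasure (quenchedLaw f Q C s S) := by
  unfold quenchedLaw; infer_instance

/-- The number of wins of the team `T_0`. -/
def wins {N : ℕ} (r : Match N → Bool) : ℕ :=
  (Finset.univ.filter fun j : Fin N => r ⟨(0, j.succ), j.succ_pos⟩ = true).card

/-- The centred and rescaled number of wins `(W_n(s) - E[W_n(s)]) / √(2n)` of `T_0` in a league of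
`2n` teams, where `L` is the law of the results. -/
def normalizedWins (n : ℕ) (L : Measure (Match (2 * n - 1) → Bool)) (r : Match (2 * n - 1) → Bool) :
    ℝ :=
  ((wins r : ℝ) - ∫ r', (wins r' : ℝ) ∂L) / √(2 * (n : ℝ))

/-! ### The process of daily factors -/

section DailyFactors

variable {Ω : Type*} [MeasurableSpace Ω]

/-- The law of the path of the process `ξ`. -/
def pathLaw (P : Measure Ω) [IsProbabilityMeasure P] (ξ : ℕ → Ω → ℝ≥0)
    (hξ : ∀ ℓ, Measurable (ξ ℓ)) : ProbabilityMeasure (ℕ → ℝ≥0) :=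
  ⟨P.map fun ω ℓ => ξ ℓ ω,
    Measure.isProbabilityMeasure_map (measurable_pi_lambda _ hξ).aemeasurable⟩

/-- The `σ`-algebra generated by the `ξ ℓ`, `ℓ ∈ T`. -/
abbrev sigmaGen (ξ : ℕ → Ω → ℝ≥0) (T : Set ℕ) : MeasurableSpace Ω :=
  ⨆ ℓ ∈ T, MeasurableSpace.comap (ξ ℓ) inferInstance

/-- One-dimensional marginals `ν`, and shift-invariant two-dimensional marginals. -/
structure IsPairStationary (P : Measure Ω) (ξ : ℕ → Ω → ℝ≥0) (ν : Measure ℝ≥0) : Prop where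
  map_eq : ∀ ℓ, P.map (ξ ℓ) = ν
  map_pair_eq : ∀ ℓ k τ, P.map (fun ω => (ξ ℓ ω, ξ k ω)) =
    P.map (fun ω => (ξ (ℓ + τ) ω, ξ (k + τ) ω))

/-- Weak mixing, for sets of `σ(ξ_1)` and `σ(ξ_ℓ)`. -/
def IsWeaklyMixing (P : Measure Ω) (ξ : ℕ → Ω → ℝ≥0) : Prop :=
  ∀ (A : Set Ω) (B : ℕ → Set Ω), MeasurableSet[sigmaGen ξ {0}] A →
    (∀ ℓ, MeasurableSet[sigmaGen ξ {ℓ}] (B ℓ)) →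
    Tendsto (fun n : ℕ => (1 / (n : ℝ)) *
      ∑ ℓ ∈ Finset.range n, |P.real (A ∩ B ℓ) - P.real A * P.real (B ℓ)|) atTop (𝓝 0)

/-- The mixing coefficient `α_n`, for `n ≥ 1` (a supremum of a set of numbers in `[0,1]`). -/
def alpha (P : Measure Ω) (ξ : ℕ → Ω → ℝ≥0) (n : ℕ) : ℝ :=
  sSup {a | ∃ (k : ℕ) (A B : Set Ω), MeasurableSet[sigmaGen ξ (Set.Iic k)] A ∧
    MeasurableSet[sigmaGen ξ (Set.Ici (k + n))] B ∧
    a = |P.real (A ∩ B) - P.real A * P.real B|}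

/-- The mixing assumptions for the central limit theorem. -/
structure CLTMixing (P : Measure Ω) (ξ : ℕ → Ω → ℝ≥0) : Prop where
  summable_alpha : Summable fun n : ℕ => alpha P ξ (n + 1)
  exists_blocks : ∃ p q : ℕ → ℕ, Tendsto p atTop atTop ∧ Tendsto q atTop atTop ∧
    (fun n => (q n : ℝ)) =o[atTop] (fun n => (p n : ℝ)) ∧
    (fun n => (p n : ℝ)) =o[atTop] (fun n => (n : ℝ)) ∧
    Tendsto (fun n : ℕ => (n : ℝ) * (p n : ℝ)⁻¹ * alpha P ξ (q n)) atTop (𝓝 0) ∧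
    Tendsto (fun n : ℕ => (p n : ℝ) / (n : ℝ) *
      ∑ j ∈ Finset.Icc 1 (p n), (j : ℝ) * alpha P ξ j) atTop (𝓝 0)

/-! ### The constants of the limit theorem -/

/-- `ℓ(s) = E[f(s V, U V')]`. -/
def ell (f : WinFunction) (μ ν : Measure ℝ≥0) (s : ℝ≥0) : ℝ :=
  ∫ z, (f (s * z.1) (z.2.2 * z.2.1) : ℝ) ∂(ν.prod (ν.prod μ))

/-- `F_s(x, y) = E[f(s x, y V')]`. -/
def F (f : WinFunction) (ν : Measure ℝ≥0) (s x y : ℝ≥0) : ℝ :=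
  ∫ v, (f (s * x) (y * v) : ℝ) ∂ν

/-- `F̃_s(x, y) = F_s(x, y) - E[F_s(V, y)]`. -/
def Ftilde (f : WinFunction) (ν : Measure ℝ≥0) (s x y : ℝ≥0) : ℝ :=
  F f ν s x y - ∫ v, F f ν s v y ∂ν

/-- `σ(s)² = E[F_s(V, U) - F_s(V, U)²]`. -/
def sigmaSq (f : WinFunction) (μ ν : Measure ℝ≥0) (s : ℝ≥0) : ℝ :=
  ∫ z, (F f ν s z.1 z.2 - F f ν s z.1 z.2 ^ 2) ∂(ν.prod μ)

/-- `E[F̃_s(ξ_1, U) F̃_s(ξ_{1+k}, U')]`, with `ξ`, `U`, `U'` independent. -/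
def covTerm (f : WinFunction) (μ ν : Measure ℝ≥0) (P : Measure Ω) (ξ : ℕ → Ω → ℝ≥0)
    (s : ℝ≥0) (k : ℕ) : ℝ :=
  ∫ z, Ftilde f ν s (ξ 0 z.1) z.2.1 * Ftilde f ν s (ξ k z.1) z.2.2 ∂(P.prod (μ.prod μ))

/-- `ρ(s)² = E[F̃_s(V, U)²] + 2 ∑_{k ≥ 1} E[F̃_s(ξ_1, U) F̃_s(ξ_{1+k}, U')]`. -/
def rhoSq (f : WinFunction) (μ ν : Measure ℝ≥0) (P : Measure Ω) (ξ : ℕ → Ω → ℝ≥0)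
    (s : ℝ≥0) : ℝ :=
  (∫ z, Ftilde f ν s z.1 z.2 ^ 2 ∂(ν.prod μ)) + 2 * ∑' k : ℕ, covTerm f μ ν P ξ s (k + 1)

end DailyFactors

end League

end

/-! `T_0` meets every opponent exactly once, so of an opponent's path only one value, of law `ν`,
ever matters. After averaging over the opponents, the matches of `T_0` are, given its own path `ξ`,
independent Bernoulli trials: on day `d`, against an opponent of initial strength `y_d`, the
parameter is `F_s(ξ_d, y_d)`. The centred number of wins thus splits into the sum of the centred
trials and the sum of the `F̃_s(ξ_d, y_d)`, a functional of `ξ` alone; `integral_exp_centred_wins`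
is this splitting inside the characteristic function.

Given `ξ`, the first sum is nearly Gaussian, with variance the sum of `F_s - F_s²` over the days.
Mixing keeps this variance within `O(√n)` of its mean in `L¹`, so after division by `2n` its limit
is the constant `σ(s)²`. A deterministic conditional variance means that the first sum contributes a
separate Gaussian factor (`norm_integral_prod_bernoulli_sub_le`).

The second sum is treated by Bernstein's method (`norm_charFun_sub_exp_le`): long blocks are
separated by short gaps, the gaps are negligible in `L²`, the blocks are almost independent, and
each block is short enough for a second-order Taylor expansion. Since `α` is nonincreasing and
summable, `n α_n → 0`; blocks of length about `√n / M` with gaps shorter by a further factor `M`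
then suffice, letting first `n` and then `M` tend to infinity (`tendsto_charFun_sub_exp`).

The strengths `S` enter only through averages over the days of functions of `y_d` or of `(y_d,
y_{d+k})`. These converge almost surely by sub-Gaussian tail bounds and Borel–Cantelli, however the
calendars rearrange the opponents as `n` varies (`ae_tendsto_average`, `ae_tendsto_pair_average`).
Summing the covariances lag by lag, with domination by `4 α_k`, the variance of the second sum
divided by `2n` tends to `ρ(s)²` (`tendsto_variance`), which is therefore nonnegative. -/

noncomputable section

namespace League

set_option linter.unusedSectionVars false

/-! ### Covariance inequalities under strong mixing. -/

section Covariance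

variable {Ω : Type*} {𝓐 𝓑 mΩ : MeasurableSpace Ω}

/-- Layer cake: each integral is the integral over `t ∈ (0, 1]` of the measure of `{t ≤ X}`, an
event of `𝓑`. Two arbitrary finite measures are allowed so that the bound can be used once for each
factor of a covariance. -/
lemma abs_integral_sub_integral_le_of_measureReal (h𝓑 : 𝓑 ≤ mΩ)
    {m₁ m₂ : Measure Ω} [IsFiniteMeasure m₁] [IsFiniteMeasure m₂] {a : ℝ}
    (h : ∀ B, MeasurableSet[𝓑] B → |m₁.real B - m₂.real B| ≤ a)
    {X : Ω → ℝ} (hX : Measurable[𝓑] X) (h0 : ∀ ω, 0 ≤ X ω) (h1 : ∀ ω, X ω ≤ 1) :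
    |∫ ω, X ω ∂m₁ - ∫ ω, X ω ∂m₂| ≤ a := by
  have hXm : Measurable X := hX.mono h𝓑 le_rfl
  have hint : ∀ (m : Measure Ω) [IsFiniteMeasure m], Integrable X m := fun m _ =>
    Integrable.of_bound hXm.aestronglyMeasurable 1
      (Eventually.of_forall fun ω => by rw [Real.norm_of_nonneg (h0 ω)]; exact h1 ω)
  have key : ∀ (m : Measure Ω) [IsFiniteMeasure m],
      ∫ ω, X ω ∂m = ∫ t in Set.Ioc (0 : ℝ) 1, m.real {ω | t ≤ X ω} := fun m _ =>
    (hint m).integral_eq_integral_Ioc_meas_le (Eventually.of_forall h0) (Eventually.of_forall h1)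
  have hmeas : ∀ (m : Measure Ω) [IsFiniteMeasure m],
      IntegrableOn (fun t : ℝ => m.real {ω | t ≤ X ω}) (Set.Ioc 0 1) := by
    intro m _
    have hanti : Antitone fun t : ℝ => m.real {ω | t ≤ X ω} := fun t t' htt' =>
      measureReal_mono fun ω (hω : t' ≤ X ω) => htt'.trans hω
    refine Integrable.of_bound hanti.measurable.aestronglyMeasurable (m.real Set.univ)
      (Eventually.of_forall fun t => ?_)
    rw [Real.norm_of_nonneg measureReal_nonneg]
    exact measureReal_mono (Set.subset_univ _)
  rw [key m₁, key m₂, ← integral_sub (hmeas m₁) (hmeas m₂), ← Real.norm_eq_abs]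
  refine (norm_setIntegral_le_of_norm_le_const (C := a) (by simp) fun t _ => ?_).trans (by simp)
  exact h _ (hX measurableSet_Ici)

variable {P : Measure Ω} [IsProbabilityMeasure P] {a : ℝ}

/-- The passage from events to functions is made one factor at a time: for a fixed event `A`,
compare `P` restricted to `A` with `P(A) P`; then compare the measure of density `Y` with `E[Y] P`.
-/
lemma abs_cov_le_of_mem_unitInterval (h𝓐 : 𝓐 ≤ mΩ) (h𝓑 : 𝓑 ≤ mΩ)
    (h : ∀ A B, MeasurableSet[𝓐] A → MeasurableSet[𝓑] B →
      |P.real (A ∩ B) - P.real A * P.real B| ≤ a)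
    {X Y : Ω → ℝ} (hX : Measurable[𝓐] X) (hY : Measurable[𝓑] Y)
    (hX0 : ∀ ω, 0 ≤ X ω) (hX1 : ∀ ω, X ω ≤ 1) (hY0 : ∀ ω, 0 ≤ Y ω) (hY1 : ∀ ω, Y ω ≤ 1) :
    |∫ ω, X ω * Y ω ∂P - (∫ ω, X ω ∂P) * ∫ ω, Y ω ∂P| ≤ a := by
  have hXm : Measurable X := hX.mono h𝓐 le_rfl
  have hYm : Measurable Y := hY.mono h𝓑 le_rfl
  have hYint : Integrable Y P := Integrable.of_bound hYm.aestronglyMeasurable 1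
      (Eventually.of_forall fun ω => by rw [Real.norm_of_nonneg (hY0 ω)]; exact hY1 ω)
  have step : ∀ A, MeasurableSet[𝓐] A →
      |∫ ω in A, Y ω ∂P - P.real A * ∫ ω, Y ω ∂P| ≤ a := by
    intro A hA
    have := abs_integral_sub_integral_le_of_measureReal h𝓑 (m₁ := P.restrict A)
      (m₂ := (P A).toNNReal • P) (a := a) ?_ hY hY0 hY1
    · rwa [integral_smul_nnreal_measure, NNReal.smul_def, ENNReal.coe_toNNReal_eq_toReal] at this
    · intro B hB
      have := h A B hA hB
      rw [measureReal_restrict_apply (h𝓑 _ hB), Set.inter_comm]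
      simpa [measureReal_def, NNReal.smul_def] using this
  have hlt : ∫⁻ ω, ENNReal.ofReal (Y ω) ∂P ≠ ⊤ := hYint.lintegral_lt_top.ne
  have : IsFiniteMeasure (P.withDensity fun ω => ENNReal.ofReal (Y ω)) :=
    isFiniteMeasure_withDensity hlt
  have hEY : 0 ≤ ∫ ω, Y ω ∂P := integral_nonneg hY0
  have := abs_integral_sub_integral_le_of_measureReal h𝓐
    (m₁ := P.withDensity fun ω => ENNReal.ofReal (Y ω))
    (m₂ := (∫ ω, Y ω ∂P).toNNReal • P) (a := a) ?_ hX hX0 hX1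
  · rw [integral_withDensity_eq_integral_toReal_smul (by fun_prop) (by simp),
      integral_smul_nnreal_measure, NNReal.smul_def, Real.coe_toNNReal _ hEY] at this
    simp only [ENNReal.toReal_ofReal (hY0 _), smul_eq_mul] at this
    rw [mul_comm (∫ ω, X ω ∂P)]
    simpa only [mul_comm (X _)] using this
  · intro A hA
    have h2 := step A hA
    rw [measureReal_def, withDensity_apply _ (h𝓐 _ hA),
      ← ofReal_integral_eq_lintegral_ofReal hYint.restrict (Eventually.of_forall hY0),
      ENNReal.toReal_ofReal (integral_nonneg hY0), measureReal_nnreal_smul_apply,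
      Real.coe_toNNReal _ hEY, mul_comm (∫ ω, Y ω ∂P)]
    exact h2

/-- The maps `(X + 1) / 2` and `(Y + 1) / 2` take values in `[0, 1]` and divide the covariance by
`4`. -/
lemma abs_cov_le_of_abs_le_one (h𝓐 : 𝓐 ≤ mΩ) (h𝓑 : 𝓑 ≤ mΩ)
    (h : ∀ A B, MeasurableSet[𝓐] A → MeasurableSet[𝓑] B →
      |P.real (A ∩ B) - P.real A * P.real B| ≤ a)
    {X Y : Ω → ℝ} (hX : Measurable[𝓐] X) (hY : Measurable[𝓑] Y)
    (hX1 : ∀ ω, |X ω| ≤ 1) (hY1 : ∀ ω, |Y ω| ≤ 1) :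
    |∫ ω, X ω * Y ω ∂P - (∫ ω, X ω ∂P) * ∫ ω, Y ω ∂P| ≤ 4 * a := by
  have hXm : Measurable X := hX.mono h𝓐 le_rfl
  have hYm : Measurable Y := hY.mono h𝓑 le_rfl
  have hXint : Integrable X P := Integrable.of_bound hXm.aestronglyMeasurable 1
    (Eventually.of_forall hX1)
  have hYint : Integrable Y P := Integrable.of_bound hYm.aestronglyMeasurable 1
    (Eventually.of_forall hY1)
  have hXYint : Integrable (fun ω => X ω * Y ω) P :=
    hYint.bdd_mul hXm.aestronglyMeasurable (c := 1) (Eventually.of_forall hX1)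
  have key := abs_cov_le_of_mem_unitInterval h𝓐 h𝓑 h
    (X := fun ω => (X ω + 1) / 2) (Y := fun ω => (Y ω + 1) / 2)
    ((hX.add_const 1).div_const 2) ((hY.add_const 1).div_const 2)
    (fun ω => by linarith [(abs_le.1 (hX1 ω)).1]) (fun ω => by linarith [(abs_le.1 (hX1 ω)).2])
    (fun ω => by linarith [(abs_le.1 (hY1 ω)).1]) (fun ω => by linarith [(abs_le.1 (hY1 ω)).2])
  have e1 : ∫ ω, (X ω + 1) / 2 * ((Y ω + 1) / 2) ∂P
      = (∫ ω, X ω * Y ω ∂P + ∫ ω, X ω ∂P + ∫ ω, Y ω ∂P + 1) / 4 := by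
    have : ∀ ω, (X ω + 1) / 2 * ((Y ω + 1) / 2) = (X ω * Y ω + X ω + Y ω + 1) / 4 :=
      fun ω => by ring
    simp_rw [this]
    have i1 : Integrable (fun ω => X ω * Y ω + X ω) P := hXYint.add hXint
    have i2 : Integrable (fun ω => X ω * Y ω + X ω + Y ω) P := i1.add hYint
    rw [integral_div, integral_add i2 (integrable_const 1), integral_add i1 hYint,
      integral_add hXYint hXint]
    simp
  have e2 : ∀ {Z : Ω → ℝ}, Integrable Z P →
      ∫ ω, (Z ω + 1) / 2 ∂P = (∫ ω, Z ω ∂P + 1) / 2 := by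
    intro Z hZ
    rw [integral_div, integral_add hZ (integrable_const 1)]
    simp
  rw [e1, e2 hXint, e2 hYint] at key
  rw [abs_le] at key ⊢
  constructor <;> nlinarith [key.1, key.2]

/-- The real and imaginary parts of the covariance are combinations of four real covariances, each
at most `4 a`. -/
lemma norm_cov_le_of_norm_le_one (h𝓐 : 𝓐 ≤ mΩ) (h𝓑 : 𝓑 ≤ mΩ)
    (h : ∀ A B, MeasurableSet[𝓐] A → MeasurableSet[𝓑] B →
      |P.real (A ∩ B) - P.real A * P.real B| ≤ a)
    {X Y : Ω → ℂ} (hX : Measurable[𝓐] X) (hY : Measurable[𝓑] Y)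
    (hX1 : ∀ ω, ‖X ω‖ ≤ 1) (hY1 : ∀ ω, ‖Y ω‖ ≤ 1) :
    ‖∫ ω, X ω * Y ω ∂P - (∫ ω, X ω ∂P) * ∫ ω, Y ω ∂P‖ ≤ 16 * a := by
  have hXm : Measurable X := hX.mono h𝓐 le_rfl
  have hYm : Measurable Y := hY.mono h𝓑 le_rfl
  have hXint : Integrable X P := Integrable.of_bound hXm.aestronglyMeasurable 1
    (Eventually.of_forall hX1)
  have hYint : Integrable Y P := Integrable.of_bound hYm.aestronglyMeasurable 1
    (Eventually.of_forall hY1)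
  have hXYint : Integrable (fun ω => X ω * Y ω) P :=
    hYint.bdd_mul hXm.aestronglyMeasurable (c := 1) (Eventually.of_forall hX1)
  have hXr : Measurable[𝓐] fun ω => (X ω).re := Complex.measurable_re.comp hX
  have hXi : Measurable[𝓐] fun ω => (X ω).im := Complex.measurable_im.comp hX
  have hYr : Measurable[𝓑] fun ω => (Y ω).re := Complex.measurable_re.comp hY
  have hYi : Measurable[𝓑] fun ω => (Y ω).im := Complex.measurable_im.comp hY
  have bXr : ∀ ω, |(X ω).re| ≤ 1 := fun ω => (Complex.abs_re_le_norm _).trans (hX1 ω)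
  have bXi : ∀ ω, |(X ω).im| ≤ 1 := fun ω => (Complex.abs_im_le_norm _).trans (hX1 ω)
  have bYr : ∀ ω, |(Y ω).re| ≤ 1 := fun ω => (Complex.abs_re_le_norm _).trans (hY1 ω)
  have bYi : ∀ ω, |(Y ω).im| ≤ 1 := fun ω => (Complex.abs_im_le_norm _).trans (hY1 ω)
  have intmul : ∀ {U V : Ω → ℝ}, Measurable[𝓐] U → Measurable[𝓑] V → (∀ ω, |U ω| ≤ 1) →
      (∀ ω, |V ω| ≤ 1) → Integrable (fun ω => U ω * V ω) P := by
    intro U V hU hV bU bV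
    exact (Integrable.of_bound (hV.mono h𝓑 le_rfl).aestronglyMeasurable 1
      (Eventually.of_forall bV)).bdd_mul (hU.mono h𝓐 le_rfl).aestronglyMeasurable (c := 1)
      (Eventually.of_forall bU)
  have c1 := abs_cov_le_of_abs_le_one h𝓐 h𝓑 h hXr hYr bXr bYr
  have c2 := abs_cov_le_of_abs_le_one h𝓐 h𝓑 h hXi hYi bXi bYi
  have c3 := abs_cov_le_of_abs_le_one h𝓐 h𝓑 h hXr hYi bXr bYi
  have c4 := abs_cov_le_of_abs_le_one h𝓐 h𝓑 h hXi hYr bXi bYr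
  have re_int : ∀ {Z : Ω → ℂ}, Integrable Z P → (∫ ω, Z ω ∂P).re = ∫ ω, (Z ω).re ∂P :=
    fun hZ => (integral_re hZ).symm
  have im_int : ∀ {Z : Ω → ℂ}, Integrable Z P → (∫ ω, Z ω ∂P).im = ∫ ω, (Z ω).im ∂P :=
    fun hZ => (integral_im hZ).symm
  refine (Complex.norm_le_abs_re_add_abs_im _).trans ?_
  simp only [Complex.sub_re, Complex.sub_im, Complex.mul_re, Complex.mul_im, re_int hXint,
    re_int hYint, im_int hXint, im_int hYint, re_int hXYint, im_int hXYint]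
  rw [integral_sub (intmul hXr hYr bXr bYr) (intmul hXi hYi bXi bYi),
    integral_add (intmul hXr hYi bXr bYi) (intmul hXi hYr bXi bYr)]
  rw [abs_le] at c1 c2 c3 c4
  have h1 : ∀ {u v x y : ℝ}, -(4 * a) ≤ u - x → u - x ≤ 4 * a → -(4 * a) ≤ v - y →
      v - y ≤ 4 * a → |u - v - (x - y)| ≤ 8 * a := by
    intro u v x y _ _ _ _
    rw [abs_le]; constructor <;> linarith
  have h2 : ∀ {u v x y : ℝ}, -(4 * a) ≤ u - x → u - x ≤ 4 * a → -(4 * a) ≤ v - y →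
      v - y ≤ 4 * a → |u + v - (x + y)| ≤ 8 * a := by
    intro u v x y _ _ _ _
    rw [abs_le]; constructor <;> linarith
  linarith [h1 c1.1 c1.2 c2.1 c2.2, h2 c3.1 c3.2 c4.1 c4.2]

end Covariance

/-! ### Elementary estimates for exponentials. -/

section Exponential

lemma norm_prod_sub_prod_le {ι : Type*} (s : Finset ι) {a b : ι → ℂ} (ha : ∀ i ∈ s, ‖a i‖ ≤ 1)
    (hb : ∀ i ∈ s, ‖b i‖ ≤ 1) : ‖∏ i ∈ s, a i - ∏ i ∈ s, b i‖ ≤ ∑ i ∈ s, ‖a i - b i‖ := by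
  classical
  induction s using Finset.induction_on with
  | empty => simp
  | insert j s hj ih =>
    rw [Finset.prod_insert hj, Finset.prod_insert hj, Finset.sum_insert hj]
    have e : a j * ∏ i ∈ s, a i - b j * ∏ i ∈ s, b i
        = (a j - b j) * ∏ i ∈ s, a i + b j * (∏ i ∈ s, a i - ∏ i ∈ s, b i) := by ring
    have h1 : ‖∏ i ∈ s, a i‖ ≤ 1 := by
      rw [norm_prod]
      exact Finset.prod_le_one (fun _ _ => norm_nonneg _)
        fun i hi => ha i (Finset.mem_insert_of_mem hi)
    have h2 := ih (fun i hi => ha i (Finset.mem_insert_of_mem hi))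
      fun i hi => hb i (Finset.mem_insert_of_mem hi)
    rw [e]
    refine (norm_add_le _ _).trans (add_le_add ?_ ?_)
    · rw [norm_mul]
      exact mul_le_of_le_one_right (norm_nonneg _) h1
    · rw [norm_mul]
      exact (mul_le_of_le_one_left (norm_nonneg _) (hb j (Finset.mem_insert_self _ _))).trans h2

/-- The Taylor remainder covers `|y| ≤ 1`. For `|y| ≥ 1` the terms are bounded separately by `2 +
|y| + y² / 2 ≤ 4 |y|³`, so no smallness of `y` is needed. -/
lemma norm_exp_I_mul_sub_quadratic_le (y : ℝ) :
    ‖Complex.exp (Complex.I * y) - (1 + Complex.I * y - (y : ℂ) ^ 2 / 2)‖ ≤ 4 * |y| ^ 3 := by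
  have hn : ‖Complex.I * (y : ℂ)‖ = |y| := by simp
  rcases le_total |y| 1 with h | h
  · have := Complex.exp_bound (x := Complex.I * y) (by rw [hn]; exact h) (n := 3) (by norm_num)
    simp only [Finset.sum_range_succ, Finset.sum_range_zero, hn] at this
    have e : (0 : ℂ) + (Complex.I * y) ^ 0 / (Nat.factorial 0 : ℕ)
        + (Complex.I * y) ^ 1 / (Nat.factorial 1 : ℕ) + (Complex.I * y) ^ 2 / (Nat.factorial 2 : ℕ)
        = 1 + Complex.I * y - (y : ℂ) ^ 2 / 2 := by
      simp [mul_pow]; ring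
    rw [e] at this
    refine this.trans ?_
    have h3 : 0 ≤ |y| ^ 3 := by positivity
    norm_num [Nat.factorial]
    linarith
  · have h1 : ‖Complex.exp (Complex.I * y)‖ = 1 := Complex.norm_exp_I_mul_ofReal y
    have h2 : ‖(1 : ℂ) + Complex.I * y - (y : ℂ) ^ 2 / 2‖ ≤ 1 + |y| + |y| ^ 2 / 2 := by
      refine (norm_sub_le _ _).trans (add_le_add ((norm_add_le _ _).trans (by simp)) ?_)
      simp
    refine (norm_sub_le _ _).trans ?_
    rw [h1]
    nlinarith [mul_le_mul h h (by norm_num) (by positivity),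
      pow_le_pow_right₀ h (show 2 ≤ 3 by norm_num), pow_le_pow_right₀ h (show 1 ≤ 3 by norm_num)]

lemma abs_exp_neg_sub_linear_le {x : ℝ} (hx : 0 ≤ x) : |Real.exp (-x) - (1 - x)| ≤ x ^ 2 := by
  have h0 : 0 ≤ Real.exp (-x) - (1 - x) := by linarith [Real.add_one_le_exp (-x)]
  rw [abs_of_nonneg h0]
  rcases le_total x 1 with h | h
  · have := Real.norm_exp_sub_one_sub_id_le (x := -x) (by rwa [norm_neg, Real.norm_of_nonneg hx])
    rw [norm_neg, Real.norm_of_nonneg hx, Real.norm_eq_abs] at this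
    linarith [le_abs_self (Real.exp (-x) - 1 - -x)]
  · have : Real.exp (-x) ≤ 1 := Real.exp_le_one_iff.2 (by linarith)
    nlinarith

lemma abs_exp_neg_sub_exp_neg_le {x y : ℝ} (hx : 0 ≤ x) (hy : 0 ≤ y) :
    |Real.exp (-x) - Real.exp (-y)| ≤ |x - y| := by
  wlog h : x ≤ y generalizing x y
  · rw [abs_sub_comm, abs_sub_comm x y]
    exact this hy hx (le_of_not_ge h)
  have h1 : Real.exp (-y) ≤ Real.exp (-x) := Real.exp_le_exp.2 (by linarith)
  have h2 : Real.exp (-y) = Real.exp (-x) * Real.exp (x - y) := by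
    rw [← Real.exp_add]; ring_nf
  have h3 : Real.exp (-x) ≤ 1 := Real.exp_le_one_iff.2 (by linarith)
  have h4 := Real.add_one_le_exp (x - y)
  have h5 : Real.exp (x - y) ≤ 1 := Real.exp_le_one_iff.2 (by linarith)
  rw [abs_of_nonneg (by linarith), abs_of_nonpos (by linarith)]
  nlinarith [Real.exp_pos (-x)]

lemma norm_exp_I_mul_sub_exp_I_mul_le (x y : ℝ) :
    ‖Complex.exp (Complex.I * x) - Complex.exp (Complex.I * y)‖ ≤ |x - y| := by
  have e : Complex.exp (Complex.I * x) - Complex.exp (Complex.I * y)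
      = Complex.exp (Complex.I * y) * (Complex.exp (Complex.I * (x - y : ℝ)) - 1) := by
    rw [mul_sub, ← Complex.exp_add, mul_one]
    congr 2
    push_cast; ring
  rw [e, norm_mul, Complex.norm_exp_I_mul_ofReal, one_mul]
  exact Real.norm_exp_I_mul_ofReal_sub_one_le

end Exponential

/-! ### The mixing coefficients. -/

section Alpha

lemma sigmaGen_mono {Ω : Type*} {ξ : ℕ → Ω → ℝ≥0} {T T' : Set ℕ} (h : T ⊆ T') :
    sigmaGen ξ T ≤ sigmaGen ξ T' :=
  biSup_mono h

variable {Ω : Type*} [mΩ : MeasurableSpace Ω] {P : Measure Ω} [IsProbabilityMeasure P]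
  {ξ : ℕ → Ω → ℝ≥0}

lemma sigmaGen_le (hξ : ∀ ℓ, Measurable (ξ ℓ)) (T : Set ℕ) : sigmaGen ξ T ≤ mΩ :=
  iSup₂_le fun ℓ _ => (hξ ℓ).comap_le

lemma bddAbove_alpha_set (P : Measure Ω) [IsProbabilityMeasure P] (ξ : ℕ → Ω → ℝ≥0) (n : ℕ) :
    BddAbove {a | ∃ (k : ℕ) (A B : Set Ω), MeasurableSet[sigmaGen ξ (Set.Iic k)] A ∧
      MeasurableSet[sigmaGen ξ (Set.Ici (k + n))] B ∧
      a = |P.real (A ∩ B) - P.real A * P.real B|} := by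
  refine ⟨1, ?_⟩
  rintro _ ⟨k, A, B, -, -, rfl⟩
  have h1 : P.real (A ∩ B) ≤ 1 := measureReal_le_one
  have h2 : P.real A ≤ 1 := measureReal_le_one
  have h3 : P.real B ≤ 1 := measureReal_le_one
  have h4 : 0 ≤ P.real (A ∩ B) := measureReal_nonneg
  have h5 : 0 ≤ P.real A := measureReal_nonneg
  have h6 : 0 ≤ P.real B := measureReal_nonneg
  rw [abs_le]
  constructor <;> nlinarith

lemma le_alpha {k n : ℕ} {A B : Set Ω} (hA : MeasurableSet[sigmaGen ξ (Set.Iic k)] A)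
    (hB : MeasurableSet[sigmaGen ξ (Set.Ici (k + n))] B) :
    |P.real (A ∩ B) - P.real A * P.real B| ≤ alpha P ξ n :=
  le_csSup (bddAbove_alpha_set P ξ n) ⟨k, A, B, hA, hB, rfl⟩

lemma alpha_nonneg (n : ℕ) : 0 ≤ alpha P ξ n :=
  (abs_nonneg _).trans (le_alpha (P := P) (ξ := ξ) (k := 0) (n := n)
    (@MeasurableSet.empty _ (_)) (@MeasurableSet.empty _ (_)))

lemma alpha_antitone : Antitone (alpha P ξ) := by
  intro m n hmn
  refine csSup_le_csSup (bddAbove_alpha_set P ξ m) ?_ ?_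
  · exact ⟨_, 0, ∅, ∅, @MeasurableSet.empty _ (_), @MeasurableSet.empty _ (_), rfl⟩
  · rintro _ ⟨k, A, B, hA, hB, rfl⟩
    exact ⟨k, A, B, hA, sigmaGen_mono (Set.Ici_subset_Ici.2 (by omega)) _ hB, rfl⟩

/-- A nonincreasing summable sequence is `o(1/n)`: the `n/2 + 1` terms of index `n/2, …, 2(n/2)` all
dominate `α_{n+1}`, and their sum is at most a tail of the series. -/
lemma tendsto_mul_alpha (hα : Summable fun n : ℕ => alpha P ξ (n + 1)) :
    Tendsto (fun n : ℕ => ((n + 1 : ℕ) : ℝ) * alpha P ξ (n + 1)) atTop (𝓝 0) := by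
  have hα' : Summable fun n : ℕ => alpha P ξ n := (summable_nat_add_iff 1).1 hα
  have h1 : Tendsto (fun n : ℕ => ∑' k, alpha P ξ (k + n)) atTop (𝓝 0) :=
    tendsto_sum_nat_add _
  have hhalf : Tendsto (fun n : ℕ => n / 2) atTop atTop :=
    Nat.tendsto_div_const_atTop (by norm_num)
  have h2 := ((h1.comp hhalf).const_mul 4)
  rw [mul_zero] at h2
  refine squeeze_zero (fun n => mul_nonneg (Nat.cast_nonneg _) (alpha_nonneg _)) (fun n => ?_) h2
  have hs : ∑ k ∈ Finset.range (n / 2 + 1), alpha P ξ (k + n / 2)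
      ≤ ∑' k, alpha P ξ (k + n / 2) :=
    ((summable_nat_add_iff (n / 2)).2 hα').sum_le_tsum _ fun _ _ => alpha_nonneg _
  have hc : ((n / 2 + 1 : ℕ) : ℝ) * alpha P ξ (n + 1)
      ≤ ∑ k ∈ Finset.range (n / 2 + 1), alpha P ξ (k + n / 2) := by
    rw [← Finset.card_range (n / 2 + 1), ← nsmul_eq_mul, Finset.card_range]
    have := Finset.card_nsmul_le_sum (Finset.range (n / 2 + 1)) (fun k => alpha P ξ (k + n / 2))
      (alpha P ξ (n + 1)) fun k hk => alpha_antitone (by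
        have := Finset.mem_range.1 hk; omega)
    simpa using this
  have hn : ((n + 1 : ℕ) : ℝ) ≤ 4 * ((n / 2 + 1 : ℕ) : ℝ) := by
    have : n + 1 ≤ 4 * (n / 2 + 1) := by omega
    exact_mod_cast this
  have := mul_le_mul_of_nonneg_right hn (alpha_nonneg (P := P) (ξ := ξ) (n + 1))
  simp only [Function.comp]
  linarith

end Alpha

/-! ### Second moments of sums of centred functionals. -/

section MixingArray

variable {Ω : Type*} [mΩ : MeasurableSpace Ω] {P : Measure Ω} [IsProbabilityMeasure P]
  {ξ : ℕ → Ω → ℝ≥0}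

/-- A sequence of centred random variables with values in `[-1, 1]`, the `d`-th of which is a
function of `ξ d`. -/
structure IsCentredFunctional (P : Measure Ω) (ξ : ℕ → Ω → ℝ≥0) (Z : ℕ → Ω → ℝ) : Prop where
  measurable : ∀ d, Measurable[sigmaGen ξ {d}] (Z d)
  abs_le_one : ∀ d ω, |Z d ω| ≤ 1
  integral_eq_zero : ∀ d, ∫ ω, Z d ω ∂P = 0

/-- The bound `1 + 8 ∑ α_n` for the sum of the covariances of one variable with all others. -/
def covConst (P : Measure Ω) (ξ : ℕ → Ω → ℝ≥0) : ℝ := 1 + 8 * ∑' n, alpha P ξ (n + 1)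

lemma one_le_covConst : 1 ≤ covConst P ξ := by
  have : 0 ≤ ∑' n, alpha P ξ (n + 1) := tsum_nonneg fun n => alpha_nonneg _
  unfold covConst
  linarith

lemma abs_cov_le_alpha (hξ : ∀ ℓ, Measurable (ξ ℓ)) {d d' : ℕ} (hd : d < d') {X Y : Ω → ℝ}
    (hX : Measurable[sigmaGen ξ {d}] X) (hY : Measurable[sigmaGen ξ {d'}] Y)
    (hX1 : ∀ ω, |X ω| ≤ 1) (hY1 : ∀ ω, |Y ω| ≤ 1) :
    |∫ ω, X ω * Y ω ∂P - (∫ ω, X ω ∂P) * ∫ ω, Y ω ∂P| ≤ 4 * alpha P ξ (d' - d) :=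
  abs_cov_le_of_abs_le_one (sigmaGen_le hξ _) (sigmaGen_le hξ _)
    (fun A B hA hB => le_alpha (k := d) (n := d' - d)
      (sigmaGen_mono (by simp) _ hA)
      (sigmaGen_mono (by simp; omega) _ hB)) hX hY hX1 hY1

lemma sum_comp_le_tsum {b : ℕ → ℝ} (hb : Summable b) (hb0 : ∀ n, 0 ≤ b n) (D : Finset ℕ)
    {φ : ℕ → ℕ} (hφ : Set.InjOn φ D) : ∑ d ∈ D, b (φ d) ≤ ∑' n, b n := by
  rw [← Finset.sum_image (g := φ) (f := b) fun x hx y hy h => hφ hx hy h]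
  exact hb.sum_le_tsum _ fun _ _ => hb0 _

namespace IsCentredFunctional

variable {Z : ℕ → Ω → ℝ}

lemma measurable_of (h : IsCentredFunctional P ξ Z) (hξ : ∀ ℓ, Measurable (ξ ℓ)) (d : ℕ) :
    Measurable (Z d) := (h.measurable d).mono (sigmaGen_le hξ _) le_rfl

lemma integrable (h : IsCentredFunctional P ξ Z) (hξ : ∀ ℓ, Measurable (ξ ℓ)) (d : ℕ) :
    Integrable (Z d) P :=
  Integrable.of_bound (h.measurable_of hξ d).aestronglyMeasurable 1
    (Eventually.of_forall (h.abs_le_one d))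

lemma integrable_mul (h : IsCentredFunctional P ξ Z) (hξ : ∀ ℓ, Measurable (ξ ℓ)) (d d' : ℕ) :
    Integrable (fun ω => Z d ω * Z d' ω) P :=
  (h.integrable hξ d').bdd_mul (h.measurable_of hξ d).aestronglyMeasurable (c := 1)
    (Eventually.of_forall (h.abs_le_one d))

lemma abs_integral_mul_le_alpha (h : IsCentredFunctional P ξ Z) (hξ : ∀ ℓ, Measurable (ξ ℓ))
    {d d' : ℕ} (hd : d < d') : |∫ ω, Z d ω * Z d' ω ∂P| ≤ 4 * alpha P ξ (d' - d) := by
  have := abs_cov_le_alpha (P := P) hξ hd (h.measurable d) (h.measurable d') (h.abs_le_one d)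
    (h.abs_le_one d')
  rwa [h.integral_eq_zero d, zero_mul, sub_zero] at this

lemma abs_integral_sq_le_one (h : IsCentredFunctional P ξ Z) (d : ℕ) :
    |∫ ω, Z d ω * Z d ω ∂P| ≤ 1 := by
  refine (norm_integral_le_of_norm_le_const (μ := P) (f := fun ω => Z d ω * Z d ω) (C := 1)
    (Eventually.of_forall fun ω => ?_)).trans (by simp)
  rw [norm_mul]
  exact mul_le_one₀ (h.abs_le_one d ω) (norm_nonneg _) (h.abs_le_one d ω)

lemma integral_mul_comm (d d' : ℕ) :
    ∫ ω, Z d ω * Z d' ω ∂P = ∫ ω, Z d' ω * Z d ω ∂P := by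
  simp_rw [mul_comm]

lemma sum_abs_integral_mul_far_le (h : IsCentredFunctional P ξ Z) (hξ : ∀ ℓ, Measurable (ξ ℓ))
    (hα : Summable fun n : ℕ => alpha P ξ (n + 1)) (D : Finset ℕ) (d q : ℕ)
    (hD : ∀ d' ∈ D, d + q < d' ∨ d' + q < d) :
    ∑ d' ∈ D, |∫ ω, Z d ω * Z d' ω ∂P| ≤ 8 * ∑' n, alpha P ξ (n + q + 1) := by
  have hα' : Summable fun n : ℕ => alpha P ξ (n + q + 1) :=
    (summable_nat_add_iff q (f := fun n : ℕ => alpha P ξ (n + 1))).2 hα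
  rw [← Finset.sum_filter_add_sum_filter_not D (fun d' => d < d')]
  have h1 : ∑ d' ∈ D with d < d', |∫ ω, Z d ω * Z d' ω ∂P|
      ≤ 4 * ∑' n, alpha P ξ (n + q + 1) := by
    refine (Finset.sum_le_sum (g := fun d' => 4 * alpha P ξ ((d' - d - q - 1) + q + 1))
      fun d' hd' => ?_).trans ?_
    · rw [Finset.mem_filter] at hd'
      have := hD d' hd'.1
      have e : d' - d - q - 1 + q + 1 = d' - d := by omega
      simp only [e]
      exact h.abs_integral_mul_le_alpha hξ hd'.2
    · rw [← Finset.mul_sum]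
      refine mul_le_mul_of_nonneg_left (sum_comp_le_tsum hα' (fun n => alpha_nonneg _) _ ?_)
        (by norm_num)
      intro x hx y hy hxy
      have hx' := Finset.mem_filter.1 hx
      have hy' := Finset.mem_filter.1 hy
      have := hD x hx'.1
      have := hD y hy'.1
      simp only at hxy
      omega
  have h2 : ∑ d' ∈ D with ¬ d < d', |∫ ω, Z d ω * Z d' ω ∂P|
      ≤ 4 * ∑' n, alpha P ξ (n + q + 1) := by
    refine (Finset.sum_le_sum (g := fun d' => 4 * alpha P ξ ((d - d' - q - 1) + q + 1))
      fun d' hd' => ?_).trans ?_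
    · rw [Finset.mem_filter] at hd'
      have := hD d' hd'.1
      have e : d - d' - q - 1 + q + 1 = d - d' := by omega
      simp only [e]
      rw [integral_mul_comm]
      exact h.abs_integral_mul_le_alpha hξ (by omega)
    · rw [← Finset.mul_sum]
      refine mul_le_mul_of_nonneg_left (sum_comp_le_tsum hα' (fun n => alpha_nonneg _) _ ?_)
        (by norm_num)
      intro x hx y hy hxy
      have hx' := Finset.mem_filter.1 hx
      have hy' := Finset.mem_filter.1 hy
      have := hD x hx'.1
      have := hD y hy'.1
      simp only at hxy
      omega
  linarith

lemma sum_abs_integral_mul_le (h : IsCentredFunctional P ξ Z) (hξ : ∀ ℓ, Measurable (ξ ℓ))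
    (hα : Summable fun n : ℕ => alpha P ξ (n + 1)) (D : Finset ℕ) (d : ℕ) :
    ∑ d' ∈ D, |∫ ω, Z d ω * Z d' ω ∂P| ≤ covConst P ξ := by
  rw [← Finset.sum_filter_add_sum_filter_not D (fun d' => d' = d)]
  refine add_le_add ?_ ?_
  · calc ∑ d' ∈ D with d' = d, |∫ ω, Z d ω * Z d' ω ∂P|
        ≤ ∑ d' ∈ {d}, |∫ ω, Z d ω * Z d' ω ∂P| :=
          Finset.sum_le_sum_of_subset_of_nonneg
            (fun x hx => by simpa using (Finset.mem_filter.1 hx).2) fun _ _ _ => abs_nonneg _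
      _ ≤ 1 := by simpa using h.abs_integral_sq_le_one d
  · refine h.sum_abs_integral_mul_far_le hξ hα _ d 0 fun d' hd' => ?_
    have := (Finset.mem_filter.1 hd').2
    omega

lemma integral_sum_sq_eq (h : IsCentredFunctional P ξ Z) (hξ : ∀ ℓ, Measurable (ξ ℓ))
    (D : Finset ℕ) :
    ∫ ω, (∑ d ∈ D, Z d ω) ^ 2 ∂P = ∑ d ∈ D, ∑ d' ∈ D, ∫ ω, Z d ω * Z d' ω ∂P := by
  simp_rw [sq, Finset.sum_mul_sum]
  rw [integral_finsetSum _ fun d _ => integrable_finsetSum _ fun d' _ => h.integrable_mul hξ d d']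
  exact Finset.sum_congr rfl fun d _ => integral_finsetSum _ fun d' _ => h.integrable_mul hξ d d'

lemma integral_sum_sq_le (h : IsCentredFunctional P ξ Z) (hξ : ∀ ℓ, Measurable (ξ ℓ))
    (hα : Summable fun n : ℕ => alpha P ξ (n + 1)) (D : Finset ℕ) :
    ∫ ω, (∑ d ∈ D, Z d ω) ^ 2 ∂P ≤ D.card * covConst P ξ := by
  rw [h.integral_sum_sq_eq hξ, ← nsmul_eq_mul]
  exact Finset.sum_le_card_nsmul _ _ _ fun d _ =>
    (Finset.sum_le_sum fun d' _ => le_abs_self _).trans (h.sum_abs_integral_mul_le hξ hα D d)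

lemma measurable_sum (h : IsCentredFunctional P ξ Z) (hξ : ∀ ℓ, Measurable (ξ ℓ))
    (D : Finset ℕ) : Measurable fun ω => ∑ d ∈ D, Z d ω :=
  Finset.measurable_sum _ fun d _ => h.measurable_of hξ d

lemma abs_sum_le (h : IsCentredFunctional P ξ Z) (D : Finset ℕ) (ω : Ω) :
    |∑ d ∈ D, Z d ω| ≤ D.card :=
  (Finset.abs_sum_le_sum_abs _ _).trans
    ((Finset.sum_le_card_nsmul _ _ 1 fun d _ => h.abs_le_one d ω).trans (by simp))

lemma integrable_sum_pow (h : IsCentredFunctional P ξ Z) (hξ : ∀ ℓ, Measurable (ξ ℓ))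
    (D : Finset ℕ) (k : ℕ) : Integrable (fun ω => (∑ d ∈ D, Z d ω) ^ k) P :=
  Integrable.of_bound ((h.measurable_sum hξ D).pow_const k).aestronglyMeasurable ((D.card : ℝ) ^ k)
    (Eventually.of_forall fun ω => by
      rw [norm_pow]; exact pow_le_pow_left₀ (norm_nonneg _) (h.abs_sum_le D ω) k)

/-- The first moment is at most the root of the second, because the variance of the absolute value
is nonnegative. -/
lemma integral_abs_sum_le (h : IsCentredFunctional P ξ Z) (hξ : ∀ ℓ, Measurable (ξ ℓ))
    (hα : Summable fun n : ℕ => alpha P ξ (n + 1)) (D : Finset ℕ) :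
    ∫ ω, |∑ d ∈ D, Z d ω| ∂P ≤ √(D.card * covConst P ξ) := by
  have hm : MemLp (fun ω => |∑ d ∈ D, Z d ω|) 2 P :=
    MemLp.of_bound (h.measurable_sum hξ D).abs.aestronglyMeasurable D.card
      (Eventually.of_forall fun ω => by simpa using h.abs_sum_le D ω)
  have hv := variance_nonneg (fun ω => |∑ d ∈ D, Z d ω|) P
  rw [variance_eq_sub hm] at hv
  refine Real.le_sqrt_of_sq_le (le_trans ?_ (h.integral_sum_sq_le hξ hα D))
  simpa [Pi.pow_apply] using hv

end IsCentredFunctional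

end MixingArray

/-! ### Combinatorics of blocks and gaps. -/

section Blocks

/-- The `j`-th block: the times `d < N` in `[p j, p j + p - q)`. -/
def block (N p q j : ℕ) : Finset ℕ := (Finset.range N).filter fun d => d / p = j ∧ d % p + q < p

/-- The times `d < N` that belong to no block. -/
def gaps (N p q : ℕ) : Finset ℕ := (Finset.range N).filter fun d => ¬ d % p + q < p

lemma mem_block {N p q j d : ℕ} : d ∈ block N p q j ↔ d < N ∧ d / p = j ∧ d % p + q < p := by
  simp [block]

lemma mem_gaps {N p q d : ℕ} : d ∈ gaps N p q ↔ d < N ∧ ¬ d % p + q < p := by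
  simp [gaps]

lemma le_of_mem_block {N p q j d : ℕ} (h : d ∈ block N p q j) : j * p ≤ d := by
  have := (mem_block.1 h).2.1
  rw [← this]
  exact Nat.div_mul_le_self d p

lemma add_lt_of_mem_block {N p q j d : ℕ} (h : d ∈ block N p q j) : d + q < (j + 1) * p := by
  obtain ⟨-, h1, h2⟩ := mem_block.1 h
  have := Nat.div_add_mod d p
  rw [h1] at this
  nlinarith

lemma card_block_le {N p q j : ℕ} (hp : 0 < p) : (block N p q j).card ≤ p := by
  have := Finset.card_le_card_of_injOn (s := block N p q j) (t := Finset.range p) (fun d => d % p)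
    (fun d _ => by simpa using Nat.mod_lt d hp) ?_
  · simpa using this
  · intro x hx y hy hxy
    have hx' := (mem_block.1 hx).2.1
    have hy' := (mem_block.1 hy).2.1
    simp only at hxy
    rw [← Nat.div_add_mod x p, ← Nat.div_add_mod y p, hx', hy', hxy]

lemma card_gaps_le {N p q : ℕ} (hp : 0 < p) : (gaps N p q).card ≤ (N / p + 1) * q := by
  -- A gap consists of the last `q` residues of a period; counted from the end of the period, the
  -- residue is less than `q`.
  have := Finset.card_le_card_of_injOn (s := gaps N p q)
    (t := Finset.range (N / p + 1) ×ˢ Finset.range q) (fun d => (d / p, p - 1 - d % p)) ?_ ?_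
  · simpa using this
  · intro d hd
    obtain ⟨h1, h2⟩ := mem_gaps.1 hd
    have h3 : d / p ≤ N / p := Nat.div_le_div_right h1.le
    have h4 := Nat.mod_lt d hp
    simp only [Finset.coe_product, Finset.coe_range, Set.mem_prod, Set.mem_Iio]
    omega
  · intro x hx y hy hxy
    have hx4 := Nat.mod_lt x hp
    have hy4 := Nat.mod_lt y hp
    simp only [Prod.mk.injEq] at hxy
    have e : x % p = y % p := by omega
    rw [← Nat.div_add_mod x p, ← Nat.div_add_mod y p, hxy.1, e]

lemma sum_range_eq_sum_blocks_add_sum_gaps {M : Type*} [AddCommMonoid M] (N p q : ℕ)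
    (z : ℕ → M) : ∑ d ∈ Finset.range N, z d
      = ∑ j ∈ Finset.range (N / p + 1), ∑ d ∈ block N p q j, z d + ∑ d ∈ gaps N p q, z d := by
  rw [← Finset.sum_filter_add_sum_filter_not (Finset.range N) (fun d => d % p + q < p)]
  congr 1
  rw [← Finset.sum_fiberwise_of_maps_to (g := fun d => d / p) (t := Finset.range (N / p + 1))]
  · refine Finset.sum_congr rfl fun j _ => Finset.sum_congr ?_ fun _ _ => rfl
    ext d
    simp only [Finset.mem_filter, mem_block, Finset.mem_range]
    tauto
  · intro d hd
    have h1 := Finset.mem_range.1 (Finset.mem_filter.1 hd).1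
    exact Finset.mem_range.2 (Nat.lt_succ_of_le (Nat.div_le_div_right h1.le))

lemma far_of_mem_block_of_mem_block {N p q j j' d d' : ℕ} (hd : d ∈ block N p q j)
    (hd' : d' ∈ block N p q j') (hj : j ≠ j') : d + q < d' ∨ d' + q < d := by
  have a := add_lt_of_mem_block hd
  have a' := add_lt_of_mem_block hd'
  have b := le_of_mem_block hd
  have b' := le_of_mem_block hd'
  rcases lt_or_gt_of_ne hj with h | h
  · left
    have := Nat.mul_le_mul_right p (Nat.succ_le_of_lt h)
    simp only [Nat.succ_eq_add_one] at this
    omega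
  · right
    have := Nat.mul_le_mul_right p (Nat.succ_le_of_lt h)
    simp only [Nat.succ_eq_add_one] at this
    omega

end Blocks

/-! ### Bernstein's method: a quantitative central limit theorem. -/

section BlockBound

variable {Ω : Type*} [mΩ : MeasurableSpace Ω] {P : Measure Ω} [IsProbabilityMeasure P]
  {ξ : ℕ → Ω → ℝ≥0} {Z : ℕ → Ω → ℝ}

namespace IsCentredFunctional

/-- Bernstein's method: blocks separated by gaps of length `q` are almost independent. -/
lemma norm_integral_prod_blocks_sub_le (h : IsCentredFunctional P ξ Z)
    (hξ : ∀ ℓ, Measurable (ξ ℓ)) (τ : ℝ) (N : ℕ) {p q : ℕ} (hqp : q < p) (k : ℕ) :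
    ‖∫ ω, ∏ j ∈ Finset.range k,
          Complex.exp (Complex.I * (τ * ∑ d ∈ block N p q j, Z d ω : ℝ)) ∂P
        - ∏ j ∈ Finset.range k,
          ∫ ω, Complex.exp (Complex.I * (τ * ∑ d ∈ block N p q j, Z d ω : ℝ)) ∂P‖
      ≤ k * (16 * alpha P ξ (q + 1)) := by
  have hnorm : ∀ j ω,
      ‖Complex.exp (Complex.I * (τ * ∑ d ∈ block N p q j, Z d ω : ℝ))‖ = 1 := fun j ω =>
    Complex.norm_exp_I_mul_ofReal _
  have hmeas : ∀ (j : ℕ) (T : Set ℕ), (∀ d ∈ block N p q j, d ∈ T) →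
      Measurable[sigmaGen ξ T]
        fun ω => Complex.exp (Complex.I * (τ * ∑ d ∈ block N p q j, Z d ω : ℝ)) := by
    intro j T hT
    have h1 : Measurable[sigmaGen ξ T] fun ω => ∑ d ∈ block N p q j, Z d ω :=
      Finset.measurable_sum _ fun d hd =>
        (h.measurable d).mono (sigmaGen_mono (by simpa using hT d hd)) le_rfl
    have h2 : Measurable fun x : ℝ => Complex.exp (Complex.I * (τ * x : ℝ)) := by fun_prop
    exact h2.comp h1
  induction k with
  | zero => simp
  | succ k ih =>
    simp_rw [Finset.prod_range_succ]
    set A : ℂ := ∫ ω, ∏ j ∈ Finset.range k,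
      Complex.exp (Complex.I * (τ * ∑ d ∈ block N p q j, Z d ω : ℝ)) ∂P with hA
    set B : ℂ := ∫ ω, Complex.exp (Complex.I * (τ * ∑ d ∈ block N p q k, Z d ω : ℝ)) ∂P with hB
    have hB1 : ‖B‖ ≤ 1 := by
      refine (norm_integral_le_of_norm_le_const (μ := P) (C := 1)
        (Eventually.of_forall fun ω => (hnorm k ω).le)).trans (by simp)
    have hcov : ‖∫ ω, (∏ j ∈ Finset.range k,
        Complex.exp (Complex.I * (τ * ∑ d ∈ block N p q j, Z d ω : ℝ)))
          * Complex.exp (Complex.I * (τ * ∑ d ∈ block N p q k, Z d ω : ℝ)) ∂P - A * B‖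
        ≤ 16 * alpha P ξ (q + 1) := by
      rcases Nat.eq_zero_or_pos k with rfl | hk
      · simp only [hA, hB, Finset.range_zero, Finset.prod_empty, one_mul, integral_const,
          probReal_univ, one_smul, sub_self, norm_zero]
        exact mul_nonneg (by norm_num) (alpha_nonneg _)
      · have hkp : p ≤ k * p := Nat.le_mul_of_pos_left p hk
        -- The blocks before the `k`-th lie in times at most `k p - q - 1`, and the `k`-th starts at
        -- `k p` or later, which is `q + 1` steps further; the natural subtraction is exact since `q
        -- < p ≤ k p`. For `k = 0` there is no past, hence the separate case.
        refine norm_cov_le_of_norm_le_one (𝓐 := sigmaGen ξ (Set.Iic (k * p - q - 1)))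
          (𝓑 := sigmaGen ξ (Set.Ici (k * p - q - 1 + (q + 1)))) (sigmaGen_le hξ _)
          (sigmaGen_le hξ _) (fun A B hA hB => le_alpha hA hB)
          (Finset.measurable_prod _ fun j hj => hmeas j _ fun d hd => ?_)
          (hmeas k _ fun d hd => ?_) (fun ω => ?_) (fun ω => (hnorm k ω).le)
        · have h1 := add_lt_of_mem_block hd
          have h2 : (j + 1) * p ≤ k * p :=
            Nat.mul_le_mul_right p (Nat.succ_le_of_lt (Finset.mem_range.1 hj))
          simp only [Set.mem_Iic]
          omega
        · have h1 := le_of_mem_block hd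
          simp only [Set.mem_Ici]
          omega
        · rw [norm_prod]
          exact (Finset.prod_eq_one fun j _ => hnorm j ω).le
    refine (norm_sub_le_norm_sub_add_norm_sub _ (A * B) _).trans ?_
    rw [← sub_mul, norm_mul]
    have := mul_le_of_le_one_right (norm_nonneg (A - ∏ j ∈ Finset.range k,
      ∫ ω, Complex.exp (Complex.I * (τ * ∑ d ∈ block N p q j, Z d ω : ℝ)) ∂P)) hB1
    push_cast at ih this hcov ⊢
    linarith

/-- Taylor expansion of order two on a single block, followed by `1 - x ≈ exp (-x)`. The third
moment is reduced to the second by `|∑ Z|³ ≤ p (∑ Z)²`, so only the variance bound `p C` is used. -/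
lemma norm_charFun_sum_sub_exp_le (h : IsCentredFunctional P ξ Z) (hξ : ∀ ℓ, Measurable (ξ ℓ))
    (hα : Summable fun n : ℕ => alpha P ξ (n + 1)) (τ : ℝ) {p : ℕ} {D : Finset ℕ}
    (hD : D.card ≤ p) :
    ‖∫ ω, Complex.exp (Complex.I * (τ * ∑ d ∈ D, Z d ω : ℝ)) ∂P
        - (Real.exp (-(τ ^ 2 / 2 * ∫ ω, (∑ d ∈ D, Z d ω) ^ 2 ∂P)) : ℂ)‖
      ≤ 4 * |τ| ^ 3 * p ^ 2 * covConst P ξ + (τ ^ 2 * p * covConst P ξ) ^ 2 := by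
  have hDp : (D.card : ℝ) ≤ p := by exact_mod_cast hD
  have hC := one_le_covConst (P := P) (ξ := ξ)
  set v : ℝ := ∫ ω, (∑ d ∈ D, Z d ω) ^ 2 ∂P with hv
  have hv0 : 0 ≤ v := integral_nonneg fun ω => sq_nonneg _
  have hvp : v ≤ p * covConst P ξ := (h.integral_sum_sq_le hξ hα D).trans
    (mul_le_mul_of_nonneg_right hDp (by linarith))
  have hm := h.measurable_sum hξ D
  have i1 : Integrable (fun ω => ∑ d ∈ D, Z d ω) P := by
    simpa using h.integrable_sum_pow hξ D 1
  have i2 := h.integrable_sum_pow hξ D 2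
  have i0 : Integrable (fun ω => Complex.exp (Complex.I * (τ * ∑ d ∈ D, Z d ω : ℝ))) P := by
    refine Integrable.of_bound (Measurable.aestronglyMeasurable (by fun_prop)) 1
      (Eventually.of_forall fun ω => (Complex.norm_exp_I_mul_ofReal _).le)
  have hmean : ∫ ω, ∑ d ∈ D, Z d ω ∂P = 0 := by
    rw [integral_finsetSum _ fun d _ => h.integrable hξ d]
    exact Finset.sum_eq_zero fun d _ => h.integral_eq_zero d
  have i3 : Integrable (fun ω => (1 : ℂ) + Complex.I * (τ * ∑ d ∈ D, Z d ω : ℝ)) P :=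
    (integrable_const _).add (((i1.const_mul τ).ofReal).const_mul _)
  have i4 : Integrable (fun ω => (((τ * ∑ d ∈ D, Z d ω : ℝ) : ℂ)) ^ 2 / 2) P := by
    have : Integrable (fun ω => ((τ ^ 2 * (∑ d ∈ D, Z d ω) ^ 2 : ℝ) : ℂ) / 2) P :=
      ((i2.const_mul (τ ^ 2)).ofReal (𝕜 := ℂ)).div_const 2
    refine this.congr (Eventually.of_forall fun ω => ?_)
    push_cast
    ring
  have hexp : ∫ ω, ((1 : ℂ) + Complex.I * (τ * ∑ d ∈ D, Z d ω : ℝ)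
      - ((τ * ∑ d ∈ D, Z d ω : ℝ) : ℂ) ^ 2 / 2) ∂P = ((1 - τ ^ 2 / 2 * v : ℝ) : ℂ) := by
    rw [integral_sub i3 i4, integral_add (integrable_const _)
      (((i1.const_mul τ).ofReal).const_mul _), integral_const_mul, integral_complex_ofReal,
      integral_const_mul, hmean, integral_div]
    have e : ∫ ω, ((τ * ∑ d ∈ D, Z d ω : ℝ) : ℂ) ^ 2 ∂P = ((τ ^ 2 * v : ℝ) : ℂ) := by
      rw [hv, ← integral_const_mul, ← integral_complex_ofReal]
      congr 1 with ω
      push_cast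
      ring
    rw [e]
    simp
    ring
  have hfirst : ‖∫ ω, Complex.exp (Complex.I * (τ * ∑ d ∈ D, Z d ω : ℝ)) ∂P
      - ((1 - τ ^ 2 / 2 * v : ℝ) : ℂ)‖ ≤ 4 * |τ| ^ 3 * p ^ 2 * covConst P ξ := by
    have i34 : Integrable (fun ω => (1 : ℂ) + Complex.I * (τ * ∑ d ∈ D, Z d ω : ℝ)
      - ((τ * ∑ d ∈ D, Z d ω : ℝ) : ℂ) ^ 2 / 2) P := i3.sub i4
    rw [← hexp, ← integral_sub i0 i34]
    refine (norm_integral_le_of_norm_le ((i2.const_mul (4 * |τ| ^ 3 * p)))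
      (Eventually.of_forall fun ω => ?_)).trans ?_
    · refine (norm_exp_I_mul_sub_quadratic_le _).trans ?_
      rw [abs_mul, mul_pow]
      have h3 : |∑ d ∈ D, Z d ω| ^ 3 ≤ p * (∑ d ∈ D, Z d ω) ^ 2 := by
        rw [← sq_abs (∑ d ∈ D, Z d ω), pow_succ, mul_comm]
        exact mul_le_mul_of_nonneg_right ((h.abs_sum_le D ω).trans hDp) (by positivity)
      have := mul_le_mul_of_nonneg_left h3 (show 0 ≤ 4 * |τ| ^ 3 by positivity)
      linarith
    · rw [integral_const_mul]
      have := mul_le_mul_of_nonneg_left hvp (show 0 ≤ 4 * |τ| ^ 3 * p by positivity)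
      calc _ ≤ _ := this
        _ = _ := by ring
  have hx0 : 0 ≤ τ ^ 2 / 2 * v := by positivity
  have hsecond : ‖((1 - τ ^ 2 / 2 * v : ℝ) : ℂ) - (Real.exp (-(τ ^ 2 / 2 * v)) : ℂ)‖
      ≤ (τ ^ 2 * p * covConst P ξ) ^ 2 := by
    rw [← Complex.ofReal_sub, Complex.norm_real, Real.norm_eq_abs, abs_sub_comm]
    refine (abs_exp_neg_sub_linear_le hx0).trans (pow_le_pow_left₀ hx0 ?_ 2)
    have := mul_le_mul_of_nonneg_left hvp (sq_nonneg τ)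
    have h0 := mul_nonneg (sq_nonneg τ) hv0
    linarith
  exact (norm_sub_le_norm_sub_add_norm_sub _ _ _).trans (add_le_add hfirst hsecond)

/-- The discrepancy is a sum of covariances of two kinds. Indices in different blocks are more than
`q` apart and contribute a tail of `∑ α` for each of at most `N` times; pairs meeting a gap are
counted in two groups, each contributing at most `C` per gap time. -/
lemma abs_integral_sum_sq_sub_blocks_le (h : IsCentredFunctional P ξ Z)
    (hξ : ∀ ℓ, Measurable (ξ ℓ)) (hα : Summable fun n : ℕ => alpha P ξ (n + 1)) (N p q : ℕ) :
    |∫ ω, (∑ d ∈ Finset.range N, Z d ω) ^ 2 ∂P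
        - ∑ j ∈ Finset.range (N / p + 1), ∫ ω, (∑ d ∈ block N p q j, Z d ω) ^ 2 ∂P|
      ≤ 2 * (gaps N p q).card * covConst P ξ + N * (8 * ∑' n, alpha P ξ (n + q + 1)) := by
  set c : ℕ → ℕ → ℝ := fun d d' => ∫ ω, Z d ω * Z d' ω ∂P with hc
  set R : ℝ := ∑' n, alpha P ξ (n + q + 1) with hR
  have hR0 : 0 ≤ R := tsum_nonneg fun n => alpha_nonneg _
  have hcomm : ∀ d d', c d d' = c d' d := fun d d' => integral_mul_comm d d'
  set K := Finset.range (N / p + 1) with hK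
  simp_rw [h.integral_sum_sq_eq hξ]
  -- split both summation indices into blocks and gaps
  have hsplit : ∑ d ∈ Finset.range N, ∑ d' ∈ Finset.range N, c d d'
      - ∑ j ∈ K, ∑ d ∈ block N p q j, ∑ d' ∈ block N p q j, c d d'
      = ∑ j ∈ K, ∑ d ∈ block N p q j, ∑ j' ∈ K.erase j, ∑ d' ∈ block N p q j', c d d'
        + ∑ d' ∈ gaps N p q, ∑ j ∈ K, ∑ d ∈ block N p q j, c d' d
        + ∑ d ∈ gaps N p q, ∑ d' ∈ Finset.range N, c d d' := by
    rw [sum_range_eq_sum_blocks_add_sum_gaps N p q]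
    have e1 : ∀ j ∈ K, ∀ d, ∑ d' ∈ Finset.range N, c d d'
        = ∑ d' ∈ block N p q j, c d d' + ∑ j' ∈ K.erase j, ∑ d' ∈ block N p q j', c d d'
          + ∑ d' ∈ gaps N p q, c d d' := by
      intro j hj d
      rw [sum_range_eq_sum_blocks_add_sum_gaps N p q, ← hK,
        ← Finset.add_sum_erase K (fun j' => ∑ d' ∈ block N p q j', c d d') hj]
    rw [Finset.sum_congr rfl fun j hj => Finset.sum_congr rfl fun d _ => e1 j hj d]
    simp_rw [Finset.sum_add_distrib]
    have e2 : ∑ j ∈ K, ∑ d ∈ block N p q j, ∑ d' ∈ gaps N p q, c d d'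
        = ∑ d' ∈ gaps N p q, ∑ j ∈ K, ∑ d ∈ block N p q j, c d' d := by
      rw [Finset.sum_comm (s := gaps N p q)]
      refine Finset.sum_congr rfl fun j _ => ?_
      rw [Finset.sum_comm]
      exact Finset.sum_congr rfl fun d _ => Finset.sum_congr rfl fun d' _ => hcomm _ _
    rw [e2]
    ring
  rw [hsplit]
  have hblock : ∀ g : ℕ → ℝ, (∀ d, 0 ≤ g d) →
      ∑ j ∈ K, ∑ d ∈ block N p q j, g d ≤ ∑ d ∈ Finset.range N, g d := by
    intro g hg
    rw [sum_range_eq_sum_blocks_add_sum_gaps N p q g]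
    exact le_add_of_nonneg_right (Finset.sum_nonneg fun d _ => hg d)
  have t1 : |∑ j ∈ K, ∑ d ∈ block N p q j, ∑ j' ∈ K.erase j, ∑ d' ∈ block N p q j', c d d'|
      ≤ N * (8 * R) := by
    calc _ ≤ ∑ j ∈ K, ∑ d ∈ block N p q j, 8 * R := by
          refine (Finset.abs_sum_le_sum_abs _ _).trans (Finset.sum_le_sum fun j hj => ?_)
          refine (Finset.abs_sum_le_sum_abs _ _).trans (Finset.sum_le_sum fun d hd => ?_)
          have e : ∑ j' ∈ K.erase j, ∑ d' ∈ block N p q j', c d d'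
              = ∑ d' ∈ (K.erase j).biUnion (block N p q), c d d' := by
            rw [Finset.sum_biUnion]
            intro i _ i' _ hii'
            rw [Function.onFun, Finset.disjoint_left]
            intro x hx hx'
            exact hii' ((mem_block.1 hx).2.1.symm.trans (mem_block.1 hx').2.1)
          rw [e]
          refine (Finset.abs_sum_le_sum_abs _ _).trans
            (h.sum_abs_integral_mul_far_le hξ hα _ d q fun d' hd' => ?_)
          obtain ⟨j', hj', hd''⟩ := Finset.mem_biUnion.1 hd'
          exact far_of_mem_block_of_mem_block hd hd'' (Finset.ne_of_mem_erase hj').symm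
      _ ≤ _ := (hblock (fun _ => 8 * R) fun _ => by positivity).trans (by simp)
  have t2 : |∑ d' ∈ gaps N p q, ∑ j ∈ K, ∑ d ∈ block N p q j, c d' d|
      ≤ (gaps N p q).card * covConst P ξ := by
    rw [← nsmul_eq_mul]
    refine (Finset.abs_sum_le_sum_abs _ _).trans (Finset.sum_le_card_nsmul _ _ _ fun d _ => ?_)
    refine (Finset.abs_sum_le_sum_abs _ _).trans ((Finset.sum_le_sum fun j _ =>
      Finset.abs_sum_le_sum_abs _ _).trans ((hblock _ fun _ => abs_nonneg _).trans ?_))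
    exact h.sum_abs_integral_mul_le hξ hα _ d
  have t3 : |∑ d ∈ gaps N p q, ∑ d' ∈ Finset.range N, c d d'|
      ≤ (gaps N p q).card * covConst P ξ := by
    rw [← nsmul_eq_mul]
    refine (Finset.abs_sum_le_sum_abs _ _).trans (Finset.sum_le_card_nsmul _ _ _ fun d _ => ?_)
    exact (Finset.abs_sum_le_sum_abs _ _).trans (h.sum_abs_integral_mul_le hξ hα _ d)
  refine (abs_add_three _ _ _).trans ?_
  linarith

/-- A quantitative central limit theorem, with block length `p` and gap length `q`. -/
lemma norm_charFun_sub_exp_le (h : IsCentredFunctional P ξ Z) (hξ : ∀ ℓ, Measurable (ξ ℓ))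
    (hα : Summable fun n : ℕ => alpha P ξ (n + 1)) (τ : ℝ) (N : ℕ) {p q : ℕ} (hqp : q < p) :
    ‖∫ ω, Complex.exp (Complex.I * (τ * ∑ d ∈ Finset.range N, Z d ω : ℝ)) ∂P
        - (Real.exp (-(τ ^ 2 / 2 * ∫ ω, (∑ d ∈ Finset.range N, Z d ω) ^ 2 ∂P)) : ℂ)‖
      ≤ |τ| * √(((N / p + 1) * q : ℕ) * covConst P ξ)
        + (N / p + 1 : ℕ) * (16 * alpha P ξ (q + 1))
        + (N / p + 1 : ℕ) * (4 * |τ| ^ 3 * p ^ 2 * covConst P ξ + (τ ^ 2 * p * covConst P ξ) ^ 2)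
        + τ ^ 2 / 2 * (2 * ((N / p + 1) * q : ℕ) * covConst P ξ
          + N * (8 * ∑' n, alpha P ξ (n + q + 1))) := by
  have hp : 0 < p := by omega
  have hC := one_le_covConst (P := P) (ξ := ξ)
  have hg : ((gaps N p q).card : ℝ) ≤ ((N / p + 1) * q : ℕ) := by exact_mod_cast card_gaps_le hp
  set K := N / p + 1 with hK
  set v : ℕ → ℝ := fun j => ∫ ω, (∑ d ∈ block N p q j, Z d ω) ^ 2 ∂P with hv
  have hv0 : ∀ j, 0 ≤ v j := fun j => integral_nonneg fun ω => sq_nonneg _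
  have iexp : ∀ D : Finset ℕ,
      Integrable (fun ω => Complex.exp (Complex.I * (τ * ∑ d ∈ D, Z d ω : ℝ))) P := by
    intro D
    have hm := h.measurable_sum hξ D
    exact Integrable.of_bound (Measurable.aestronglyMeasurable (by fun_prop)) 1
      (Eventually.of_forall fun ω => (Complex.norm_exp_I_mul_ofReal _).le)
  have hprod : ∀ ω, ∏ j ∈ Finset.range K,
      Complex.exp (Complex.I * (τ * ∑ d ∈ block N p q j, Z d ω : ℝ))
      = Complex.exp (Complex.I *
        (τ * ∑ j ∈ Finset.range K, ∑ d ∈ block N p q j, Z d ω : ℝ)) := by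
    intro ω
    rw [← Complex.exp_sum, ← Finset.mul_sum]
    congr 2
    push_cast
    rw [← Finset.mul_sum]
  have iprod : Integrable (fun ω => ∏ j ∈ Finset.range K,
      Complex.exp (Complex.I * (τ * ∑ d ∈ block N p q j, Z d ω : ℝ))) P := by
    have hm : ∀ j, Measurable fun ω => ∑ d ∈ block N p q j, Z d ω := fun j =>
      h.measurable_sum hξ _
    refine Integrable.of_bound (Measurable.aestronglyMeasurable (by fun_prop)) 1
      (Eventually.of_forall fun ω => ?_)
    rw [hprod]
    exact (Complex.norm_exp_I_mul_ofReal _).le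
  -- Four replacements, one for each term of the bound: drop the gaps, decouple the blocks, replace
  -- each block by a Gaussian, and replace the sum of the block variances by the full variance.
  have s1 : ‖∫ ω, Complex.exp (Complex.I * (τ * ∑ d ∈ Finset.range N, Z d ω : ℝ)) ∂P
      - ∫ ω, ∏ j ∈ Finset.range K,
          Complex.exp (Complex.I * (τ * ∑ d ∈ block N p q j, Z d ω : ℝ)) ∂P‖
      ≤ |τ| * √((K * q : ℕ) * covConst P ξ) := by
    rw [← integral_sub (iexp _) iprod]
    have hi : Integrable (fun ω => |∑ d ∈ gaps N p q, Z d ω|) P := by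
      simpa using (h.integrable_sum_pow hξ (gaps N p q) 1).abs
    refine (norm_integral_le_of_norm_le (hi.const_mul |τ|) (Eventually.of_forall fun ω => ?_)).trans
      ?_
    · rw [hprod]
      refine (norm_exp_I_mul_sub_exp_I_mul_le _ _).trans ?_
      rw [← mul_sub, abs_mul, sum_range_eq_sum_blocks_add_sum_gaps N p q, ← hK, add_sub_cancel_left]
    · rw [integral_const_mul]
      refine mul_le_mul_of_nonneg_left ((h.integral_abs_sum_le hξ hα _).trans ?_) (abs_nonneg _)
      exact Real.sqrt_le_sqrt (mul_le_mul_of_nonneg_right hg (by linarith))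
  have s2 := h.norm_integral_prod_blocks_sub_le hξ τ N hqp K
  have s3 : ‖∏ j ∈ Finset.range K,
        ∫ ω, Complex.exp (Complex.I * (τ * ∑ d ∈ block N p q j, Z d ω : ℝ)) ∂P
      - ∏ j ∈ Finset.range K, (Real.exp (-(τ ^ 2 / 2 * v j)) : ℂ)‖
      ≤ K * (4 * |τ| ^ 3 * p ^ 2 * covConst P ξ + (τ ^ 2 * p * covConst P ξ) ^ 2) := by
    refine (norm_prod_sub_prod_le _ (fun j _ => ?_) fun j _ => ?_).trans ?_
    · exact (norm_integral_le_of_norm_le_const (μ := P) (C := 1)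
        (Eventually.of_forall fun ω => (Complex.norm_exp_I_mul_ofReal _).le)).trans (by simp)
    · rw [Complex.norm_real, Real.norm_of_nonneg (Real.exp_pos _).le, Real.exp_le_one_iff]
      have := hv0 j
      rw [neg_nonpos]
      positivity
    · refine (Finset.sum_le_card_nsmul _ _ _ fun j _ =>
        h.norm_charFun_sum_sub_exp_le hξ hα τ (card_block_le (N := N) (q := q) (j := j) hp)).trans ?_
      rw [Finset.card_range, nsmul_eq_mul]
  have s4 : ‖∏ j ∈ Finset.range K, (Real.exp (-(τ ^ 2 / 2 * v j)) : ℂ)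
      - (Real.exp (-(τ ^ 2 / 2 * ∫ ω, (∑ d ∈ Finset.range N, Z d ω) ^ 2 ∂P)) : ℂ)‖
      ≤ τ ^ 2 / 2 * (2 * (K * q : ℕ) * covConst P ξ
          + N * (8 * ∑' n, alpha P ξ (n + q + 1))) := by
    rw [← Complex.ofReal_prod, ← Real.exp_sum, ← Complex.ofReal_sub, Complex.norm_real,
      Real.norm_eq_abs, Finset.sum_neg_distrib, ← Finset.mul_sum]
    have hv0' : 0 ≤ ∑ j ∈ Finset.range K, v j := Finset.sum_nonneg fun j _ => hv0 j
    have hV0 : 0 ≤ ∫ ω, (∑ d ∈ Finset.range N, Z d ω) ^ 2 ∂P :=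
      integral_nonneg fun ω => sq_nonneg _
    refine (abs_exp_neg_sub_exp_neg_le (by positivity) (by positivity)).trans ?_
    rw [← mul_sub, abs_mul, abs_of_nonneg (show 0 ≤ τ ^ 2 / 2 by positivity), abs_sub_comm]
    refine mul_le_mul_of_nonneg_left ((h.abs_integral_sum_sq_sub_blocks_le hξ hα N p q).trans ?_)
      (by positivity)
    have := mul_le_mul_of_nonneg_right hg (show 0 ≤ covConst P ξ by linarith)
    linarith
  refine (norm_sub_le_norm_sub_add_norm_sub _ _ _).trans (add_le_add
    ((norm_sub_le_norm_sub_add_norm_sub _ _ _).trans (add_le_add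
      ((norm_sub_le_norm_sub_add_norm_sub _ _ _).trans (add_le_add s1 s2)) s3)) s4)

end IsCentredFunctional

end BlockBound

/-! ### Choice of the block lengths and passage to the limit. -/

section Limit

variable {Ω : Type*} [mΩ : MeasurableSpace Ω] {P : Measure Ω} [IsProbabilityMeasure P]
  {ξ : ℕ → Ω → ℝ≥0}

/-- The bound of `norm_charFun_sub_exp_le` for blocks of length `p ≈ √L / M` and gaps of length
`q ≈ p / M`. -/
lemma IsCentredFunctional.norm_charFun_sub_exp_le_of_sqrt {Z : ℕ → Ω → ℝ}
    (h : IsCentredFunctional P ξ Z) (hξ : ∀ ℓ, Measurable (ξ ℓ))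
    (hα : Summable fun n : ℕ => alpha P ξ (n + 1)) (t : ℝ) {N L M p q : ℕ} (hNL : N ≤ L)
    (hM : 2 ≤ M) (hp : p = Nat.sqrt L / M) (hq : q = p / M) (hp1 : 1 ≤ p) :
    ‖∫ ω, Complex.exp (Complex.I * (t / √L * ∑ d ∈ Finset.range N, Z d ω : ℝ)) ∂P
        - (Real.exp (-((t / √L) ^ 2 / 2 * ∫ ω, (∑ d ∈ Finset.range N, Z d ω) ^ 2 ∂P)) : ℂ)‖
      ≤ (√(2 * t ^ 2 * covConst P ξ * (1 / M))
          + (8 * |t| ^ 3 * covConst P ξ + 2 * t ^ 4 * covConst P ξ ^ 2 + 2 * t ^ 2 * covConst P ξ)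
            * (1 / M))
        + (128 * M ^ 3 * (((q + 1 : ℕ) : ℝ) * alpha P ξ (q + 1))
          + 4 * t ^ 2 * ∑' n, alpha P ξ (n + q + 1)) := by
  have hqp : q < p := hq ▸ Nat.div_lt_self hp1 hM
  refine (h.norm_charFun_sub_exp_le hξ hα (t / √L) N hqp).trans ?_
  have hC := one_le_covConst (P := P) (ξ := ξ)
  have hR : 0 ≤ ∑' n, alpha P ξ (n + q + 1) := tsum_nonneg fun n => alpha_nonneg _
  have ha := alpha_nonneg (P := P) (ξ := ξ) (q + 1)
  set C := covConst P ξ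
  set R := ∑' n, alpha P ξ (n + q + 1)
  set a := alpha P ξ (q + 1)
  -- the arithmetic of the block lengths
  have n1 : p * M ≤ Nat.sqrt L := hp ▸ Nat.div_mul_le_self _ _
  have n2 : Nat.sqrt L + 1 ≤ M * (p + 1) := by
    have := Nat.lt_mul_div_succ (Nat.sqrt L) (show 0 < M by omega)
    rw [← hp] at this
    omega
  have n3 : q * M ≤ p := hq ▸ Nat.div_mul_le_self _ _
  have n4 : p + 1 ≤ M * (q + 1) := by
    have := Nat.lt_mul_div_succ p (show 0 < M by omega)
    rw [← hq] at this
    omega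
  have n5 : L < (Nat.sqrt L + 1) * (Nat.sqrt L + 1) := Nat.lt_succ_sqrt L
  have n6 : Nat.sqrt L * Nat.sqrt L ≤ L := Nat.sqrt_le L
  have n7 : (N / p + 1) * p ≤ 2 * L := by
    have h1 := Nat.div_mul_le_self N p
    have h2 : p ≤ Nat.sqrt L := le_trans (Nat.le_mul_of_pos_right p (by omega)) n1
    have h3 : Nat.sqrt L ≤ L := Nat.sqrt_le_self L
    rw [add_mul, one_mul]
    omega
  set K := N / p + 1
  have hM0 : (2 : ℝ) ≤ M := by exact_mod_cast hM
  have hp0 : (1 : ℝ) ≤ p := by exact_mod_cast hp1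
  have r3 : (q : ℝ) * M ≤ p := by exact_mod_cast n3
  have r4 : (p : ℝ) ≤ M * (q + 1) := by
    have : (p : ℝ) + 1 ≤ M * (q + 1) := by exact_mod_cast n4
    linarith
  have r7 : (K : ℝ) * p ≤ 2 * L := by exact_mod_cast n7
  have hK0 : (0 : ℝ) ≤ K := Nat.cast_nonneg _
  have hq0 : (0 : ℝ) ≤ q := Nat.cast_nonneg _
  have hr1 : (1 : ℝ) ≤ √(L : ℝ) := by
    rw [Real.one_le_sqrt]
    have h1 : 1 ≤ Nat.sqrt L := hp1.trans ((Nat.le_mul_of_pos_right p (by omega)).trans n1)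
    have : 1 ≤ L := h1.trans (Nat.sqrt_le_self L)
    exact_mod_cast this
  set r : ℝ := √(L : ℝ) with hr
  have hrL : r * r = L := Real.mul_self_sqrt (Nat.cast_nonneg _)
  have r1 : (p : ℝ) * M ≤ r := by
    have h1 : ((p * M : ℕ) : ℝ) ≤ r := by
      refine Real.le_sqrt_of_sq_le ?_
      have : (p * M) ^ 2 ≤ L := by rw [sq]; exact (Nat.mul_le_mul n1 n1).trans n6
      exact_mod_cast this
    exact_mod_cast h1
  -- Rounding loses at most a factor `2`: `√L < M (p + 1) ≤ 2 M p`, because `p ≥ 1`.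
  have r2 : r ≤ 2 * M * p := by
    refine Real.sqrt_le_iff.2 ⟨by positivity, ?_⟩
    have h2 : Nat.sqrt L + 1 ≤ 2 * M * p := by nlinarith
    have : L ≤ (2 * M * p) ^ 2 := by
      rw [sq]; exact n5.le.trans (Nat.mul_le_mul h2 h2)
    exact_mod_cast this
  have hrpos : 0 < r := by linarith
  have hMpos : (0 : ℝ) < M := by linarith
  have hppos : (0 : ℝ) < p := by linarith
  have hτ2 : (t / r) ^ 2 = t ^ 2 / (r * r) := by rw [div_pow, sq r]
  have kq : (K : ℝ) * q ≤ 2 * (r * r) / M := by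
    rw [le_div_iff₀ hMpos, hrL]
    calc (K : ℝ) * q * M = K * (q * M) := by ring
      _ ≤ K * p := mul_le_mul_of_nonneg_left r3 hK0
      _ ≤ _ := r7
  have pr : (p : ℝ) ≤ r / M := by rwa [le_div_iff₀ hMpos]
  -- This fixes the order of `p`: the Taylor errors sum to order `K p² L^{-3/2}`, which is `O(1/M)`
  -- when `p ≤ √L / M`.
  have kpp : (K : ℝ) * p ^ 2 ≤ 2 * (r * r) * (r / M) := by
    calc (K : ℝ) * p ^ 2 = K * p * p := by ring
      _ ≤ 2 * (r * r) * (r / M) := by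
        refine mul_le_mul (by rw [hrL]; exact r7) pr hppos.le (by positivity)
  -- The number of blocks is bounded by a multiple of the gap length, so that the decoupling error
  -- `K α_{q+1}` is controlled by `(q + 1) α_{q+1}`, which vanishes for fixed `M`.
  have kk : (K : ℝ) ≤ 8 * M ^ 3 * (q + 1) := by
    have h1 : (K : ℝ) * p ≤ 2 * (2 * M * p) * (2 * M * p) := by
      calc (K : ℝ) * p ≤ 2 * (r * r) := by rw [hrL]; exact r7
        _ ≤ 2 * ((2 * M * p) * (2 * M * p)) := by
          exact mul_le_mul_of_nonneg_left (mul_le_mul r2 r2 hrpos.le (by positivity)) (by norm_num)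
        _ = _ := by ring
    have h2 : (K : ℝ) ≤ 8 * M ^ 2 * p := by
      refine le_of_mul_le_mul_right (le_trans h1 (le_of_eq ?_)) hppos
      ring
    calc (K : ℝ) ≤ 8 * M ^ 2 * p := h2
      _ ≤ 8 * M ^ 2 * (M * (q + 1)) := mul_le_mul_of_nonneg_left r4 (by positivity)
      _ = _ := by ring
  have b1 : |t / r| * √((K * q : ℕ) * C) ≤ √(2 * t ^ 2 * C * (1 / M)) := by
    rw [← Real.sqrt_sq_eq_abs, ← Real.sqrt_mul (sq_nonneg _)]
    refine Real.sqrt_le_sqrt ?_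
    rw [hτ2]
    push_cast
    calc t ^ 2 / (r * r) * (K * q * C) ≤ t ^ 2 / (r * r) * (2 * (r * r) / M * C) := by
          gcongr
      _ = _ := by field_simp
  have b2 : (K : ℝ) * (16 * a) ≤ 128 * M ^ 3 * (((q + 1 : ℕ) : ℝ) * a) := by
    have := mul_le_mul_of_nonneg_right kk (show 0 ≤ 16 * a by positivity)
    push_cast
    calc _ ≤ _ := this
      _ = _ := by ring
  have b3 : (K : ℝ) * (4 * |t / r| ^ 3 * p ^ 2 * C + ((t / r) ^ 2 * p * C) ^ 2)
      ≤ (8 * |t| ^ 3 * C + 2 * t ^ 4 * C ^ 2) * (1 / M) := by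
    have e : (K : ℝ) * (4 * |t / r| ^ 3 * p ^ 2 * C + ((t / r) ^ 2 * p * C) ^ 2)
        = (K * p ^ 2) * (4 * |t| ^ 3 * C / r ^ 3 + t ^ 4 * C ^ 2 / r ^ 4) := by
      rw [abs_div, abs_of_pos hrpos, div_pow, hτ2]
      field_simp
    rw [e]
    have h1 : t ^ 4 * C ^ 2 / r ^ 4 ≤ t ^ 4 * C ^ 2 / r ^ 3 := by
      gcongr
      norm_num
    calc (K * p ^ 2) * (4 * |t| ^ 3 * C / r ^ 3 + t ^ 4 * C ^ 2 / r ^ 4)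
        ≤ (2 * (r * r) * (r / M)) * (4 * |t| ^ 3 * C / r ^ 3 + t ^ 4 * C ^ 2 / r ^ 3) := by
          gcongr
      _ = _ := by field_simp; ring
  have b4 : (t / r) ^ 2 / 2 * (2 * (K * q : ℕ) * C + N * (8 * R))
      ≤ 2 * t ^ 2 * C * (1 / M) + 4 * t ^ 2 * R := by
    have hN : (N : ℝ) ≤ r * r := by rw [hrL]; exact_mod_cast hNL
    rw [hτ2]
    push_cast
    calc t ^ 2 / (r * r) / 2 * (2 * (K * q) * C + N * (8 * R))
        ≤ t ^ 2 / (r * r) / 2 * (2 * (2 * (r * r) / M) * C + r * r * (8 * R)) := by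
          gcongr
      _ = _ := by field_simp; ring
  linarith

/-- The central limit theorem for triangular arrays of bounded functionals of a strongly mixing
process, in terms of characteristic functions. -/
lemma tendsto_charFun_sub_exp (hξ : ∀ ℓ, Measurable (ξ ℓ))
    (hα : Summable fun n : ℕ => alpha P ξ (n + 1)) {Z : ℕ → ℕ → Ω → ℝ}
    (hZ : ∀ n, IsCentredFunctional P ξ (Z n)) {N L : ℕ → ℕ} (hNL : ∀ n, N n ≤ L n)
    (hL : Tendsto L atTop atTop) (t : ℝ) :
    Tendsto (fun n =>
      ∫ ω, Complex.exp (Complex.I * (t / √(L n) * ∑ d ∈ Finset.range (N n), Z n d ω : ℝ)) ∂P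
        - (Real.exp (-((t / √(L n)) ^ 2 / 2 *
          ∫ ω, (∑ d ∈ Finset.range (N n), Z n d ω) ^ 2 ∂P)) : ℂ)) atTop (𝓝 0) := by
  have hα' : Summable fun n : ℕ => alpha P ξ n := (summable_nat_add_iff 1).1 hα
  have lim1 : Tendsto (fun M : ℕ => √(2 * t ^ 2 * covConst P ξ * (1 / (M : ℝ)))
      + (8 * |t| ^ 3 * covConst P ξ + 2 * t ^ 4 * covConst P ξ ^ 2 + 2 * t ^ 2 * covConst P ξ)
        * (1 / (M : ℝ))) atTop (𝓝 0) := by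
    have h0 := tendsto_one_div_atTop_nhds_zero_nat (𝕜 := ℝ)
    have := ((h0.const_mul (2 * t ^ 2 * covConst P ξ)).sqrt).add
      (h0.const_mul (8 * |t| ^ 3 * covConst P ξ + 2 * t ^ 4 * covConst P ξ ^ 2
        + 2 * t ^ 2 * covConst P ξ))
    simpa using this
  have lim2 : ∀ M : ℕ, Tendsto (fun q : ℕ =>
      128 * (M : ℝ) ^ 3 * (((q + 1 : ℕ) : ℝ) * alpha P ξ (q + 1))
        + 4 * t ^ 2 * ∑' n, alpha P ξ (n + q + 1)) atTop (𝓝 0) := by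
    intro M
    have h1 : Tendsto (fun q : ℕ => ∑' n, alpha P ξ (n + q + 1)) atTop (𝓝 0) :=
      tendsto_sum_nat_add fun n => alpha P ξ (n + 1)
    simpa using ((tendsto_mul_alpha hα).const_mul (128 * (M : ℝ) ^ 3)).add
      (h1.const_mul (4 * t ^ 2))
  rw [Metric.tendsto_atTop']
  intro δ hδ
  -- First `M` makes the terms in `1/M` small uniformly in `n`; with `M` fixed, the remaining terms
  -- vanish because the gap length tends to infinity.
  obtain ⟨M, hM2, hM⟩ := ((eventually_ge_atTop 2).and
    (lim1.eventually_lt_const (half_pos hδ))).exists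
  have hsqrt : Tendsto (fun n => Nat.sqrt (L n)) atTop atTop := by
    refine tendsto_atTop.2 fun b => ?_
    filter_upwards [hL.eventually_ge_atTop (b * b)] with n hn
    exact Nat.le_sqrt.2 hn
  have hp : Tendsto (fun n => Nat.sqrt (L n) / M) atTop atTop :=
    (Nat.tendsto_div_const_atTop (by omega)).comp hsqrt
  have hq : Tendsto (fun n => Nat.sqrt (L n) / M / M) atTop atTop :=
    (Nat.tendsto_div_const_atTop (by omega)).comp hp
  have ev := (hp.eventually_ge_atTop 1).and
    (((lim2 M).comp hq).eventually_lt_const (half_pos hδ))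
  obtain ⟨n₀, hn₀⟩ := eventually_atTop.1 ev
  refine ⟨n₀, fun n hn => ?_⟩
  obtain ⟨e1, e2⟩ := hn₀ n hn.le
  rw [dist_zero_right]
  refine ((hZ n).norm_charFun_sub_exp_le_of_sqrt hξ hα t (hNL n) hM2 rfl rfl e1).trans_lt ?_
  simp only [Function.comp] at e2
  linarith

end Limit

/-! ### The constants `σ(s)²` and `ρ(s)²`. -/

section Constants

variable {Ω : Type*} [mΩ : MeasurableSpace Ω] {P : Measure Ω} [IsProbabilityMeasure P]
  {ξ : ℕ → Ω → ℝ≥0} (f : WinFunction) {μ ν : Measure ℝ≥0} [IsProbabilityMeasure μ]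
  [IsProbabilityMeasure ν] (s : ℝ≥0)

lemma measurable_sigmaGen_singleton {Ω : Type*} (ξ : ℕ → Ω → ℝ≥0) (d : ℕ) :
    Measurable[sigmaGen ξ {d}] (ξ d) := by
  have : sigmaGen ξ {d} = MeasurableSpace.comap (ξ d) inferInstance := by simp [sigmaGen]
  rw [this]
  exact comap_measurable _

lemma measurable_winFunction : Measurable fun z : ℝ≥0 × ℝ≥0 => (f z.1 z.2 : ℝ) :=
  measurable_subtype_coe.comp f.measurable

lemma integrable_win_of_measurable {α : Type*} [MeasurableSpace α] {m : Measure α}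
    [IsFiniteMeasure m] {a b : α → ℝ≥0} (ha : Measurable a) (hb : Measurable b) :
    Integrable (fun x => (f (a x) (b x) : ℝ)) m :=
  Integrable.of_bound ((measurable_winFunction f).comp (ha.prodMk hb)).aestronglyMeasurable 1
    (Eventually.of_forall fun x => by
      rw [Real.norm_of_nonneg (unitInterval.nonneg _)]; exact unitInterval.le_one _)

lemma measurable_F : Measurable fun z : ℝ≥0 × ℝ≥0 => F f ν s z.1 z.2 := by
  have h : Measurable fun z : (ℝ≥0 × ℝ≥0) × ℝ≥0 => (f (s * z.1.1) (z.1.2 * z.2) : ℝ) :=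
    (measurable_winFunction f).comp (by fun_prop : Measurable fun z : (ℝ≥0 × ℝ≥0) × ℝ≥0 =>
      (s * z.1.1, z.1.2 * z.2))
  exact (h.stronglyMeasurable.integral_prod_right (ν := ν)).measurable

lemma F_nonneg (x y : ℝ≥0) : 0 ≤ F f ν s x y :=
  integral_nonneg fun _ => unitInterval.nonneg _

lemma F_le_one (x y : ℝ≥0) : F f ν s x y ≤ 1 := by
  have := integral_mono (μ := ν) (integrable_win_of_measurable f (a := fun _ => s * x)
    (b := fun v => y * v) (by fun_prop) (by fun_prop)) (integrable_const 1)
    fun v => unitInterval.le_one (f (s * x) (y * v))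
  simpa [F] using this

lemma integrable_F_comp {α : Type*} [MeasurableSpace α] {m : Measure α} [IsFiniteMeasure m]
    {a b : α → ℝ≥0} (ha : Measurable a) (hb : Measurable b) :
    Integrable (fun x => F f ν s (a x) (b x)) m :=
  Integrable.of_bound ((measurable_F f s).comp (ha.prodMk hb)).aestronglyMeasurable 1
    (Eventually.of_forall fun x => by
      rw [Real.norm_of_nonneg (F_nonneg f s _ _)]; exact F_le_one f s _ _)

/-- `E[F_s(V, y)]`. -/
def meanF (f : WinFunction) (ν : Measure ℝ≥0) (s y : ℝ≥0) : ℝ := ∫ v, F f ν s v y ∂ν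

lemma measurable_meanF : Measurable (meanF f ν s) :=
  ((measurable_F f s).stronglyMeasurable.integral_prod_left' (μ := ν)).measurable

lemma meanF_nonneg (y : ℝ≥0) : 0 ≤ meanF f ν s y := integral_nonneg fun _ => F_nonneg f s _ _

lemma meanF_le_one (y : ℝ≥0) : meanF f ν s y ≤ 1 := by
  have := integral_mono (μ := ν) (integrable_F_comp f (ν := ν) s (a := id) (b := fun _ => y)
    (by fun_prop) (by fun_prop)) (integrable_const 1) fun v => F_le_one f s v y
  simpa [meanF] using this

lemma measurable_Ftilde : Measurable fun z : ℝ≥0 × ℝ≥0 => Ftilde f ν s z.1 z.2 :=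
  (measurable_F f s).sub ((measurable_meanF f s).comp measurable_snd)

lemma abs_Ftilde_le_one (x y : ℝ≥0) : |Ftilde f ν s x y| ≤ 1 := by
  have h1 := F_nonneg f (ν := ν) s x y
  have h2 := F_le_one f (ν := ν) s x y
  have h3 := meanF_nonneg f (ν := ν) s y
  have h4 := meanF_le_one f (ν := ν) s y
  change |F f ν s x y - meanF f ν s y| ≤ 1
  rw [abs_le]
  constructor <;> linarith

lemma integral_Ftilde (y : ℝ≥0) : ∫ v, Ftilde f ν s v y ∂ν = 0 := by
  have hi : Integrable (fun v => F f ν s v y) ν :=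
    integrable_F_comp f s measurable_id measurable_const
  unfold Ftilde
  rw [integral_sub hi (integrable_const _)]
  simp

/-- `E[F_s(V, y) - F_s(V, y)²]`. -/
def condVar (f : WinFunction) (ν : Measure ℝ≥0) (s y : ℝ≥0) : ℝ :=
  ∫ v, (F f ν s v y - F f ν s v y ^ 2) ∂ν

/-- `E[F̃_s(ξ_1, y) F̃_s(ξ_{1+k}, y')]`. -/
def covFtilde (f : WinFunction) (ν : Measure ℝ≥0) (P : Measure Ω) (ξ : ℕ → Ω → ℝ≥0) (s : ℝ≥0)
    (k : ℕ) (y y' : ℝ≥0) : ℝ :=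
  ∫ ω, Ftilde f ν s (ξ 0 ω) y * Ftilde f ν s (ξ k ω) y' ∂P

lemma measurable_bernoulliVar :
    Measurable fun z : ℝ≥0 × ℝ≥0 => F f ν s z.1 z.2 - F f ν s z.1 z.2 ^ 2 :=
  (measurable_F f s).sub ((measurable_F f s).pow_const 2)

lemma bernoulliVar_nonneg (x y : ℝ≥0) : 0 ≤ F f ν s x y - F f ν s x y ^ 2 := by
  nlinarith [F_nonneg f (ν := ν) s x y, F_le_one f (ν := ν) s x y]

lemma bernoulliVar_le_one (x y : ℝ≥0) : F f ν s x y - F f ν s x y ^ 2 ≤ 1 := by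
  nlinarith [F_nonneg f (ν := ν) s x y, F_le_one f (ν := ν) s x y]

lemma integrable_bernoulliVar_comp {α : Type*} [MeasurableSpace α] {m : Measure α}
    [IsFiniteMeasure m] {a b : α → ℝ≥0} (ha : Measurable a) (hb : Measurable b) :
    Integrable (fun x => F f ν s (a x) (b x) - F f ν s (a x) (b x) ^ 2) m :=
  Integrable.of_bound ((measurable_bernoulliVar f s).comp (ha.prodMk hb)).aestronglyMeasurable 1
    (Eventually.of_forall fun x => by
      rw [Real.norm_of_nonneg (bernoulliVar_nonneg f s _ _)]; exact bernoulliVar_le_one f s _ _)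

lemma measurable_condVar : Measurable (condVar f ν s) :=
  ((measurable_bernoulliVar f s).stronglyMeasurable.integral_prod_left' (μ := ν)).measurable

lemma condVar_nonneg (y : ℝ≥0) : 0 ≤ condVar f ν s y :=
  integral_nonneg fun _ => bernoulliVar_nonneg f s _ _

lemma condVar_le_one (y : ℝ≥0) : condVar f ν s y ≤ 1 := by
  have := integral_mono (μ := ν) (integrable_bernoulliVar_comp f (ν := ν) s (a := id)
    (b := fun _ => y) (by fun_prop) (by fun_prop)) (integrable_const 1)
    fun v => bernoulliVar_le_one f s v y
  simpa [condVar] using this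

lemma sigmaSq_eq_integral_condVar : sigmaSq f μ ν s = ∫ y, condVar f ν s y ∂μ := by
  unfold sigmaSq condVar
  exact integral_prod_symm _ (integrable_bernoulliVar_comp f s measurable_fst measurable_snd)

lemma sigmaSq_nonneg : 0 ≤ sigmaSq f μ ν s :=
  integral_nonneg fun _ => bernoulliVar_nonneg f s _ _

lemma sigmaSq_eq_ell_sub :
    sigmaSq f μ ν s = ell f μ ν s - ∫ z, F f ν s z.1 z.2 ^ 2 ∂(ν.prod μ) := by
  have i1 : Integrable (fun z : ℝ≥0 × ℝ≥0 => F f ν s z.1 z.2) (ν.prod μ) :=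
    integrable_F_comp f s measurable_fst measurable_snd
  have i2 : Integrable (fun z : ℝ≥0 × ℝ≥0 => F f ν s z.1 z.2 ^ 2) (ν.prod μ) := by
    refine (i1.sub (integrable_bernoulliVar_comp f (ν := ν) s measurable_fst measurable_snd)).congr
      (Eventually.of_forall fun z => ?_)
    simp
  unfold sigmaSq
  rw [integral_sub i1 i2]
  congr 1
  unfold ell
  rw [integral_prod _ i1, integral_prod _ (integrable_win_of_measurable f (by fun_prop)
    (by fun_prop))]
  refine integral_congr_ae (Eventually.of_forall fun x => ?_)
  exact (integral_prod_symm (μ := ν) (ν := μ)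
    (fun z : ℝ≥0 × ℝ≥0 => (f (s * x) (z.2 * z.1) : ℝ))
    (integrable_win_of_measurable f (by fun_prop) (by fun_prop))).symm

lemma abs_covFtilde_le_one (k : ℕ) (y y' : ℝ≥0) : |covFtilde f ν P ξ s k y y'| ≤ 1 := by
  refine (norm_integral_le_of_norm_le_const (μ := P)
    (f := fun ω => Ftilde f ν s (ξ 0 ω) y * Ftilde f ν s (ξ k ω) y') (C := 1)
    (Eventually.of_forall fun ω => ?_)).trans (by simp)
  rw [norm_mul]
  exact mul_le_one₀ (abs_Ftilde_le_one f s _ _) (norm_nonneg _) (abs_Ftilde_le_one f s _ _)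

lemma measurable_Ftilde_mul (hξ : ∀ ℓ, Measurable (ξ ℓ)) (k : ℕ) :
    Measurable fun z : Ω × ℝ≥0 × ℝ≥0 =>
      Ftilde f ν s (ξ 0 z.1) z.2.1 * Ftilde f ν s (ξ k z.1) z.2.2 := by
  have h0 := hξ 0
  have hk := hξ k
  exact ((measurable_Ftilde f s).comp (by fun_prop :
    Measurable fun z : Ω × ℝ≥0 × ℝ≥0 => (ξ 0 z.1, z.2.1))).mul
    ((measurable_Ftilde f s).comp (by fun_prop :
    Measurable fun z : Ω × ℝ≥0 × ℝ≥0 => (ξ k z.1, z.2.2)))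

lemma measurable_covFtilde (hξ : ∀ ℓ, Measurable (ξ ℓ)) (k : ℕ) :
    Measurable fun z : ℝ≥0 × ℝ≥0 => covFtilde f ν P ξ s k z.1 z.2 :=
  ((measurable_Ftilde_mul f s hξ k).stronglyMeasurable.integral_prod_left' (μ := P)).measurable

lemma covTerm_eq_integral_covFtilde (hξ : ∀ ℓ, Measurable (ξ ℓ)) (k : ℕ) :
    covTerm f μ ν P ξ s k = ∫ z, covFtilde f ν P ξ s k z.1 z.2 ∂(μ.prod μ) := by
  unfold covTerm covFtilde
  refine integral_prod_symm _ (Integrable.of_bound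
    (measurable_Ftilde_mul f s hξ k).aestronglyMeasurable 1 (Eventually.of_forall fun z => ?_))
  rw [norm_mul]
  exact mul_le_one₀ (abs_Ftilde_le_one f s _ _) (norm_nonneg _) (abs_Ftilde_le_one f s _ _)

section Stationary

variable (hξ : ∀ ℓ, Measurable (ξ ℓ)) (hstat : IsPairStationary P ξ ν)

include hξ hstat

lemma integral_comp_eq {g : ℝ≥0 → ℝ} (hg : Measurable g) (d : ℕ) :
    ∫ ω, g (ξ d ω) ∂P = ∫ v, g v ∂ν := by
  rw [← hstat.map_eq d, integral_map (hξ d).aemeasurable hg.aestronglyMeasurable]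

/-- `F̃_s` subtracts the mean at the given strength of the opponent, so the centring is exact for
every deterministic sequence `y`, not only on average over it. -/
lemma isCentredFunctional_Ftilde (y : ℕ → ℝ≥0) :
    IsCentredFunctional P ξ fun d ω => Ftilde f ν s (ξ d ω) (y d) where
  measurable d := ((measurable_Ftilde f s).comp (measurable_id.prodMk measurable_const)).comp
    (measurable_sigmaGen_singleton ξ d)
  abs_le_one d ω := abs_Ftilde_le_one f s _ _
  integral_eq_zero d := by
    rw [integral_comp_eq hξ hstat (g := fun v => Ftilde f ν s v (y d))
      ((measurable_Ftilde f s).comp (measurable_id.prodMk measurable_const)), integral_Ftilde]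

/-- This makes the moment bounds available for the conditional variances of the results, whose sum
is thereby seen to concentrate. -/
lemma isCentredFunctional_bernoulliVar (y : ℕ → ℝ≥0) :
    IsCentredFunctional P ξ fun d ω =>
      F f ν s (ξ d ω) (y d) - F f ν s (ξ d ω) (y d) ^ 2 - condVar f ν s (y d) where
  measurable d := (((measurable_bernoulliVar f s).comp
    (measurable_id.prodMk measurable_const)).sub_const _).comp (measurable_sigmaGen_singleton ξ d)
  abs_le_one d ω := by
    have h1 := bernoulliVar_nonneg f (ν := ν) s (ξ d ω) (y d)
    have h2 := bernoulliVar_le_one f (ν := ν) s (ξ d ω) (y d)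
    have h3 := condVar_nonneg f (ν := ν) s (y d)
    have h4 := condVar_le_one f (ν := ν) s (y d)
    rw [abs_le]
    constructor <;> linarith
  integral_eq_zero d := by
    have hi : Integrable (fun v => F f ν s v (y d) - F f ν s v (y d) ^ 2) ν :=
      integrable_bernoulliVar_comp f s measurable_id measurable_const
    rw [integral_comp_eq hξ hstat
      (g := fun v => F f ν s v (y d) - F f ν s v (y d) ^ 2 - condVar f ν s (y d))
      (((measurable_bernoulliVar f s).comp (measurable_id.prodMk measurable_const)).sub_const _),
      integral_sub hi (integrable_const _)]
    simp [condVar]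

lemma integral_Ftilde_mul_Ftilde (d k : ℕ) (y y' : ℝ≥0) :
    ∫ ω, Ftilde f ν s (ξ d ω) y * Ftilde f ν s (ξ (d + k) ω) y' ∂P
      = covFtilde f ν P ξ s k y y' := by
  have hg : Measurable fun z : ℝ≥0 × ℝ≥0 => Ftilde f ν s z.1 y * Ftilde f ν s z.2 y' :=
    ((measurable_Ftilde f s).comp (measurable_fst.prodMk measurable_const)).mul
      ((measurable_Ftilde f s).comp (measurable_snd.prodMk measurable_const))
  have h := hstat.map_pair_eq 0 k d
  have e1 := integral_map (μ := P) ((hξ 0).prodMk (hξ k)).aemeasurable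
    hg.aestronglyMeasurable
  have e2 := integral_map (μ := P) ((hξ (0 + d)).prodMk (hξ (k + d))).aemeasurable
    hg.aestronglyMeasurable
  rw [h, e2] at e1
  rw [zero_add, add_comm k d] at e1
  exact e1

lemma abs_covFtilde_le_alpha (k : ℕ) (y y' : ℝ≥0) :
    |covFtilde f ν P ξ s (k + 1) y y'| ≤ 4 * alpha P ξ (k + 1) := by
  -- Only times `0` and `k + 1` matter, so a single sequence can carry both `y` and `y'`.
  have h := (isCentredFunctional_Ftilde f s hξ hstat
    (fun d => if d = 0 then y else y')).abs_integral_mul_le_alpha hξ (Nat.succ_pos k)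
  simpa [covFtilde] using h

lemma integral_Ftilde_sq_eq :
    ∫ z, Ftilde f ν s z.1 z.2 ^ 2 ∂(ν.prod μ) = ∫ y, covFtilde f ν P ξ s 0 y y ∂μ := by
  have hm : Measurable fun z : ℝ≥0 × ℝ≥0 => Ftilde f ν s z.1 z.2 ^ 2 :=
    (measurable_Ftilde f s).pow_const 2
  rw [integral_prod_symm _ (Integrable.of_bound hm.aestronglyMeasurable 1
    (Eventually.of_forall fun z => ?_))]
  · refine integral_congr_ae (Eventually.of_forall fun y => ?_)
    simp only [covFtilde, ← sq]
    exact (integral_comp_eq hξ hstat (g := fun v => Ftilde f ν s v y ^ 2)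
      (hm.comp (measurable_id.prodMk measurable_const)) 0).symm
  · rw [norm_pow]
    exact pow_le_one₀ (norm_nonneg _) (abs_Ftilde_le_one f s _ _)

lemma abs_covTerm_le_alpha (k : ℕ) :
    |covTerm f μ ν P ξ s (k + 1)| ≤ 4 * alpha P ξ (k + 1) := by
  rw [covTerm_eq_integral_covFtilde f s hξ]
  exact (norm_integral_le_of_norm_le_const (μ := μ.prod μ)
    (f := fun z => covFtilde f ν P ξ s (k + 1) z.1 z.2) (C := 4 * alpha P ξ (k + 1))
    (Eventually.of_forall fun z => abs_covFtilde_le_alpha f s hξ hstat k z.1 z.2)).trans (by simp)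

lemma summable_covTerm (hα : Summable fun n : ℕ => alpha P ξ (n + 1)) :
    Summable fun k : ℕ => covTerm f μ ν P ξ s (k + 1) :=
  Summable.of_norm_bounded (hα.mul_left 4) fun k => abs_covTerm_le_alpha f s hξ hstat k

end Stationary

end Constants

/-! ### Strong laws for the rearranged initial strengths. -/

section StrongLaw

lemma hasSubgaussianMGF_mono {Ω : Type*} [MeasurableSpace Ω] {Q : Measure Ω} {X : Ω → ℝ}
    {c c' : ℝ≥0} (h : HasSubgaussianMGF X c Q) (hc : c ≤ c') : HasSubgaussianMGF X c' Q where
  integrable_exp_mul := h.integrable_exp_mul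
  mgf_le t := (h.mgf_le t).trans (Real.exp_le_exp.2 (by
    have : (c : ℝ) ≤ c' := by exact_mod_cast hc
    gcongr))

/-- With parameter `2n`, the Chernoff bound at level `2 n ε` is `exp (-ε² n)`, which is summable:
Borel–Cantelli applies with no relation required between the `X n`. -/
lemma ae_eventually_lt_of_hasSubgaussianMGF {Ω : Type*} [MeasurableSpace Ω] {Q : Measure Ω}
    [IsProbabilityMeasure Q] {X : ℕ → Ω → ℝ} (h : ∀ n, HasSubgaussianMGF (X n) (2 * n : ℕ) Q)
    {ε : ℝ} (hε : 0 < ε) : ∀ᵐ ω ∂Q, ∀ᶠ n : ℕ in atTop, X n ω < ε * (2 * n) := by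
  have hb : ∀ n : ℕ, Q {ω | ε * (2 * n) ≤ X n ω} ≤ ENNReal.ofReal (Real.exp (-ε ^ 2) ^ n) := by
    intro n
    rw [← ofReal_measureReal]
    refine ENNReal.ofReal_le_ofReal (((h n).measure_ge_le (by positivity)).trans (le_of_eq ?_))
    rw [← Real.exp_nat_mul]
    congr 1
    rcases Nat.eq_zero_or_pos n with rfl | hn
    · simp
    · have : (n : ℝ) ≠ 0 := by positivity
      push_cast
      field_simp
  have hs : Summable fun n : ℕ => Real.exp (-ε ^ 2) ^ n :=
    summable_geometric_of_lt_one (Real.exp_pos _).le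
      (Real.exp_lt_one_iff.2 (by have := pow_pos hε 2; linarith))
  have hsum : ∑' n : ℕ, Q {ω | ε * (2 * n) ≤ X n ω} ≠ ⊤ :=
    ((ENNReal.tsum_le_tsum hb).trans_lt hs.tsum_ofReal_lt_top).ne
  filter_upwards [ae_eventually_notMem hsum] with ω hω
  filter_upwards [hω] with n hn
  simpa using hn

lemma ae_tendsto_div_of_hasSubgaussianMGF {Ω : Type*} [MeasurableSpace Ω] {Q : Measure Ω}
    [IsProbabilityMeasure Q] {X : ℕ → Ω → ℝ} (h : ∀ n, HasSubgaussianMGF (X n) (2 * n : ℕ) Q) :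
    ∀ᵐ ω ∂Q, Tendsto (fun n : ℕ => X n ω / (2 * n)) atTop (𝓝 0) := by
  have h1 : ∀ᵐ ω ∂Q, ∀ m : ℕ, ∀ᶠ n : ℕ in atTop, X n ω < 1 / ((m : ℝ) + 1) * (2 * n) :=
    ae_all_iff.2 fun m => ae_eventually_lt_of_hasSubgaussianMGF h Nat.one_div_pos_of_nat
  have h2 : ∀ᵐ ω ∂Q, ∀ m : ℕ, ∀ᶠ n : ℕ in atTop, -X n ω < 1 / ((m : ℝ) + 1) * (2 * n) :=
    ae_all_iff.2 fun m => ae_eventually_lt_of_hasSubgaussianMGF (X := fun n => -X n)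
      (fun n => (h n).neg) Nat.one_div_pos_of_nat
  filter_upwards [h1, h2] with ω h1 h2
  rw [Metric.tendsto_nhds]
  intro ε hε
  obtain ⟨m, hm⟩ := exists_nat_one_div_lt hε
  filter_upwards [h1 m, h2 m, eventually_gt_atTop 0] with n a b hn
  have hn' : (0 : ℝ) < 2 * n := by positivity
  rw [dist_zero_right, Real.norm_eq_abs, abs_div, abs_of_pos hn', div_lt_iff₀ hn']
  have := mul_lt_mul_of_pos_right hm hn'
  rw [abs_lt]
  constructor <;> linarith

variable {μ : Measure ℝ≥0} [IsProbabilityMeasure μ]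

/-- Sums of functions of disjoint pairs of coordinates are sub-Gaussian. -/
lemma hasSubgaussianMGF_sum_pairs {h : ℝ≥0 × ℝ≥0 → ℝ} (hm : Measurable h) (hb : ∀ z, |h z| ≤ 1)
    (a b : ℕ → ℕ) (D : Finset ℕ)
    (hD : ∀ d ∈ D, ∀ d' ∈ D, d ≠ d' → Disjoint ({a d, b d} : Finset ℕ) {a d', b d'}) :
    HasSubgaussianMGF (fun S : ℕ → ℝ≥0 => ∑ d ∈ D, (h (S (a d), S (b d))
        - ∫ S', h (S' (a d), S' (b d)) ∂(Measure.infinitePi fun _ : ℕ => μ)))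
      (D.card : ℝ≥0) (Measure.infinitePi fun _ : ℕ => μ) := by
  have hX : ∀ d, Measurable fun S : ℕ → ℝ≥0 => h (S (a d), S (b d)) := fun d =>
    hm.comp (by fun_prop)
  induction D using Finset.induction_on with
  | empty => simp
  | insert i D hi ih =>
    have ih := ih fun d hd d' hd' => hD d (Finset.mem_insert_of_mem hd) d'
      (Finset.mem_insert_of_mem hd')
    simp_rw [Finset.sum_insert hi, Finset.card_insert_of_notMem hi]
    rw [Nat.cast_add, Nat.cast_one, add_comm (D.card : ℝ≥0) 1]
    refine HasSubgaussianMGF.add_of_indepFun ?_ ih ?_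
    -- Hoeffding's lemma on `[-1, 1]` gives the parameter `((1 - (-1)) / 2)² = 1` for each summand.
    · have := hasSubgaussianMGF_of_mem_Icc (μ := Measure.infinitePi fun _ : ℕ => μ)
        (hX i).aemeasurable (a := -1) (b := 1) (Eventually.of_forall fun S => abs_le.1 (hb _))
      convert this using 1
      norm_num [← NNReal.coe_inj]
    · have hdisj : Disjoint ({a i, b i} : Finset ℕ) (D.biUnion fun d => {a d, b d}) := by
        rw [Finset.disjoint_biUnion_right]
        intro d hd
        exact hD i (Finset.mem_insert_self _ _) d (Finset.mem_insert_of_mem hd)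
          fun e => hi (e ▸ hd)
      have hind : iIndepFun (fun (j : ℕ) (S : ℕ → ℝ≥0) => S j)
          (Measure.infinitePi fun _ : ℕ => μ) :=
        iIndepFun_infinitePi (X := fun _ x => x) fun _ => measurable_id
      have hind2 := hind.indepFun_finset _ _ hdisj fun j => measurable_pi_apply j
      -- Independence is available for finite sets of coordinates, so both summands are written as
      -- functions of such restrictions. The default `0` is never read, as every index used belongs
      -- to its set.
      have hext : ∀ T : Finset ℕ, ∀ j, Measurable fun x : T → ℝ≥0 =>
          if hj : j ∈ T then x ⟨j, hj⟩ else 0 := by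
        intro T j
        by_cases hj : j ∈ T
        · simp only [hj, dif_pos]
          fun_prop
        · simp only [hj, dif_neg, not_false_eq_true]
          fun_prop
      set T₁ : Finset ℕ := {a i, b i}
      set T₂ : Finset ℕ := D.biUnion fun d => {a d, b d} with hT₂
      have := hind2.comp
        (φ := fun x => h (if hj : a i ∈ T₁ then x ⟨_, hj⟩ else 0,
            if hj : b i ∈ T₁ then x ⟨_, hj⟩ else 0)
          - ∫ S', h (S' (a i), S' (b i)) ∂(Measure.infinitePi fun _ : ℕ => μ))
        (ψ := fun x => ∑ d ∈ D, (h (if hj : a d ∈ T₂ then x ⟨_, hj⟩ else 0,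
            if hj : b d ∈ T₂ then x ⟨_, hj⟩ else 0)
          - ∫ S', h (S' (a d), S' (b d)) ∂(Measure.infinitePi fun _ : ℕ => μ)))
        ((hm.comp ((hext T₁ _).prodMk (hext T₁ _))).sub_const _)
        (Finset.measurable_sum _ fun d _ =>
          (hm.comp ((hext T₂ _).prodMk (hext T₂ _))).sub_const _)
      convert this using 1
      · funext S
        simp [T₁]
      · funext S
        refine Finset.sum_congr rfl fun d hd => ?_
        have h1 : a d ∈ T₂ := Finset.mem_biUnion.2 ⟨d, hd, by simp⟩
        have h2 : b d ∈ T₂ := Finset.mem_biUnion.2 ⟨d, hd, by simp⟩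
        simp [h1, h2]

lemma integral_infinitePi_pair {h : ℝ≥0 × ℝ≥0 → ℝ} (hm : Measurable h) {i j : ℕ} (hij : i ≠ j) :
    ∫ S, h (S i, S j) ∂(Measure.infinitePi fun _ : ℕ => μ) = ∫ z, h z ∂(μ.prod μ) := by
  rw [← Measure.infinitePi_map_eval_prod (P := fun _ : ℕ => μ) hij,
    integral_map (Measurable.aemeasurable (by fun_prop)) hm.aestronglyMeasurable]

lemma integral_infinitePi_eval {g : ℝ≥0 → ℝ} (hm : Measurable g) (i : ℕ) :
    ∫ S, g (S i) ∂(Measure.infinitePi fun _ : ℕ => μ) = ∫ y, g y ∂μ := by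
  have := integral_map (μ := Measure.infinitePi fun _ : ℕ => μ) (measurable_pi_apply i).aemeasurable
    hm.aestronglyMeasurable
  rw [← this, Measure.infinitePi_map_eval]

lemma tendsto_card_range_div (k : ℕ) :
    Tendsto (fun n : ℕ => ((2 * n - 1 - k : ℕ) : ℝ) / (2 * n)) atTop (𝓝 1) := by
  have h : Tendsto (fun n : ℕ => 1 - ((1 + k : ℕ) : ℝ) / 2 * (1 / (n : ℝ))) atTop (𝓝 1) := by
    simpa using (tendsto_one_div_atTop_nhds_zero_nat (𝕜 := ℝ)).const_mul
      (((1 + k : ℕ) : ℝ) / 2) |>.const_sub 1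
  refine h.congr' ?_
  filter_upwards [eventually_ge_atTop (1 + k)] with n hn
  have hn0 : (n : ℝ) ≠ 0 := by
    have : 0 < n := by omega
    positivity
  have e : 2 * n - 1 - k = 2 * n - (1 + k) := by omega
  rw [e, Nat.cast_sub (by omega)]
  push_cast
  field_simp

variable {o : ℕ → ℕ → ℕ} (ho : ∀ n, Set.InjOn (o n) (Set.Iio (2 * n - 1)))

include ho

/-- The enumeration `o n` changes with `n`, so these are not partial sums of one sequence; the
exponential tail bounds are insensitive to this. Each coordinate is treated as a degenerate pair. -/
lemma ae_tendsto_average {g : ℝ≥0 → ℝ} (hm : Measurable g) (hb : ∀ y, |g y| ≤ 1) :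
    ∀ᵐ S ∂(Measure.infinitePi fun _ : ℕ => μ),
      Tendsto (fun n : ℕ => (∑ d ∈ Finset.range (2 * n - 1), g (S (o n d))) / (2 * n)) atTop
        (𝓝 (∫ y, g y ∂μ)) := by
  have key := ae_tendsto_div_of_hasSubgaussianMGF fun n => hasSubgaussianMGF_mono
    (hasSubgaussianMGF_sum_pairs (μ := μ) (h := fun z => g z.1) (hm.comp measurable_fst)
      (fun z => hb _) (o n) (o n) (Finset.range (2 * n - 1)) fun d hd d' hd' hdd' => by
        have : o n d ≠ o n d' := fun e => hdd' (ho n (by simpa using hd) (by simpa using hd') e)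
        simpa using this)
    (show _ ≤ ((2 * n : ℕ) : ℝ≥0) by
      rw [Finset.card_range]; exact_mod_cast Nat.sub_le _ _)
  filter_upwards [key] with S hS
  have h2 := hS.add ((tendsto_card_range_div 0).mul_const (∫ y, g y ∂μ))
  rw [zero_add, one_mul] at h2
  refine h2.congr fun n => ?_
  simp_rw [integral_infinitePi_eval hm, Finset.sum_sub_distrib]
  rw [Finset.sum_const, Finset.card_range, nsmul_eq_mul, Nat.sub_zero]
  ring

/-- The pairs at `d` and `d + k` overlap. Sorting `d` by the parity of `d / k` separates them, since
adding `k` raises `d / k` by one; within each class the pairs are disjoint, hence independent. -/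
lemma ae_tendsto_pair_average {h : ℝ≥0 × ℝ≥0 → ℝ} (hm : Measurable h) (hb : ∀ z, |h z| ≤ 1)
    {k : ℕ} (hk : 0 < k) :
    ∀ᵐ S ∂(Measure.infinitePi fun _ : ℕ => μ),
      Tendsto (fun n : ℕ => (∑ d ∈ Finset.range (2 * n - 1 - k), h (S (o n d), S (o n (d + k))))
        / (2 * n)) atTop (𝓝 (∫ z, h z ∂(μ.prod μ))) := by
  have hne : ∀ n d d' : ℕ, d < 2 * n - 1 → d' < 2 * n - 1 → d ≠ d' → o n d ≠ o n d' :=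
    fun n d d' hd hd' hdd' e => hdd' (ho n hd hd' e)
  have key : ∀ r : ℕ, ∀ᵐ S ∂(Measure.infinitePi fun _ : ℕ => μ), Tendsto (fun n : ℕ =>
      (∑ d ∈ Finset.range (2 * n - 1 - k) with d / k % 2 = r,
        (h (S (o n d), S (o n (d + k))) - ∫ z, h z ∂(μ.prod μ))) / (2 * n)) atTop (𝓝 0) := by
    intro r
    have := ae_tendsto_div_of_hasSubgaussianMGF fun n => hasSubgaussianMGF_mono
      (hasSubgaussianMGF_sum_pairs (μ := μ) hm hb (o n) (fun d => o n (d + k))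
        ((Finset.range (2 * n - 1 - k)).filter fun d => d / k % 2 = r) fun d hd d' hd' hdd' => ?_)
      (show _ ≤ ((2 * n : ℕ) : ℝ≥0) from ?_)
    · filter_upwards [this] with S hS
      refine hS.congr fun n => ?_
      congr 1
      refine Finset.sum_congr rfl fun d hd => ?_
      have hd1 := Finset.mem_range.1 (Finset.mem_filter.1 hd).1
      rw [integral_infinitePi_pair hm (hne n d (d + k) (by omega) (by omega) (by omega))]
    · rw [Finset.mem_filter, Finset.mem_range] at hd hd'
      have e1 : (d + k) / k = d / k + 1 := Nat.add_div_right d hk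
      have e2 : (d' + k) / k = d' / k + 1 := Nat.add_div_right d' hk
      have n1 : d ≠ d' + k := fun e => by rw [← e] at e2; omega
      have n2 : d + k ≠ d' := fun e => by rw [e] at e1; omega
      have m1 := hne n d d' (by omega) (by omega) hdd'
      have m2 := hne n d (d' + k) (by omega) (by omega) n1
      have m3 := hne n (d + k) d' (by omega) (by omega) n2
      have m4 := hne n (d + k) (d' + k) (by omega) (by omega) (by omega)
      rw [Finset.disjoint_left]
      intro x hx hx'
      simp only [Finset.mem_insert, Finset.mem_singleton] at hx hx'
      rcases hx with rfl | rfl <;> rcases hx' with e | e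
      exacts [m1 e, m2 e, m3 e, m4 e]
    · have : (((Finset.range (2 * n - 1 - k)).filter fun d => d / k % 2 = r).card) ≤ 2 * n :=
        (Finset.card_filter_le _ _).trans (by rw [Finset.card_range]; omega)
      exact_mod_cast this
  filter_upwards [key 0, key 1] with S h0 h1
  have h2 := (h0.add h1).add ((tendsto_card_range_div k).mul_const (∫ z, h z ∂(μ.prod μ)))
  rw [zero_add, zero_add, one_mul] at h2
  refine h2.congr fun n => ?_
  have e : ∑ d ∈ Finset.range (2 * n - 1 - k) with d / k % 2 = 0,
        (h (S (o n d), S (o n (d + k))) - ∫ z, h z ∂(μ.prod μ))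
      + ∑ d ∈ Finset.range (2 * n - 1 - k) with d / k % 2 = 1,
        (h (S (o n d), S (o n (d + k))) - ∫ z, h z ∂(μ.prod μ))
      = ∑ d ∈ Finset.range (2 * n - 1 - k),
        (h (S (o n d), S (o n (d + k))) - ∫ z, h z ∂(μ.prod μ)) := by
    rw [← Finset.sum_filter_add_sum_filter_not (Finset.range (2 * n - 1 - k))
      (fun d => d / k % 2 = 0)]
    congr 2
    refine Finset.filter_congr fun d _ => ?_
    omega
  rw [← add_div, e, Finset.sum_sub_distrib, Finset.sum_const, Finset.card_range, nsmul_eq_mul]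
  ring

end StrongLaw

/-! ### Reduction of the league to the path of `T_0`. -/

section QuenchedLaw

variable {N : ℕ}

/-- The day on which `T_0` plays against `T_{j+1}`. -/
def Calendar.opponentDay (C : Calendar N) (j : Fin N) : ℕ := C.day 0 j.succ

lemma Calendar.opponentDay_injective (C : Calendar N) : Function.Injective C.opponentDay := by
  intro i j hij
  exact Fin.succ_injective _ ((C.bijOn 0).injOn (Fin.succ_ne_zero i) (Fin.succ_ne_zero j) hij)

lemma Calendar.opponentDay_lt (C : Calendar N) (j : Fin N) : C.opponentDay j < N :=
  (C.bijOn 0).mapsTo (Fin.succ_ne_zero j)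

lemma Calendar.exists_opponentDay_eq (C : Calendar N) {d : ℕ} (hd : d < N) :
    ∃ j, C.opponentDay j = d := by
  obtain ⟨i, hi, hid⟩ := (C.bijOn 0).surjOn hd
  obtain ⟨j, rfl⟩ := Fin.exists_succ_eq.2 hi
  exact ⟨j, hid⟩

open Classical in
/-- The index of the initial strength of the opponent of `T_0` on day `d`. -/
def Calendar.opponent (C : Calendar N) (d : ℕ) : ℕ :=
  if h : ∃ j, C.opponentDay j = d then (h.choose : ℕ) else 0

lemma Calendar.opponent_opponentDay (C : Calendar N) (j : Fin N) :
    C.opponent (C.opponentDay j) = j := by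
  have h : ∃ i, C.opponentDay i = C.opponentDay j := ⟨j, rfl⟩
  rw [Calendar.opponent, dif_pos h, C.opponentDay_injective h.choose_spec]

lemma Calendar.injOn_opponent (C : Calendar N) : Set.InjOn C.opponent (Set.Iio N) := by
  intro d hd d' hd' h
  obtain ⟨j, rfl⟩ := C.exists_opponentDay_eq hd
  obtain ⟨j', rfl⟩ := C.exists_opponentDay_eq hd'
  rw [opponent_opponentDay, opponent_opponentDay] at h
  rw [Fin.ext h]

lemma Calendar.prod_opponentDay (C : Calendar N) {M : Type*} [CommMonoid M] (G : ℕ → ℕ → M) :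
    ∏ j : Fin N, G (C.opponentDay j) j = ∏ d ∈ Finset.range N, G d (C.opponent d) := by
  refine Finset.prod_bij (fun j _ => C.opponentDay j)
    (fun j _ => Finset.mem_range.2 (C.opponentDay_lt j))
    (fun i _ j _ h => C.opponentDay_injective h) (fun d hd => ?_) fun j _ => ?_
  · obtain ⟨j, hj⟩ := C.exists_opponentDay_eq (Finset.mem_range.1 hd)
    exact ⟨j, Finset.mem_univ _, hj⟩
  · rw [opponent_opponentDay]

lemma Calendar.sum_opponentDay (C : Calendar N) {M : Type*} [AddCommMonoid M] (G : ℕ → ℕ → M) :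
    ∑ j : Fin N, G (C.opponentDay j) j = ∑ d ∈ Finset.range N, G d (C.opponent d) := by
  have := C.prod_opponentDay (M := Multiplicative M) fun d i => Multiplicative.ofAdd (G d i)
  exact this

/-- The match of `T_0` against `T_{j+1}`. -/
def matchZero (j : Fin N) : Match N := ⟨(0, j.succ), j.succ_pos⟩

lemma matchZero_injective : Function.Injective (matchZero (N := N)) := by
  intro i j h
  have := congrArg (fun m : Match N => m.1.2) h
  exact Fin.succ_injective _ this

/-- The matches without `T_0` are given the constant function `1`, which integrates to `1`; the
product structure then leaves only the matches of `T_0`. -/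
lemma integral_condResults_prod (f : WinFunction) (C : Calendar N) (x : Fin (N + 1) → ℝ≥0)
    (e : Fin (N + 1) → ℕ → ℝ≥0) (h : Fin N → Bool → ℂ) :
    ∫ r, ∏ j, h j (r (matchZero j)) ∂(condResults f C x e)
      = ∏ j, (((winProb f C x e (matchZero j) : ℝ) : ℂ) * h j true
        + (1 - ((winProb f C x e (matchZero j) : ℝ) : ℂ)) * h j false) := by
  classical
  let H : Match N → Bool → ℂ := fun m b =>
    if m.1.1 = 0 then h (m.1.2.pred (Fin.ne_zero_of_lt m.2)) b else 1
  have hH : ∀ j, H (matchZero j) = h j := by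
    intro j
    funext b
    simp [H, matchZero]
  have hrange : ∀ m : Match N, m ∉ Set.range (matchZero (N := N)) → m.1.1 ≠ 0 := by
    rintro ⟨⟨a, b⟩, hab⟩ hm rfl
    obtain ⟨j, rfl⟩ := Fin.exists_succ_eq.2 (Fin.ne_zero_of_lt hab)
    exact hm ⟨j, rfl⟩
  have e1 : ∀ r : Match N → Bool, ∏ j, h j (r (matchZero j)) = ∏ m, H m (r m) := fun r =>
    Fintype.prod_of_injective matchZero matchZero_injective _ _
      (fun m hm => by simp [H, hrange m hm]) fun j => by rw [hH]
  simp_rw [e1, condResults]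
  rw [integral_fintype_prod_eq_prod]
  symm
  refine Fintype.prod_of_injective matchZero matchZero_injective _ _ (fun m hm => ?_) fun j => ?_
  · simp [H, hrange m hm]
  · rw [hH, integral_bernoulliMeasure]
    simp

variable {Ω : Type*} [mΩ : MeasurableSpace Ω] {P : Measure Ω} [IsProbabilityMeasure P]
  {ξ : ℕ → Ω → ℝ≥0} {ν : Measure ℝ≥0} [IsProbabilityMeasure ν]

lemma integral_bind_condResults (f : WinFunction) (Q : ProbabilityMeasure (ℕ → ℝ≥0))
    (C : Calendar N) (x : Fin (N + 1) → ℝ≥0) (g : (Match N → Bool) → ℂ) :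
    ∫ r, g r ∂(resultsLaw f Q C x : Measure (Match N → Bool))
      = ∫ e, ∫ r, g r ∂(condResults f C x e)
        ∂(Measure.pi fun _ : Fin (N + 1) => (Q : Measure (ℕ → ℝ≥0))) := by
  let κ : Kernel (Fin (N + 1) → ℕ → ℝ≥0) (Match N → Bool) :=
    ⟨condResults f C x, measurable_condResults f C x⟩
  let m := Measure.pi fun _ : Fin (N + 1) => (Q : Measure (ℕ → ℝ≥0))
  have hm : (resultsLaw f Q C x : Measure (Match N → Bool)) = (κ ∘ₖ Kernel.const Unit m) () :=
    (show _ = m.bind κ from rfl).trans (Measure.comp_eq_comp_const_apply (κ := κ) (μ := m))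
  have hprob := (resultsLaw f Q C x).2
  rw [hm, Kernel.integral_comp (hm ▸ Integrable.of_finite), Kernel.const_apply]
  rfl

/-- Fubini, with coordinate `0` integrated last: once it is fixed, the factors depend on different
independent coordinates. -/
lemma integral_pi_prod_succ {X : Type*} [MeasurableSpace X] {Q : Measure X}
    [IsProbabilityMeasure Q] {φ : X → Fin N → X → ℂ} {B : Fin N → ℝ}
    (hφ : ∀ j, Measurable fun z : X × X => φ z.1 j z.2) (hB : ∀ x j y, ‖φ x j y‖ ≤ B j) :
    ∫ e, ∏ j : Fin N, φ (e 0) j (e j.succ) ∂(Measure.pi fun _ : Fin (N + 1) => Q)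
      = ∫ x, ∏ j : Fin N, ∫ y, φ x j y ∂Q ∂Q := by
  rw [← ((measurePreserving_piFinSuccAbove (fun _ : Fin (N + 1) => Q) 0).symm).integral_comp']
  have e2 : ∀ z : X × (Fin N → X),
      ∏ j : Fin N, φ ((MeasurableEquiv.piFinSuccAbove (fun _ : Fin (N + 1) => X) 0).symm z 0) j
        ((MeasurableEquiv.piFinSuccAbove (fun _ : Fin (N + 1) => X) 0).symm z j.succ)
      = ∏ j : Fin N, φ z.1 j (z.2 j) := by
    intro z
    simp [MeasurableEquiv.piFinSuccAbove_symm_apply, Fin.insertNthEquiv]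
  simp_rw [e2]
  rw [integral_prod]
  · simp_rw [integral_fintype_prod_eq_prod]
  · have hm : Measurable fun z : X × (Fin N → X) => ∏ j : Fin N, φ z.1 j (z.2 j) :=
      Finset.measurable_prod _ fun j _ => (hφ j).comp
        (measurable_fst.prodMk ((measurable_pi_apply j).comp measurable_snd))
    refine Integrable.of_bound (C := ∏ j, B j) hm.aestronglyMeasurable
      (Eventually.of_forall fun z => ?_)
    rw [norm_prod]
    exact Finset.prod_le_prod (fun j _ => norm_nonneg _) fun j _ => hB _ _ _

/-- Each opponent's path is read at a single day, where its law is `ν`. The integrand is affine in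
the winning probability, so averaging over the opponent replaces `f` by `F_s`; only the path of
`T_0` keeps its joint law. -/
lemma integral_quenchedLaw_prod (hξ : ∀ ℓ, Measurable (ξ ℓ)) (hstat : IsPairStationary P ξ ν)
    (f : WinFunction) (C : Calendar N) (s : ℝ≥0) (S : ℕ → ℝ≥0) (h : Fin N → Bool → ℂ) :
    ∫ r, ∏ j, h j (r (matchZero j)) ∂(quenchedLaw f (pathLaw P ξ hξ) C s S)
      = ∫ ω, ∏ j : Fin N, ((F f ν s (ξ (C.opponentDay j) ω) (S j) : ℂ) * h j true
        + (1 - (F f ν s (ξ (C.opponentDay j) ω) (S j) : ℂ)) * h j false) ∂P := by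
  unfold quenchedLaw
  rw [integral_bind_condResults]
  simp_rw [integral_condResults_prod]
  set Q : Measure (ℕ → ℝ≥0) := (pathLaw P ξ hξ : Measure (ℕ → ℝ≥0)) with hQ
  have hQeq : Q = P.map fun ω ℓ => ξ ℓ ω := rfl
  have hQprob : IsProbabilityMeasure Q := (pathLaw P ξ hξ).2
  let w : (ℕ → ℝ≥0) → Fin N → (ℕ → ℝ≥0) → ℝ := fun x j y =>
    (f (s * x (C.opponentDay j)) (S j * y (C.opponentDay j)) : ℝ)
  have hw : ∀ j, Measurable fun z : (ℕ → ℝ≥0) × (ℕ → ℝ≥0) => w z.1 j z.2 := fun j =>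
    (measurable_winFunction f).comp (by fun_prop : Measurable fun z : (ℕ → ℝ≥0) × (ℕ → ℝ≥0) =>
      (s * z.1 (C.opponentDay j), S j * z.2 (C.opponentDay j)))
  have hw0 : ∀ x j y, 0 ≤ w x j y := fun x j y => unitInterval.nonneg _
  have hw1 : ∀ x j y, w x j y ≤ 1 := fun x j y => unitInterval.le_one _
  let φ : (ℕ → ℝ≥0) → Fin N → (ℕ → ℝ≥0) → ℂ := fun x j y =>
    (w x j y : ℂ) * h j true + (1 - (w x j y : ℂ)) * h j false
  have hφm : ∀ j, Measurable fun z : (ℕ → ℝ≥0) × (ℕ → ℝ≥0) => φ z.1 j z.2 := by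
    intro j
    have := hw j
    fun_prop
  have hφb : ∀ x j y, ‖φ x j y‖ ≤ ‖h j true‖ + ‖h j false‖ := by
    intro x j y
    refine (norm_add_le _ _).trans (add_le_add ?_ ?_)
    · rw [norm_mul, Complex.norm_real, Real.norm_of_nonneg (hw0 x j y)]
      exact mul_le_of_le_one_left (norm_nonneg _) (hw1 x j y)
    · rw [norm_mul, ← Complex.ofReal_one, ← Complex.ofReal_sub, Complex.norm_real,
        Real.norm_of_nonneg (by linarith [hw1 x j y])]
      exact mul_le_of_le_one_left (norm_nonneg _) (by linarith [hw0 x j y])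
  have e1 : ∀ e : Fin (N + 1) → ℕ → ℝ≥0,
      ∏ j, (((winProb f C (strengths s S N) e (matchZero j) : ℝ) : ℂ) * h j true
        + (1 - ((winProb f C (strengths s S N) e (matchZero j) : ℝ) : ℂ)) * h j false)
      = ∏ j, φ (e 0) j (e j.succ) := by
    intro e
    rfl
  simp_rw [e1]
  rw [integral_pi_prod_succ hφm hφb]
  have e3 : ∀ x j, ∫ y, φ x j y ∂Q = (F f ν s (x (C.opponentDay j)) (S j) : ℂ) * h j true
      + (1 - (F f ν s (x (C.opponentDay j)) (S j) : ℂ)) * h j false := by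
    intro x j
    have hwx : Measurable (w x j) := (hw j).comp (measurable_const.prodMk measurable_id)
    have iw : Integrable (w x j) Q := Integrable.of_bound hwx.aestronglyMeasurable 1
      (Eventually.of_forall fun y => by rw [Real.norm_of_nonneg (hw0 x j y)]; exact hw1 x j y)
    have iw' : Integrable (fun y => (w x j y : ℂ)) Q := iw.ofReal
    have hwF : ∫ y, w x j y ∂Q = F f ν s (x (C.opponentDay j)) (S j) := by
      have hm : Measurable fun v : ℝ≥0 => (f (s * x (C.opponentDay j)) (S j * v) : ℝ) :=
        (measurable_winFunction f).comp (by fun_prop : Measurable fun v : ℝ≥0 =>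
          (s * x (C.opponentDay j), S j * v))
      rw [hQeq, integral_map (measurable_pi_lambda _ hξ).aemeasurable hwx.aestronglyMeasurable]
      exact integral_comp_eq hξ hstat hm (C.opponentDay j)
    have : ∀ y, φ x j y = (w x j y : ℂ) * (h j true - h j false) + h j false := by
      intro y
      simp only [φ]
      ring
    simp_rw [this]
    rw [integral_add (iw'.mul_const _) (integrable_const _), integral_mul_const,
      integral_complex_ofReal, hwF]
    simp
    ring
  simp_rw [e3]
  rw [hQeq, integral_map (measurable_pi_lambda _ hξ).aemeasurable]
  refine Measurable.aestronglyMeasurable (Finset.measurable_prod _ fun j _ => ?_)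
  have hF : Measurable fun x : ℕ → ℝ≥0 => F f ν s (x (C.opponentDay j)) (S j) :=
    (measurable_F f s).comp (by fun_prop : Measurable fun x : ℕ → ℝ≥0 =>
      (x (C.opponentDay j), S j))
  fun_prop

lemma wins_eq_sum (r : Match N → Bool) :
    (wins r : ℝ) = ∑ j : Fin N, if r (matchZero j) = true then (1 : ℝ) else 0 := by
  rw [Finset.sum_boole]
  rfl

lemma integral_wins_quenchedLaw (hξ : ∀ ℓ, Measurable (ξ ℓ)) (hstat : IsPairStationary P ξ ν)
    (f : WinFunction) (C : Calendar N) (s : ℝ≥0) (S : ℕ → ℝ≥0) :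
    ∫ r, (wins r : ℝ) ∂(quenchedLaw f (pathLaw P ξ hξ) C s S)
      = ∑ d ∈ Finset.range N, meanF f ν s (S (C.opponent d)) := by
  simp_rw [wins_eq_sum]
  rw [integral_finsetSum _ fun j _ => Integrable.of_finite,
    ← C.sum_opponentDay fun _ i => meanF f ν s (S i)]
  refine Finset.sum_congr rfl fun j _ => ?_
  -- The test function is the indicator of a win in match `j` and `1` in all other matches.
  have key := integral_quenchedLaw_prod hξ hstat f C s S
    fun i b => if i = j then (if b = true then 1 else 0) else 1
  have e1 : ∀ r : Match N → Bool,
      ∏ i, (if i = j then (if r (matchZero i) = true then (1 : ℂ) else 0) else 1)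
        = (((if r (matchZero j) = true then (1 : ℝ) else 0) : ℝ) : ℂ) := by
    intro r
    rw [Finset.prod_ite_eq' Finset.univ j
      (fun i => if r (matchZero i) = true then (1 : ℂ) else 0)]
    by_cases hr : r (matchZero j) = true <;> simp [hr]
  have e2 : ∀ ω, ∏ i : Fin N, ((F f ν s (ξ (C.opponentDay i) ω) (S i) : ℂ)
      * (if i = j then (if true = true then 1 else 0) else 1)
        + (1 - (F f ν s (ξ (C.opponentDay i) ω) (S i) : ℂ))
          * (if i = j then (if false = true then 1 else 0) else 1))
      = (F f ν s (ξ (C.opponentDay j) ω) (S j) : ℂ) := by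
    intro ω
    rw [Fintype.prod_eq_single j fun i hij => by simp [hij]]
    simp
  have key' := (integral_congr_ae (Eventually.of_forall e1)).symm.trans
    (key.trans (integral_congr_ae (Eventually.of_forall e2)))
  rw [integral_complex_ofReal, integral_complex_ofReal] at key'
  rw [Complex.ofReal_injective key']
  exact integral_comp_eq hξ hstat (g := fun v => F f ν s v (S j))
    ((measurable_F f s).comp (measurable_id.prodMk measurable_const)) _

lemma integral_exp_wins_quenchedLaw (hξ : ∀ ℓ, Measurable (ξ ℓ)) (hstat : IsPairStationary P ξ ν)
    (f : WinFunction) (C : Calendar N) (s : ℝ≥0) (S : ℕ → ℝ≥0) (τ : ℝ) :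
    ∫ r, Complex.exp (Complex.I * (τ * (wins r : ℝ) : ℝ)) ∂(quenchedLaw f (pathLaw P ξ hξ) C s S)
      = ∫ ω, ∏ d ∈ Finset.range N,
        ((F f ν s (ξ d ω) (S (C.opponent d)) : ℂ) * Complex.exp (Complex.I * (τ : ℝ))
          + (1 - (F f ν s (ξ d ω) (S (C.opponent d)) : ℂ))) ∂P := by
  have key := integral_quenchedLaw_prod hξ hstat f C s S
    fun _ b => if b = true then Complex.exp (Complex.I * (τ : ℝ)) else 1
  have e1 : ∀ r : Match N → Bool,
      ∏ i, (if r (matchZero i) = true then Complex.exp (Complex.I * (τ : ℝ)) else 1)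
        = Complex.exp (Complex.I * (τ * (wins r : ℝ) : ℝ)) := by
    intro r
    rw [wins_eq_sum, Complex.ofReal_mul, Complex.ofReal_sum, ← mul_assoc, Finset.mul_sum,
      Complex.exp_sum]
    refine Finset.prod_congr rfl fun i _ => ?_
    by_cases hr : r (matchZero i) = true <;> simp [hr]
  simp_rw [e1] at key
  rw [key]
  refine integral_congr_ae (Eventually.of_forall fun ω => ?_)
  simp only
  rw [← C.prod_opponentDay fun d i =>
    ((F f ν s (ξ d ω) (S i) : ℂ) * Complex.exp (Complex.I * (τ : ℝ))
          + (1 - (F f ν s (ξ d ω) (S i) : ℂ)))]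
  simp

end QuenchedLaw

/-! ### Characteristic function of a centred Bernoulli variable. -/

section Bernoulli

lemma exp_neg_mul_bernoulli_eq (τ x : ℝ) :
    Complex.exp (-(Complex.I * (τ * x : ℝ)))
        * ((x : ℂ) * Complex.exp (Complex.I * (τ : ℝ)) + (1 - x))
      = x * Complex.exp (Complex.I * (τ * (1 - x) : ℝ))
        + (1 - x) * Complex.exp (Complex.I * (τ * (-x) : ℝ)) := by
  rw [mul_add, mul_left_comm, ← Complex.exp_add, mul_comm _ (1 - (x : ℂ))]
  congr 3
  · push_cast; ring
  · push_cast; ring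

/-- The characteristic function of a centred Bernoulli variable. -/
lemma norm_bernoulli_sub_exp_le (τ : ℝ) {x : ℝ} (hx0 : 0 ≤ x) (hx1 : x ≤ 1) :
    ‖Complex.exp (-(Complex.I * (τ * x : ℝ)))
        * ((x : ℂ) * Complex.exp (Complex.I * (τ : ℝ)) + (1 - x))
      - (Real.exp (-(τ ^ 2 / 2 * (x - x ^ 2))) : ℂ)‖ ≤ 4 * |τ| ^ 3 + τ ^ 4 := by
  have h1 := norm_exp_I_mul_sub_quadratic_le (τ * (1 - x))
  have h2 := norm_exp_I_mul_sub_quadratic_le (τ * (-x))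
  have hv0 : 0 ≤ x - x ^ 2 := by nlinarith
  have hv1 : x - x ^ 2 ≤ 1 := by nlinarith
  have h3 := abs_exp_neg_sub_linear_le (x := τ ^ 2 / 2 * (x - x ^ 2)) (by positivity)
  have b1 : 4 * |τ * (1 - x)| ^ 3 ≤ 4 * |τ| ^ 3 := by
    rw [abs_mul, mul_pow, abs_of_nonneg (by linarith : 0 ≤ 1 - x)]
    have : (1 - x) ^ 3 ≤ 1 := pow_le_one₀ (by linarith) (by linarith)
    nlinarith [pow_nonneg (abs_nonneg τ) 3]
  have b2 : 4 * |τ * (-x)| ^ 3 ≤ 4 * |τ| ^ 3 := by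
    rw [abs_mul, mul_pow, abs_neg, abs_of_nonneg hx0]
    have : x ^ 3 ≤ 1 := pow_le_one₀ hx0 hx1
    nlinarith [pow_nonneg (abs_nonneg τ) 3]
  have b3 : (τ ^ 2 / 2 * (x - x ^ 2)) ^ 2 ≤ τ ^ 4 := by
    have h4 : τ ^ 2 / 2 * (x - x ^ 2) ≤ τ ^ 2 := by nlinarith [sq_nonneg τ]
    calc (τ ^ 2 / 2 * (x - x ^ 2)) ^ 2 ≤ (τ ^ 2) ^ 2 :=
          pow_le_pow_left₀ (by positivity) h4 2
      _ = τ ^ 4 := by ring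
  rw [exp_neg_mul_bernoulli_eq]
  have e : (x : ℂ) * Complex.exp (Complex.I * (τ * (1 - x) : ℝ))
        + (1 - x) * Complex.exp (Complex.I * (τ * (-x) : ℝ))
        - (Real.exp (-(τ ^ 2 / 2 * (x - x ^ 2))) : ℂ)
      = ((x : ℝ) : ℂ) * (Complex.exp (Complex.I * (τ * (1 - x) : ℝ))
          - (1 + Complex.I * (τ * (1 - x) : ℝ) - ((τ * (1 - x) : ℝ) : ℂ) ^ 2 / 2))
        + ((1 - x : ℝ) : ℂ) * (Complex.exp (Complex.I * (τ * (-x) : ℝ))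
          - (1 + Complex.I * (τ * (-x) : ℝ) - ((τ * (-x) : ℝ) : ℂ) ^ 2 / 2))
        - ((Real.exp (-(τ ^ 2 / 2 * (x - x ^ 2))) - (1 - τ ^ 2 / 2 * (x - x ^ 2)) : ℝ) : ℂ) := by
    push_cast
    ring
  rw [e]
  refine (norm_sub_le _ _).trans (add_le_add ((norm_add_le _ _).trans ?_) ?_)
  · rw [norm_mul, norm_mul, Complex.norm_real, Complex.norm_real, Real.norm_of_nonneg hx0,
      Real.norm_of_nonneg (by linarith : 0 ≤ 1 - x)]
    have c1 := mul_le_mul_of_nonneg_left (h1.trans b1) hx0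
    have c2 := mul_le_mul_of_nonneg_left (h2.trans b2) (by linarith : 0 ≤ 1 - x)
    linarith
  · rw [Complex.norm_real]
    exact h3.trans b3

lemma norm_bernoulli_le_one (τ : ℝ) {x : ℝ} (hx0 : 0 ≤ x) (hx1 : x ≤ 1) :
    ‖Complex.exp (-(Complex.I * (τ * x : ℝ)))
        * ((x : ℂ) * Complex.exp (Complex.I * (τ : ℝ)) + (1 - x))‖ ≤ 1 := by
  rw [exp_neg_mul_bernoulli_eq]
  refine (norm_add_le _ _).trans ?_
  rw [norm_mul, norm_mul, Complex.norm_exp_I_mul_ofReal, Complex.norm_exp_I_mul_ofReal,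
    ← Complex.ofReal_one, ← Complex.ofReal_sub, Complex.norm_real, Complex.norm_real,
    Real.norm_of_nonneg hx0, Real.norm_of_nonneg (by linarith : 0 ≤ 1 - x)]
  linarith

end Bernoulli

/-! ### Assembly of the quenched central limit theorem. -/

section QuenchedCLT

variable {Ω : Type*} [mΩ : MeasurableSpace Ω] {P : Measure Ω} [IsProbabilityMeasure P]
  {ξ : ℕ → Ω → ℝ≥0} (f : WinFunction) {μ ν : Measure ℝ≥0} [IsProbabilityMeasure μ]
  [IsProbabilityMeasure ν] (s : ℝ≥0)

/-- The mean number of wins is the sum of the means of `F_s`, so `F_s` minus its mean is `F̃_s`.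
Each day gives a phase from the fluctuation of the winning probability times the characteristic
function of a Bernoulli variable centred given the path. -/
lemma integral_exp_centred_wins (hξ : ∀ ℓ, Measurable (ξ ℓ)) (hstat : IsPairStationary P ξ ν)
    {N : ℕ} (C : Calendar N) (S : ℕ → ℝ≥0) (τ : ℝ) :
    ∫ r, Complex.exp (Complex.I * (τ * ((wins r : ℝ)
        - ∫ r', (wins r' : ℝ) ∂(quenchedLaw f (pathLaw P ξ hξ) C s S)) : ℝ))
        ∂(quenchedLaw f (pathLaw P ξ hξ) C s S)
      = ∫ ω, ∏ d ∈ Finset.range N,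
          (Complex.exp (Complex.I * (τ * Ftilde f ν s (ξ d ω) (S (C.opponent d)) : ℝ))
            * (Complex.exp (-(Complex.I * (τ * F f ν s (ξ d ω) (S (C.opponent d)) : ℝ)))
              * ((F f ν s (ξ d ω) (S (C.opponent d)) : ℂ) * Complex.exp (Complex.I * (τ : ℝ))
                + (1 - (F f ν s (ξ d ω) (S (C.opponent d)) : ℂ))))) ∂P := by
  rw [integral_wins_quenchedLaw hξ hstat]
  set m : ℝ := ∑ d ∈ Finset.range N, meanF f ν s (S (C.opponent d)) with hm
  have e1 : ∀ w : ℝ, Complex.exp (Complex.I * (τ * (w - m) : ℝ))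
      = Complex.exp (Complex.I * (τ * w : ℝ)) * Complex.exp (-(Complex.I * (τ * m : ℝ))) := by
    intro w
    rw [← Complex.exp_add]
    congr 1
    push_cast
    ring
  simp_rw [e1]
  rw [integral_mul_const, integral_exp_wins_quenchedLaw hξ hstat, ← integral_mul_const]
  refine integral_congr_ae (Eventually.of_forall fun ω => ?_)
  have e2 : Complex.exp (-(Complex.I * (τ * m : ℝ)))
      = ∏ d ∈ Finset.range N,
        Complex.exp (-(Complex.I * (τ * meanF f ν s (S (C.opponent d)) : ℝ))) := by
    rw [← Complex.exp_sum, hm, Finset.sum_neg_distrib, ← Finset.mul_sum, ← Complex.ofReal_sum,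
      ← Finset.mul_sum]
  simp only
  rw [e2, ← Finset.prod_mul_distrib]
  refine Finset.prod_congr rfl fun d _ => ?_
  rw [← mul_assoc (Complex.exp (Complex.I * _)), ← Complex.exp_add, mul_comm]
  congr 2
  change _ = Complex.I * ((τ * (F f ν s (ξ d ω) (S (C.opponent d))
    - meanF f ν s (S (C.opponent d))) : ℝ) : ℂ) + _
  push_cast
  ring

/-- The randomness of the results given the strengths contributes an independent Gaussian factor to
the characteristic function. -/
lemma norm_integral_prod_bernoulli_sub_le (hξ : ∀ ℓ, Measurable (ξ ℓ))
    (hstat : IsPairStationary P ξ ν) (hα : Summable fun n : ℕ => alpha P ξ (n + 1))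
    (y : ℕ → ℝ≥0) (N : ℕ) (τ : ℝ) {c : ℝ} (hc : 0 ≤ c) :
    ‖∫ ω, ∏ d ∈ Finset.range N,
          (Complex.exp (Complex.I * (τ * Ftilde f ν s (ξ d ω) (y d) : ℝ))
            * (Complex.exp (-(Complex.I * (τ * F f ν s (ξ d ω) (y d) : ℝ)))
              * ((F f ν s (ξ d ω) (y d) : ℂ) * Complex.exp (Complex.I * (τ : ℝ))
                + (1 - (F f ν s (ξ d ω) (y d) : ℂ))))) ∂P
        - Real.exp (-c) * ∫ ω, Complex.exp (Complex.I *
          (τ * ∑ d ∈ Finset.range N, Ftilde f ν s (ξ d ω) (y d) : ℝ)) ∂P‖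
      ≤ N * (4 * |τ| ^ 3 + τ ^ 4) + τ ^ 2 / 2 * √(N * covConst P ξ)
        + |τ ^ 2 / 2 * ∑ d ∈ Finset.range N, condVar f ν s (y d) - c| := by
  have hZ := isCentredFunctional_Ftilde f s hξ hstat y
  have hH := isCentredFunctional_bernoulliVar f s hξ hstat y
  have mZ : ∀ d, Measurable fun ω => Ftilde f ν s (ξ d ω) (y d) := fun d => hZ.measurable_of hξ d
  have mF : ∀ d, Measurable fun ω => F f ν s (ξ d ω) (y d) := fun d =>
    (measurable_F f s).comp ((hξ d).prodMk measurable_const)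
  rw [← integral_const_mul]
  have hprodle : ∀ ω, ‖∏ d ∈ Finset.range N,
          (Complex.exp (Complex.I * (τ * Ftilde f ν s (ξ d ω) (y d) : ℝ))
            * (Complex.exp (-(Complex.I * (τ * F f ν s (ξ d ω) (y d) : ℝ)))
              * ((F f ν s (ξ d ω) (y d) : ℂ) * Complex.exp (Complex.I * (τ : ℝ))
                + (1 - (F f ν s (ξ d ω) (y d) : ℂ)))))‖ ≤ 1 := by
    intro ω
    rw [norm_prod]
    refine Finset.prod_le_one (fun _ _ => norm_nonneg _) fun d _ => ?_
    rw [norm_mul, Complex.norm_exp_I_mul_ofReal, one_mul]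
    exact norm_bernoulli_le_one τ (F_nonneg f s _ _) (F_le_one f s _ _)
  rw [← integral_sub]
  rotate_left
  · exact Integrable.of_bound (Measurable.aestronglyMeasurable
      (Finset.measurable_prod _ fun d _ => by
        have := mZ d
        have := mF d
        fun_prop)) 1 (Eventually.of_forall hprodle)
  · refine (Integrable.of_bound (C := 1) (Measurable.aestronglyMeasurable ?_)
      (Eventually.of_forall fun ω => (Complex.norm_exp_I_mul_ofReal _).le)).const_mul _
    have := hZ.measurable_sum hξ (Finset.range N)
    fun_prop
  have hi : Integrable (fun ω => |∑ d ∈ Finset.range N, (F f ν s (ξ d ω) (y d)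
      - F f ν s (ξ d ω) (y d) ^ 2 - condVar f ν s (y d))|) P := by
    simpa using (hH.integrable_sum_pow hξ (Finset.range N) 1).abs
  have i1 : Integrable (fun ω => N * (4 * |τ| ^ 3 + τ ^ 4) + τ ^ 2 / 2 *
      |∑ d ∈ Finset.range N, (F f ν s (ξ d ω) (y d)
        - F f ν s (ξ d ω) (y d) ^ 2 - condVar f ν s (y d))|) P :=
    (integrable_const _).add (hi.const_mul _)
  have i2 : Integrable (fun ω => N * (4 * |τ| ^ 3 + τ ^ 4) + τ ^ 2 / 2 *
      |∑ d ∈ Finset.range N, (F f ν s (ξ d ω) (y d)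
        - F f ν s (ξ d ω) (y d) ^ 2 - condVar f ν s (y d))|
      + |τ ^ 2 / 2 * ∑ d ∈ Finset.range N, condVar f ν s (y d) - c|) P :=
    i1.add (integrable_const _)
  refine (norm_integral_le_of_norm_le i2 (Eventually.of_forall fun ω => ?_)).trans ?_
  · set Z : ℕ → ℝ := fun d => Ftilde f ν s (ξ d ω) (y d)
    set G : ℕ → ℝ := fun d => F f ν s (ξ d ω) (y d)
    have hG0 : ∀ d, 0 ≤ G d := fun d => F_nonneg f s _ _
    have hG1 : ∀ d, G d ≤ 1 := fun d => F_le_one f s _ _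
    have hV0 : ∀ d, 0 ≤ G d - G d ^ 2 := fun d => bernoulliVar_nonneg f s _ _
    have hexp : ∏ d ∈ Finset.range N, (Complex.exp (Complex.I * (τ * Z d : ℝ))
          * (Real.exp (-(τ ^ 2 / 2 * (G d - G d ^ 2))) : ℂ))
        = Complex.exp (Complex.I * (τ * ∑ d ∈ Finset.range N, Z d : ℝ))
          * (Real.exp (-(τ ^ 2 / 2 * ∑ d ∈ Finset.range N, (G d - G d ^ 2))) : ℂ) := by
      rw [Finset.prod_mul_distrib, ← Complex.exp_sum, ← Finset.mul_sum, ← Complex.ofReal_sum,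
        ← Finset.mul_sum, ← Complex.ofReal_prod, ← Real.exp_sum, Finset.sum_neg_distrib,
        ← Finset.mul_sum]
    have hle1 : ∀ {x : ℝ}, 0 ≤ x → ‖(Real.exp (-x) : ℂ)‖ ≤ 1 := by
      intro x hx
      rw [Complex.norm_real, Real.norm_of_nonneg (Real.exp_pos _).le, Real.exp_le_one_iff]
      linarith
    -- For a fixed path, each centred Bernoulli factor is replaced by the Gaussian one of the same
    -- variance, leaving the phases untouched.
    have s1 := norm_prod_sub_prod_le (Finset.range N)
      (a := fun d => Complex.exp (Complex.I * (τ * Z d : ℝ))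
        * (Complex.exp (-(Complex.I * (τ * G d : ℝ)))
          * ((G d : ℂ) * Complex.exp (Complex.I * (τ : ℝ)) + (1 - (G d : ℂ)))))
      (b := fun d => Complex.exp (Complex.I * (τ * Z d : ℝ))
          * (Real.exp (-(τ ^ 2 / 2 * (G d - G d ^ 2))) : ℂ))
      (fun d _ => by
        rw [norm_mul, Complex.norm_exp_I_mul_ofReal, one_mul]
        exact norm_bernoulli_le_one τ (hG0 d) (hG1 d))
      (fun d _ => by
        rw [norm_mul, Complex.norm_exp_I_mul_ofReal, one_mul]
        exact hle1 (mul_nonneg (by positivity) (hV0 d)))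
    have s2 : ∑ d ∈ Finset.range N, ‖Complex.exp (Complex.I * (τ * Z d : ℝ))
        * (Complex.exp (-(Complex.I * (τ * G d : ℝ)))
          * ((G d : ℂ) * Complex.exp (Complex.I * (τ : ℝ)) + (1 - (G d : ℂ))))
        - Complex.exp (Complex.I * (τ * Z d : ℝ))
          * (Real.exp (-(τ ^ 2 / 2 * (G d - G d ^ 2))) : ℂ)‖ ≤ N * (4 * |τ| ^ 3 + τ ^ 4) := by
      refine (Finset.sum_le_card_nsmul _ _ (4 * |τ| ^ 3 + τ ^ 4) fun d _ => ?_).trans ?_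
      · rw [← mul_sub, norm_mul, Complex.norm_exp_I_mul_ofReal, one_mul]
        exact norm_bernoulli_sub_exp_le τ (hG0 d) (hG1 d)
      · rw [Finset.card_range, nsmul_eq_mul]
    -- The random conditional variance is compared with its mean, then with the constant `c`. The
    -- first difference is a sum of centred functionals, whose expected absolute value is at most
    -- `√(N C)`.
    have s3 : ‖Complex.exp (Complex.I * (τ * ∑ d ∈ Finset.range N, Z d : ℝ))
          * (Real.exp (-(τ ^ 2 / 2 * ∑ d ∈ Finset.range N, (G d - G d ^ 2))) : ℂ)
        - Real.exp (-c) * Complex.exp (Complex.I * (τ * ∑ d ∈ Finset.range N, Z d : ℝ))‖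
        ≤ τ ^ 2 / 2 * |∑ d ∈ Finset.range N, (G d - G d ^ 2 - condVar f ν s (y d))|
          + |τ ^ 2 / 2 * ∑ d ∈ Finset.range N, condVar f ν s (y d) - c| := by
      rw [mul_comm (Real.exp (-c) : ℂ), ← mul_sub, norm_mul, Complex.norm_exp_I_mul_ofReal,
        one_mul, ← Complex.ofReal_sub, Complex.norm_real, Real.norm_eq_abs]
      refine (abs_exp_neg_sub_exp_neg_le (mul_nonneg (by positivity)
        (Finset.sum_nonneg fun d _ => hV0 d)) hc).trans ?_
      rw [Finset.sum_sub_distrib (fun d => G d - G d ^ 2) (fun d => condVar f ν s (y d)),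
        ← abs_of_nonneg (show 0 ≤ τ ^ 2 / 2 by positivity), ← abs_mul,
        abs_of_nonneg (show 0 ≤ τ ^ 2 / 2 by positivity)]
      refine (abs_sub_le _ (τ ^ 2 / 2 * ∑ d ∈ Finset.range N, condVar f ν s (y d)) _).trans ?_
      rw [← mul_sub]
    rw [hexp] at s1
    refine (norm_sub_le_norm_sub_add_norm_sub _ _ _).trans
      ((add_le_add (s1.trans s2) s3).trans (le_of_eq ?_))
    ring
  · rw [integral_add i1 (integrable_const _),
      integral_add (integrable_const _) (hi.const_mul _)]
    simp only [integral_const, probReal_univ, one_smul]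
    rw [integral_const_mul]
    have := hH.integral_abs_sum_le hξ hα (Finset.range N)
    rw [Finset.card_range] at this
    gcongr

lemma sum_sq_eq_sum_diagonals (z : ℕ → ℕ → ℝ) (hz : ∀ i j, z i j = z j i) (N : ℕ) :
    ∑ d ∈ Finset.range N, ∑ d' ∈ Finset.range N, z d d'
      = ∑ d ∈ Finset.range N, z d d
        + 2 * ∑ k ∈ Finset.range N, ∑ d ∈ Finset.range (N - (k + 1)), z d (d + (k + 1)) := by
  induction N with
  | zero => simp
  | succ N ih =>
    have e1 : ∑ k ∈ Finset.range (N + 1), ∑ d ∈ Finset.range (N + 1 - (k + 1)), z d (d + (k + 1))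
        = ∑ k ∈ Finset.range N, ∑ d ∈ Finset.range (N - (k + 1)), z d (d + (k + 1))
          + ∑ d ∈ Finset.range N, z d N := by
      -- From `N` to `N + 1`, each diagonal `k < N` gains the one entry `z (N - (k + 1)) N`;
      -- reversing the order of `k` lists these entries as the new column.
      rw [Finset.sum_range_succ, Nat.sub_self, Finset.range_zero, Finset.sum_empty, add_zero,
        ← Finset.sum_range_reflect (fun d => z d N) N, ← Finset.sum_add_distrib]
      refine Finset.sum_congr rfl fun k hk => ?_
      have hk' := Finset.mem_range.1 hk
      have e : N + 1 - (k + 1) = N - (k + 1) + 1 := by omega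
      rw [e, Finset.sum_range_succ]
      congr 2 <;> omega
    have e2 : ∑ d ∈ Finset.range N, z N d = ∑ d ∈ Finset.range N, z d N :=
      Finset.sum_congr rfl fun d _ => hz _ _
    rw [e1, Finset.sum_range_succ, Finset.sum_range_succ (fun d' => z N d'),
      Finset.sum_range_succ (fun d => z d d)]
    simp_rw [Finset.sum_range_succ (fun d' => z _ d')]
    rw [Finset.sum_add_distrib, ih, e2]
    ring

/-- The rescaled variances of the sums of the `F̃_s(ξ_d, y_d)` converge to `ρ(s)²`. -/
lemma tendsto_variance (hξ : ∀ ℓ, Measurable (ξ ℓ)) (hstat : IsPairStationary P ξ ν)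
    (hα : Summable fun n : ℕ => alpha P ξ (n + 1)) {y : ℕ → ℕ → ℝ≥0}
    (h0 : Tendsto (fun n : ℕ => (∑ d ∈ Finset.range (2 * n - 1),
      covFtilde f ν P ξ s 0 (y n d) (y n d)) / (2 * n)) atTop
        (𝓝 (∫ u, covFtilde f ν P ξ s 0 u u ∂μ)))
    (hk : ∀ k : ℕ, Tendsto (fun n : ℕ => (∑ d ∈ Finset.range (2 * n - 1 - (k + 1)),
      covFtilde f ν P ξ s (k + 1) (y n d) (y n (d + (k + 1)))) / (2 * n)) atTop
        (𝓝 (∫ z, covFtilde f ν P ξ s (k + 1) z.1 z.2 ∂(μ.prod μ)))) :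
    Tendsto (fun n : ℕ => (∫ ω, (∑ d ∈ Finset.range (2 * n - 1),
      Ftilde f ν s (ξ d ω) (y n d)) ^ 2 ∂P) / (2 * n)) atTop (𝓝 (rhoSq f μ ν P ξ s)) := by
  have hlim : Tendsto (fun n : ℕ => ∑' k : ℕ, (∑ d ∈ Finset.range (2 * n - 1 - (k + 1)),
      covFtilde f ν P ξ s (k + 1) (y n d) (y n (d + (k + 1)))) / (2 * n)) atTop
      (𝓝 (∑' k : ℕ, covTerm f μ ν P ξ s (k + 1))) := by
    -- Each lag has at most `2 n` terms of size at most `4 α_{k+1}`, so after division by `2 n` the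
    -- bound is uniform in `n`.
    refine tendsto_tsum_of_dominated_convergence (bound := fun k => 4 * alpha P ξ (k + 1))
      (hα.mul_left 4) (fun k => ?_) (Eventually.of_forall fun n k => ?_)
    · rw [covTerm_eq_integral_covFtilde f s hξ]
      exact hk k
    · have ha : 0 ≤ 4 * alpha P ξ (k + 1) := mul_nonneg (by norm_num) (alpha_nonneg _)
      rcases Nat.eq_zero_or_pos n with rfl | hn
      · simpa using ha
      have hn' : (0 : ℝ) < 2 * n := by positivity
      rw [norm_div, Real.norm_of_nonneg hn'.le, div_le_iff₀ hn']
      refine (norm_sum_le _ _).trans ((Finset.sum_le_card_nsmul _ _ _ fun d _ =>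
        abs_covFtilde_le_alpha f s hξ hstat k _ _).trans ?_)
      rw [Finset.card_range, nsmul_eq_mul, mul_comm]
      refine mul_le_mul_of_nonneg_left ?_ ha
      have : 2 * n - 1 - (k + 1) ≤ 2 * n := by omega
      exact_mod_cast this
  have hsum := h0.add (hlim.const_mul 2)
  rw [rhoSq, integral_Ftilde_sq_eq f s hξ hstat]
  refine hsum.congr fun n => ?_
  have hZ := isCentredFunctional_Ftilde f s hξ hstat (y n)
  rw [hZ.integral_sum_sq_eq hξ, sum_sq_eq_sum_diagonals
    (fun d d' => ∫ ω, Ftilde f ν s (ξ d ω) (y n d) * Ftilde f ν s (ξ d' ω) (y n d') ∂P)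
    (fun i j => IsCentredFunctional.integral_mul_comm
      (Z := fun d ω => Ftilde f ν s (ξ d ω) (y n d)) i j)]
  have e0 : ∀ d, ∫ ω, Ftilde f ν s (ξ d ω) (y n d) * Ftilde f ν s (ξ d ω) (y n d) ∂P
      = covFtilde f ν P ξ s 0 (y n d) (y n d) := fun d =>
    integral_Ftilde_mul_Ftilde f s hξ hstat d 0 _ _
  simp_rw [e0, integral_Ftilde_mul_Ftilde f s hξ hstat]
  -- Lags with `k ≥ 2 n - 1` have no pair of days, so the series is finite for each `n`.
  rw [tsum_eq_sum (s := Finset.range (2 * n - 1)) fun k hk => ?_]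
  · rw [← Finset.sum_div]
    ring
  · have : 2 * n - 1 - (k + 1) = 0 := by
      rw [Finset.mem_range] at hk
      omega
    rw [this]
    simp

/-- Only countably many averages are needed, one for each lag besides two single-day ones, so a
single null set of strengths is discarded. -/
lemma ae_tendsto_averages (hξ : ∀ ℓ, Measurable (ξ ℓ)) (C : ∀ n : ℕ, Calendar (2 * n - 1)) :
    ∀ᵐ S ∂(Measure.infinitePi fun _ : ℕ => μ),
      Tendsto (fun n : ℕ => (∑ d ∈ Finset.range (2 * n - 1),
        condVar f ν s (S ((C n).opponent d))) / (2 * n)) atTop (𝓝 (sigmaSq f μ ν s)) ∧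
      Tendsto (fun n : ℕ => (∑ d ∈ Finset.range (2 * n - 1),
        covFtilde f ν P ξ s 0 (S ((C n).opponent d)) (S ((C n).opponent d))) / (2 * n)) atTop
          (𝓝 (∫ u, covFtilde f ν P ξ s 0 u u ∂μ)) ∧
      ∀ k : ℕ, Tendsto (fun n : ℕ => (∑ d ∈ Finset.range (2 * n - 1 - (k + 1)),
        covFtilde f ν P ξ s (k + 1) (S ((C n).opponent d)) (S ((C n).opponent (d + (k + 1)))))
          / (2 * n)) atTop (𝓝 (∫ z, covFtilde f ν P ξ s (k + 1) z.1 z.2 ∂(μ.prod μ))) := by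
  have ho : ∀ n, Set.InjOn (C n).opponent (Set.Iio (2 * n - 1)) := fun n => (C n).injOn_opponent
  have h1 := ae_tendsto_average (μ := μ) ho (measurable_condVar f (ν := ν) s) fun y =>
    abs_le.2 ⟨by linarith [condVar_nonneg f (ν := ν) s y], condVar_le_one f s y⟩
  have h2 := ae_tendsto_average (μ := μ) ho (g := fun u => covFtilde f ν P ξ s 0 u u)
    ((measurable_covFtilde f s hξ 0).comp (measurable_id.prodMk measurable_id))
    fun y => abs_covFtilde_le_one f s 0 y y
  have h3 := ae_all_iff.2 fun k : ℕ => ae_tendsto_pair_average (μ := μ) ho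
    (measurable_covFtilde f (ν := ν) (P := P) s hξ (k + 1))
    (fun z => abs_covFtilde_le_one f s (k + 1) z.1 z.2) (Nat.succ_pos k)
  filter_upwards [h1, h2, h3] with S a1 a2 a3
  refine ⟨?_, a2, a3⟩
  rw [sigmaSq_eq_integral_condVar]
  exact a1

/-- A limit of rescaled variances is nonnegative; one good sequence `S` suffices, and almost every
one is good. -/
lemma rhoSq_nonneg (hξ : ∀ ℓ, Measurable (ξ ℓ)) (hstat : IsPairStationary P ξ ν)
    (hα : Summable fun n : ℕ => alpha P ξ (n + 1)) (C : ∀ n : ℕ, Calendar (2 * n - 1)) :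
    0 ≤ rhoSq f μ ν P ξ s := by
  obtain ⟨S, -, h0, hk⟩ := (ae_tendsto_averages f (μ := μ) (ν := ν) (P := P) s hξ C).exists
  refine ge_of_tendsto' (tendsto_variance f s hξ hstat hα
    (y := fun n d => S ((C n).opponent d)) h0 hk) fun n => ?_
  exact div_nonneg (integral_nonneg fun ω => sq_nonneg _) (by positivity)

lemma tendsto_charFun_normalizedWins (hξ : ∀ ℓ, Measurable (ξ ℓ))
    (hstat : IsPairStationary P ξ ν) (hα : Summable fun n : ℕ => alpha P ξ (n + 1))
    (C : ∀ n : ℕ, Calendar (2 * n - 1)) {S : ℕ → ℝ≥0}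
    (hσ : Tendsto (fun n : ℕ => (∑ d ∈ Finset.range (2 * n - 1),
        condVar f ν s (S ((C n).opponent d))) / (2 * n)) atTop (𝓝 (sigmaSq f μ ν s)))
    (hρ : Tendsto (fun n : ℕ => (∫ ω, (∑ d ∈ Finset.range (2 * n - 1),
      Ftilde f ν s (ξ d ω) (S ((C n).opponent d))) ^ 2 ∂P) / (2 * n)) atTop
        (𝓝 (rhoSq f μ ν P ξ s))) (t : ℝ) :
    Tendsto (fun n : ℕ => ∫ r, Complex.exp (Complex.I * (t * normalizedWins n
        (quenchedLaw f (pathLaw P ξ hξ) (C n) s S) r : ℝ))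
        ∂(quenchedLaw f (pathLaw P ξ hξ) (C n) s S)) atTop
      (𝓝 (Real.exp (-(t ^ 2 / 2 * (sigmaSq f μ ν s + rhoSq f μ ν P ξ s))) : ℂ)) := by
  set c : ℝ := t ^ 2 / 2 * sigmaSq f μ ν s with hc
  have hc0 : 0 ≤ c := mul_nonneg (by positivity) (sigmaSq_nonneg f s)
  let τ : ℕ → ℝ := fun n => t / √((2 * n : ℕ) : ℝ)
  let I₁ : ℕ → ℂ := fun n => ∫ ω, Complex.exp (Complex.I *
          (τ n * ∑ d ∈ Finset.range (2 * n - 1),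
            Ftilde f ν s (ξ d ω) (S ((C n).opponent d)) : ℝ)) ∂P
  have hτsq : ∀ n, τ n ^ 2 = t ^ 2 * (1 / ((2 * n : ℕ) : ℝ)) := by
    intro n
    simp only [τ]
    rw [div_pow, Real.sq_sqrt (Nat.cast_nonneg _)]
    ring
  have hL : Tendsto (fun n : ℕ => 2 * n) atTop atTop :=
    tendsto_atTop_mono (fun n => by simp only [id]; omega) tendsto_id
  have hinv : Tendsto (fun n : ℕ => 1 / ((2 * n : ℕ) : ℝ)) atTop (𝓝 0) :=
    (tendsto_one_div_atTop_nhds_zero_nat (𝕜 := ℝ)).comp hL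
  have hτ0 : Tendsto τ atTop (𝓝 0) := by
    have h2 : Tendsto (fun n => τ n ^ 2) atTop (𝓝 0) := by
      simp_rw [hτsq]
      simpa using hinv.const_mul (t ^ 2)
    have h3 := h2.sqrt
    simp_rw [Real.sqrt_sq_eq_abs, Real.sqrt_zero] at h3
    exact (tendsto_zero_iff_abs_tendsto_zero _).2 h3
  -- Each error term of the conditional approximation that has a factor `N` also has at least `√N
  -- τ²`; this bound therefore leaves a spare power of `τ`.
  have hNτ : ∀ n : ℕ, ((2 * n - 1 : ℕ) : ℝ) * τ n ^ 2 ≤ t ^ 2 := by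
    intro n
    rw [hτsq]
    have h1 : ((2 * n - 1 : ℕ) : ℝ) ≤ ((2 * n : ℕ) : ℝ) := by exact_mod_cast Nat.sub_le _ _
    have h2 : ((2 * n - 1 : ℕ) : ℝ) * (1 / ((2 * n : ℕ) : ℝ)) ≤ 1 := by
      rw [mul_one_div]
      exact div_le_one_of_le₀ h1 (Nat.cast_nonneg _)
    calc _ = t ^ 2 * (((2 * n - 1 : ℕ) : ℝ) * (1 / ((2 * n : ℕ) : ℝ))) := by ring
      _ ≤ t ^ 2 * 1 := mul_le_mul_of_nonneg_left h2 (sq_nonneg t)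
      _ = _ := mul_one _
  -- the sum of the strengths
  have hI₁ : Tendsto I₁ atTop (𝓝 (Real.exp (-(t ^ 2 / 2 * rhoSq f μ ν P ξ s)) : ℂ)) := by
    have h1 := tendsto_charFun_sub_exp hξ hα
      (fun n => isCentredFunctional_Ftilde f s hξ hstat fun d => S ((C n).opponent d))
      (N := fun n => 2 * n - 1) (L := fun n => 2 * n) (fun n => Nat.sub_le _ _) hL t
    have h2 : Tendsto (fun n : ℕ => ((Real.exp (-((t / √((2 * n : ℕ) : ℝ)) ^ 2 / 2 *
        ∫ ω, (∑ d ∈ Finset.range (2 * n - 1),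
          Ftilde f ν s (ξ d ω) (S ((C n).opponent d))) ^ 2 ∂P)) : ℝ) : ℂ)) atTop
        (𝓝 (Real.exp (-(t ^ 2 / 2 * rhoSq f μ ν P ξ s)) : ℂ)) := by
      refine (Complex.continuous_ofReal.tendsto _).comp
        ((Real.continuous_exp.tendsto _).comp (Tendsto.neg ?_))
      refine (hρ.const_mul (t ^ 2 / 2)).congr fun n => ?_
      have := hτsq n
      simp only [τ] at this
      rw [this]
      push_cast
      ring
    have h3 := h1.add h2
    rw [zero_add] at h3
    refine h3.congr fun n => ?_
    simp [I₁, τ]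
  -- the results given the strengths
  have hdiff : Tendsto (fun n : ℕ => ∫ r, Complex.exp (Complex.I * (t * normalizedWins n
        (quenchedLaw f (pathLaw P ξ hξ) (C n) s S) r : ℝ))
        ∂(quenchedLaw f (pathLaw P ξ hξ) (C n) s S) - Real.exp (-c) * I₁ n) atTop (𝓝 0) := by
    have hbound : Tendsto (fun n : ℕ => t ^ 2 * (4 * |τ n| + τ n ^ 2)
        + √(t ^ 2 * covConst P ξ) * |τ n|
        + |t ^ 2 / 2 * ((∑ d ∈ Finset.range (2 * n - 1),
          condVar f ν s (S ((C n).opponent d))) / (2 * n)) - c|) atTop (𝓝 0) := by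
      have ha : Tendsto (fun n => |τ n|) atTop (𝓝 0) := by simpa using hτ0.abs
      have hb : Tendsto (fun n => |t ^ 2 / 2 * ((∑ d ∈ Finset.range (2 * n - 1),
          condVar f ν s (S ((C n).opponent d))) / (2 * n)) - c|) atTop (𝓝 0) := by
        have := ((hσ.const_mul (t ^ 2 / 2)).sub_const c).abs
        rwa [← hc, sub_self, abs_zero] at this
      simpa using ((((ha.const_mul 4).add (hτ0.pow 2)).const_mul (t ^ 2)).add
        (ha.const_mul √(t ^ 2 * covConst P ξ))).add hb
    refine squeeze_zero_norm (fun n => ?_) hbound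
    have e1 : ∀ r, (t * normalizedWins n (quenchedLaw f (pathLaw P ξ hξ) (C n) s S) r : ℝ)
        = τ n * ((wins r : ℝ)
          - ∫ r', (wins r' : ℝ) ∂(quenchedLaw f (pathLaw P ξ hξ) (C n) s S)) := by
      intro r
      simp only [normalizedWins, τ]
      push_cast
      ring
    simp_rw [e1]
    rw [integral_exp_centred_wins f s hξ hstat]
    refine (norm_integral_prod_bernoulli_sub_le f s hξ hstat hα
      (fun d => S ((C n).opponent d)) (2 * n - 1) (τ n) hc0).trans ?_
    have hC := one_le_covConst (P := P) (ξ := ξ)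
    refine add_le_add (add_le_add ?_ ?_) (le_of_eq ?_)
    · have h0 : 0 ≤ 4 * |τ n| + τ n ^ 2 := by positivity
      calc ((2 * n - 1 : ℕ) : ℝ) * (4 * |τ n| ^ 3 + τ n ^ 4)
          = ((2 * n - 1 : ℕ) : ℝ) * τ n ^ 2 * (4 * |τ n| + τ n ^ 2) := by
            rw [← sq_abs (τ n), show τ n ^ 4 = |τ n| ^ 4 by
              rw [← abs_pow, abs_of_nonneg (by positivity)]]
            ring
        _ ≤ _ := mul_le_mul_of_nonneg_right (hNτ n) h0
    · have h1 : τ n ^ 2 / 2 * √(((2 * n - 1 : ℕ) : ℝ) * covConst P ξ)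
          = 1 / 2 * (√(((2 * n - 1 : ℕ) : ℝ) * τ n ^ 2 * covConst P ξ) * |τ n|) := by
        have : ((2 * n - 1 : ℕ) : ℝ) * τ n ^ 2 * covConst P ξ
            = τ n ^ 2 * (((2 * n - 1 : ℕ) : ℝ) * covConst P ξ) := by ring
        rw [this, Real.sqrt_mul (sq_nonneg _), Real.sqrt_sq_eq_abs, ← sq_abs]
        ring
      rw [h1]
      have h2 : √(((2 * n - 1 : ℕ) : ℝ) * τ n ^ 2 * covConst P ξ) ≤ √(t ^ 2 * covConst P ξ) :=
        Real.sqrt_le_sqrt (mul_le_mul_of_nonneg_right (hNτ n) (by linarith))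
      have h3 := mul_le_mul_of_nonneg_right h2 (abs_nonneg (τ n))
      have h4 : 0 ≤ √(((2 * n - 1 : ℕ) : ℝ) * τ n ^ 2 * covConst P ξ) * |τ n| := by positivity
      linarith
    · rw [hτsq]
      push_cast
      congr 2
      ring
  have hfin := hdiff.add (hI₁.const_mul (Real.exp (-c) : ℂ))
  rw [zero_add, ← Complex.ofReal_mul, ← Real.exp_add] at hfin
  have hsum : -c + -(t ^ 2 / 2 * rhoSq f μ ν P ξ s)
      = -(t ^ 2 / 2 * (sigmaSq f μ ν s + rhoSq f μ ν P ξ s)) := by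
    rw [hc]; ring
  rw [hsum] at hfin
  refine hfin.congr fun n => ?_
  ring

end QuenchedCLT

end League

end

/-! ### The limit theorem, by Lévy's continuity theorem. -/

theorem theorem2 {Ω : Type*} [MeasurableSpace Ω] (P : Measure Ω) [IsProbabilityMeasure P]
    (ξ : ℕ → Ω → ℝ≥0) (hξ : ∀ ℓ, Measurable (ξ ℓ))
    (μ ν : Measure ℝ≥0) [IsProbabilityMeasure μ] [IsProbabilityMeasure ν]
    (hstat : League.IsPairStationary P ξ ν) (hweak : League.IsWeaklyMixing P ξ)
    (hmix : League.CLTMixing P ξ)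
    (f : League.WinFunction)
    -- the calendar of the league with `2 n` teams, for every `n`
    (C : ∀ n : ℕ, League.Calendar (2 * n - 1))
    (s : ℝ≥0) :
    League.sigmaSq f μ ν s =
        League.ell f μ ν s - ∫ z, League.F f ν s z.1 z.2 ^ 2 ∂(ν.prod μ) ∧
      Summable (fun k : ℕ => League.covTerm f μ ν P ξ s (k + 1)) ∧
      0 ≤ League.sigmaSq f μ ν s ∧ 0 ≤ League.rhoSq f μ ν P ξ s ∧
      ∀ᵐ S ∂(Measure.infinitePi fun _ : ℕ => μ),
        TendstoInDistribution
          (fun n => League.normalizedWins n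
            (League.quenchedLaw f (League.pathLaw P ξ hξ) (C n) s S))
          atTop (id : ℝ → ℝ)
          (fun n => League.quenchedLaw f (League.pathLaw P ξ hξ) (C n) s S)
          (gaussianReal 0 (League.sigmaSq f μ ν s + League.rhoSq f μ ν P ξ s).toNNReal) := by
  have hα := hmix.summable_alpha
  have hσ0 : 0 ≤ League.sigmaSq f μ ν s := League.sigmaSq_nonneg f s
  have hρ0 : 0 ≤ League.rhoSq f μ ν P ξ s := League.rhoSq_nonneg f s hξ hstat hα C
  refine ⟨League.sigmaSq_eq_ell_sub f s, League.summable_covTerm f s hξ hstat hα, hσ0, hρ0, ?_⟩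
  -- The exceptional set does not depend on `t`: for each remaining `S` the characteristic functions
  -- converge at every point.
  filter_upwards [League.ae_tendsto_averages f (μ := μ) (ν := ν) (P := P) s hξ C]
    with S ⟨h1, h2, h3⟩
  have hm : ∀ n, AEMeasurable (League.normalizedWins n
      (League.quenchedLaw f (League.pathLaw P ξ hξ) (C n) s S))
      (League.quenchedLaw f (League.pathLaw P ξ hξ) (C n) s S) := fun n =>
    (measurable_of_finite _).aemeasurable
  refine ⟨hm, aemeasurable_id, ProbabilityMeasure.tendsto_iff_tendsto_charFun.2 fun t => ?_⟩
  have key := League.tendsto_charFun_normalizedWins f s hξ hstat hα C h1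
    (League.tendsto_variance f s hξ hstat hα (y := fun n d => S ((C n).opponent d)) h2 h3) t
  have hlim : charFun ((gaussianReal 0
      (League.sigmaSq f μ ν s + League.rhoSq f μ ν P ξ s).toNNReal).map id) t
      = (Real.exp (-(t ^ 2 / 2 * (League.sigmaSq f μ ν s + League.rhoSq f μ ν P ξ s))) : ℂ) := by
    rw [Measure.map_id, charFun_gaussianReal, Real.coe_toNNReal _ (add_nonneg hσ0 hρ0)]
    push_cast
    congr 1
    ring
  simp only [ProbabilityMeasure.coe_mk]
  rw [hlim]
  refine key.congr fun n => ?_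
  rw [charFun_apply_real, integral_map (hm n) (Measurable.aestronglyMeasurable (by fun_prop))]
  refine integral_congr_ae (Eventually.of_forall fun r => ?_)
  simp only
  congr 1
  push_cast
  ring
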